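/- **Setting.** Let $\Omega\subseteq\mathbb R^d$, let $K:\Omega\times\Omega\to\mathbb R$ be symmetric and positive definite (all kernel matrices of pairwise distinct points are positive definite) with $K(x,x)\le 1$, and let $\mathcal H$ be its reproducing kernel Hilbert space. Let $\mathcal A\subseteq\Omega$ be a non-empty set of arms such that $K(\cdot,\xi)$ is measurable on $\mathcal A$ for every $\xi\in\mathcal A$ (automatic if $\mathcal A$ is finite or $K$ is continuous), and let $f\in\mathcal H$ with $\|f\|_{\mathcal H}\le B$. In round $t=1,\dots,T$ ($T\ge1$) the learner selects $x_t\in\mathcal A$ and observes $y_t=f(x_t)+\varepsilon_t$, where, for a filtration $(\mathcal F_t)$, $x_t$ is $\mathcal F_t$-measurable, $y_t$ is $\mathcal F_{t+1}$-measurable, and the noise is conditionally $R$-sub-Gaussian ($R\ge 0$): $e^{u\varepsilon_t}$ is integrable and $\mathbb E[e^{u\varepsilon_t}\mid\mathcal F_t]\le e^{u^2R^2/2}$ almost surely for all $u\in\mathbb R$. The regret is $R(T)=\sup_{x\in\mathcal A}\sum_{t=1}^T(f(x)-f(x_t))$. **$P$-greedy algorithm** with candidate set $\mathcal A$ and error $\mathfrak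 e>0$. Put $P_m^2(x)=K(x,x)-\sum_{k=1}^m N_k(x)^2$. For $m=0,1,2,\dots$ choose $\xi_{m+1}\in\operatorname{argmax}_{x\in\mathcal A}P_m^2(x)$, set $N_{m+1}(x)=\bigl(K(x,\xi_{m+1})-\sum_{k=1}^mN_k(\xi_{m+1})N_k(x)\bigr)/\sqrt{P_m^2(\xi_{m+1})}$, and stop as soon as $P_{m+1}^2<\mathfrak e^2$ on $\mathcal A$. For $\mathfrak e=\alpha/T^q$ let $D=D_{q,\alpha}(T)\ge1$ be the number of selected points, and put $\tilde x=(N_1(x),\dots,N_D(x))\in\mathbb R^D$. **APG-UCB** with parameters $\lambda,R,B,\delta,\alpha,q$. Run the $P$-greedy algorithm with $\mathfrak e=\alpha/T^q$, put $\epsilon=B\mathfrak e$, and for $t=0,\dots,T-1$ select $$x_{t+1}\in\operatorname*{argmax}_{x\in\mathcal A}\Bigl\{\langle\tilde x,\hat\theta_t\rangle+\|\tilde x\|_{A_t^{-1}}(\beta_t+\epsilon\psi_t)\Bigr\},$$ where $A_t=\lambda 1_D+\sum_{s\le t}\tilde x_s\tilde x_s^{\mathrm T}$ with $\tilde x_s=(N_1(x_s),\dots,N_D(x_s))$,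 $\hat\theta_t=A_t^{-1}\sum_{s\le t}y_s\tilde x_s$, $\|v\|_{A^{-1}}=\sqrt{v^{\mathrm T}A^{-1}v}$, $\beta_t=R\sqrt{\log(\det(\lambda^{-1}A_t)/\delta^2)}+\sqrt\lambda B$ and $\psi_t=\sum_{s=1}^t\|\tilde x_s\|_{A_{s-1}^{-1}}$. Ties in both argmax rules may be broken arbitrarily. **Theorem.** Let $\lambda\ge1$, $q\ge1/2$, $\alpha>0$ and $0<\delta<1$. (i) There are a universal exponent $c$ and a constant $C$ depending only on $R,B,\lambda,\alpha$ such that, for every run of APG-UCB as above, with probability at least $1-\delta$, $$R(T)\le C\,\log^c(T+1)\Bigl(\sqrt{T\,D_{q,\alpha}(T)\log(1/\delta)}+D_{q,\alpha}(T)\sqrt T\Bigr).$$ (ii) If $\mathcal A$ is finite, the total computational complexity of APG-UCB is $O(|\mathcal A|\,T\,D_{q,\alpha}(T)^2)$: there are a single program for a real RAM and a universal constant $C'$ such that for all inputs as above (including every sequence of observed rewards) the program carries out a complete run of APG-UCB in at most $C'|\mathcal A|\,T\,D_{q,\alpha}(T)^2$ steps, where $D_{q,\alpha}(T)$ is the number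 of points selected in that run. Here every arithmetic operation, square root, logarithm, comparison, memory access, kernel evaluation, loop iteration and interaction with the environment is a step. -/

import Mathlib

open MeasureTheory ProbabilityTheory
open scoped Matrix

namespace APGUCB

noncomputable section

/-! ### Kernels and reproducing kernel Hilbert spaces -/

/-- A symmetric (strictly) positive definite kernel: every kernel matrix of pairwise distinct points
is positive definite. -/
structure IsPosDefKernel {X : Type*} (K : X → X → ℝ) : Prop where
  symm : ∀ x y, K x y = K y x
  posDef : ∀ (n : ℕ) (x : Fin n → X), Function.Injective x →
    (Matrix.of fun i j => K (x i) (x j)).PosDef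

/-- The Hilbert space `H` of real functions on `X` is the RKHS of the kernel `K`. -/
def IsRKHSOf {X : Type*} (H : Type*) [NormedAddCommGroup H] [InnerProductSpace ℝ H]
    [CompleteSpace H] [RKHS ℝ H X ℝ] (K : X → X → ℝ) : Prop :=
  ∀ x y, RKHS.kernel H x y 1 = K x y

/-! ### The `P`-greedy algorithm

Points and basis functions are numbered from `0`; only the indices below the number `D` of selected
points matter. -/

/-- The squared power function `P_m²(x) = K(x,x) - ∑_{k<m} N_k(x)²`. -/
def powerSq {X : Type*} (K : X → X → ℝ) (N : ℕ → X → ℝ) (m : ℕ) (x : X) : ℝ :=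
  K x x - ∑ k ∈ Finset.range m, N k x ^ 2

/-- `D` points `ξ 0, …, ξ (D-1)` and functions `N 0, …, N (D-1)` form a possible output of the
`P`-greedy algorithm with candidate set `A` and admissible error `e` (ties broken arbitrarily). -/
structure IsPGreedyOutput {X : Type*} (K : X → X → ℝ) (A : Set X) (e : ℝ)
    (D : ℕ) (ξ : ℕ → X) (N : ℕ → X → ℝ) : Prop where
  /-- at least one point is selected, since the stopping test comes after the first selection -/
  pos : 1 ≤ D
  mem : ∀ m < D, ξ m ∈ A
  /-- the next point maximizes the current power function over `A` -/
  greedy : ∀ m < D, ∀ x ∈ A, powerSq K N m x ≤ powerSq K N m (ξ m)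
  /-- the Newton basis -/
  newton : ∀ m < D, ∀ x, N m x =
    (K x (ξ m) - ∑ k ∈ Finset.range m, N k (ξ m) * N k x) / √(powerSq K N m (ξ m))
  /-- the stopping test fails with fewer than `D` points … -/
  continues : ∀ m, 1 ≤ m → m < D → ¬ ∀ x ∈ A, powerSq K N m x < e ^ 2
  /-- … and succeeds with `D` points -/
  stops : ∀ x ∈ A, powerSq K N D x < e ^ 2

/-- The feature vector `x̃ = (N_0(x), …, N_{D-1}(x))`. -/
def feature {X : Type*} (N : ℕ → X → ℝ) (D : ℕ) (x : X) : Fin D → ℝ := fun i => N i x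

/-! ### The modified LinUCB rule

Rounds are numbered `1, …, T`; `z s` is the feature vector of the arm of round `s` and `y s` the
reward of round `s`. -/

/-- `A_t = λ 1_D + ∑_{s=1}^t z_s z_sᵀ`. -/
def gram {D : ℕ} (lam : ℝ) (z : ℕ → Fin D → ℝ) (t : ℕ) : Matrix (Fin D) (Fin D) ℝ :=
  lam • 1 + ∑ s ∈ Finset.Icc 1 t, Matrix.vecMulVec (z s) (z s)

/-- `θ̂_t = A_t⁻¹ b_t` with `b_t = ∑_{s=1}^t y_s z_s`. -/
def thetaHat {D : ℕ} (lam : ℝ) (z : ℕ → Fin D → ℝ) (y : ℕ → ℝ) (t : ℕ) : Fin D → ℝ :=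
  (gram lam z t)⁻¹ *ᵥ ∑ s ∈ Finset.Icc 1 t, y s • z s

/-- `‖v‖_{M⁻¹} = √(vᵀ M⁻¹ v)`. -/
def invNorm {D : ℕ} (M : Matrix (Fin D) (Fin D) ℝ) (v : Fin D → ℝ) : ℝ := √(v ⬝ᵥ (M⁻¹ *ᵥ v))

/-- `β_t = R √(log (det (λ⁻¹ A_t) / δ²)) + √λ B`. -/
def beta {D : ℕ} (lam R B δ : ℝ) (z : ℕ → Fin D → ℝ) (t : ℕ) : ℝ :=
  R * √(Real.log ((lam⁻¹ • gram lam z t).det / δ ^ 2)) + √lam * B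

/-- `ψ_t = ∑_{s=1}^t ‖z_s‖_{A_{s-1}⁻¹}`. -/
def psi {D : ℕ} (lam : ℝ) (z : ℕ → Fin D → ℝ) (t : ℕ) : ℝ :=
  ∑ s ∈ Finset.Icc 1 t, invNorm (gram lam z (s - 1)) (z s)

/-- The modified upper confidence bound, after round `t`, of an arm with feature vector `v`:
`⟨v, θ̂_t⟩ + ‖v‖_{A_t⁻¹} (β_t + ε ψ_t)`. -/
def ucb {D : ℕ} (lam R B δ eps : ℝ) (z : ℕ → Fin D → ℝ) (y : ℕ → ℝ) (t : ℕ) (v : Fin D → ℝ) : ℝ :=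
  v ⬝ᵥ thetaHat lam z y t +
    invNorm (gram lam z t) v * (beta lam R B δ z t + eps * psi lam z t)

/-- The arms `x 1, …, x T` are chosen by APG-UCB with admissible error `e`, feature map given by
`N 0, …, N (D-1)`, and observed rewards `y 1, y 2, …`: in every round the arm maximizes the modified
UCB with `ε = B e` (ties broken arbitrarily). -/
def IsUCBRun {X : Type*} (A : Set X) (D : ℕ) (N : ℕ → X → ℝ) (lam R B δ e : ℝ) (T : ℕ)
    (x : ℕ → X) (y : ℕ → ℝ) : Prop :=
  ∀ t < T, x (t + 1) ∈ A ∧ ∀ a ∈ A,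
    ucb lam R B δ (B * e) (fun s => feature N D (x s)) y t (feature N D a) ≤
      ucb lam R B δ (B * e) (fun s => feature N D (x s)) y t (feature N D (x (t + 1)))

/-! ### The bandit problem -/

/-- The noise of rounds `1, …, T` is conditionally `R`-sub-Gaussian with respect to `F`. -/
def IsCondSubGaussian {S : Type*} [mS : MeasurableSpace S] (μ : Measure S)
    (F : Filtration ℕ mS) (R : ℝ) (T : ℕ) (noise : ℕ → S → ℝ) : Prop :=
  ∀ t ∈ Finset.Icc 1 T, ∀ u : ℝ,
    Integrable (fun ω => Real.exp (u * noise t ω)) μ ∧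
    ∀ᵐ ω ∂μ, (μ[fun ω' => Real.exp (u * noise t ω') | F t]) ω ≤ Real.exp (u ^ 2 * R ^ 2 / 2)

/-- `R(T) = sup_{a ∈ A} ∑_{t=1}^T (f(a) - f(x_t))`. -/
def regret {X : Type*} (A : Set X) (f : X → ℝ) (T : ℕ) (x : ℕ → X) : ℝ :=
  ⨆ a : A, ∑ t ∈ Finset.Icc 1 T, (f a - f (x t))

/-! ### A real RAM with unit costs

A structured programming language over a memory of natural numbers (for indices and counters) and
real numbers. One step is charged for every arithmetic operation, square root, logarithm, comparison,
constant, memory access, kernel evaluation, interaction with the environment and loop iteration.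
All loops are bounded, so that every program terminates. Programs are syntax: real numbers are
accessible only through the instructions below. -/

/-- Expressions for natural numbers: constants, memory cells, sums. -/
inductive NatExpr where
  | lit (c : ℕ)
  | get (arr : ℕ) (i : NatExpr)
  | add (a b : NatExpr)

/-- Expressions for real numbers. `kern i j` evaluates the kernel at the arms number `i` and `j`. -/
inductive RealExpr where
  | lit (c : ℕ)
  | get (arr : ℕ) (i j : NatExpr)
  | add (a b : RealExpr)
  | sub (a b : RealExpr)
  | mul (a b : RealExpr)
  | div (a b : RealExpr)
  | sqrt (a : RealExpr)
  | log (a : RealExpr)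
  | kern (i j : NatExpr)

/-- Comparisons. -/
inductive Test where
  | ltNat (a b : NatExpr)
  | leReal (a b : RealExpr)

/-- Programs. `play k arr i j` plays the arm number `k` and stores the reward in a real cell;
`loop v b p` runs `p` once for each value `0, 1, …, b - 1` of the counter in cell `0` of the natural
array `v`. -/
inductive Program where
  | setNat (arr : ℕ) (i e : NatExpr)
  | setReal (arr : ℕ) (i j : NatExpr) (e : RealExpr)
  | play (k : NatExpr) (arr : ℕ) (i j : NatExpr)
  | seq (p q : Program)
  | ite (b : Test) (p q : Program)
  | loop (v : ℕ) (b : NatExpr) (p : Program)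

/-- Machine states: one-dimensional arrays of natural numbers, two-dimensional arrays of reals, the
list of the arms played so far, and the number of steps made so far. -/
structure State where
  nat : ℕ → ℕ → ℕ
  real : ℕ → ℕ → ℕ → ℝ
  played : List ℕ
  steps : ℕ

/-- The value of an expression for natural numbers. -/
def NatExpr.eval (s : State) : NatExpr → ℕ
  | lit c => c
  | get arr i => s.nat arr (i.eval s)
  | add a b => a.eval s + b.eval s

/-- The number of steps for evaluating an expression for natural numbers. -/
def NatExpr.cost : NatExpr → ℕ
  | lit _ => 1
  | get _ i => i.cost + 1
  | add a b => a.cost + b.cost + 1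

/-- The value of a real expression, with kernel values `κ i j`. -/
def RealExpr.eval (κ : ℕ → ℕ → ℝ) (s : State) : RealExpr → ℝ
  | lit c => c
  | get arr i j => s.real arr (i.eval s) (j.eval s)
  | add a b => a.eval κ s + b.eval κ s
  | sub a b => a.eval κ s - b.eval κ s
  | mul a b => a.eval κ s * b.eval κ s
  | div a b => a.eval κ s / b.eval κ s
  | sqrt a => √(a.eval κ s)
  | log a => Real.log (a.eval κ s)
  | kern i j => κ (i.eval s) (j.eval s)

/-- The number of steps for evaluating a real expression. -/
def RealExpr.cost : RealExpr → ℕ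
  | lit _ => 1
  | get _ i j => i.cost + j.cost + 1
  | add a b => a.cost + b.cost + 1
  | sub a b => a.cost + b.cost + 1
  | mul a b => a.cost + b.cost + 1
  | div a b => a.cost + b.cost + 1
  | sqrt a => a.cost + 1
  | log a => a.cost + 1
  | kern i j => i.cost + j.cost + 1

/-- The outcome of a comparison. -/
def Test.holds (κ : ℕ → ℕ → ℝ) (s : State) : Test → Prop
  | ltNat a b => a.eval s < b.eval s
  | leReal a b => a.eval κ s ≤ b.eval κ s

/-- The number of steps for a comparison. -/
def Test.cost : Test → ℕ
  | ltNat a b => a.cost + b.cost + 1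
  | leReal a b => a.cost + b.cost + 1

/-- Writing to a cell of a natural array. -/
def State.writeNat (s : State) (arr i v : ℕ) : State :=
  { s with nat := Function.update s.nat arr (Function.update (s.nat arr) i v) }

/-- Writing to a cell of a real array. -/
def State.writeReal (s : State) (arr i j : ℕ) (v : ℝ) : State :=
  { s with real := Function.update s.real arr (Function.update (s.real arr) i
      (Function.update (s.real arr i) j v)) }

/-- Charging `k` steps. -/
def State.charge (s : State) (k : ℕ) : State := { s with steps := s.steps + k }

open scoped Classical in
/-- Execution of a program, with kernel values `κ i j`; the `t`-th arm played, `t = 1, 2, …`,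
returns the reward `y t`. -/
def Program.exec (κ : ℕ → ℕ → ℝ) (y : ℕ → ℝ) : Program → State → State
  | setNat arr i e, s => (s.writeNat arr (i.eval s) (e.eval s)).charge (i.cost + e.cost + 1)
  | setReal arr i j e, s =>
      (s.writeReal arr (i.eval s) (j.eval s) (e.eval κ s)).charge (i.cost + j.cost + e.cost + 1)
  | play k arr i j, s =>
      { (s.writeReal arr (i.eval s) (j.eval s) (y (s.played.length + 1))).charge
          (k.cost + i.cost + j.cost + 1) with played := s.played ++ [k.eval s] }
  | seq p q, s => q.exec κ y (p.exec κ y s)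
  | ite b p q, s =>
      if b.holds κ s then p.exec κ y (s.charge b.cost) else q.exec κ y (s.charge b.cost)
  | loop v b p, s =>
      Nat.rec (s.charge (b.cost + 1))
        (fun k s' => p.exec κ y ((s'.writeNat v 0 k).charge 1)) (b.eval s)

/-- The initial state: cells `0, 1` of the natural array `0` hold the number `n` of arms and the
horizon `T`; row `0` of the real array `0` holds `e, λ, R, B, δ`; everything else is zero. -/
def initState (n T : ℕ) (e lam R B δ : ℝ) : State where
  nat a i := if a = 0 then (if i = 0 then n else if i = 1 then T else 0) else 0
  real a i j := if a = 0 ∧ i = 0 then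
      (if j = 0 then e else if j = 1 then lam else if j = 2 then R else if j = 3 then B
        else if j = 4 then δ else 0)
    else 0
  played := []
  steps := 0

/-- Kernel values at numbered arms `a 0, …, a (n-1)`. -/
def kernelTable {X : Type*} (K : X → X → ℝ) {n : ℕ} (a : Fin n → X) (i j : ℕ) : ℝ :=
  if h : i < n ∧ j < n then K (a ⟨i, h.1⟩) (a ⟨j, h.2⟩) else 0

/-- The final state `s` shows a complete run of APG-UCB on the numbered arms `a`, with rewards `y`
and with `D` selected points: cell `0` of the natural array `1` holds `D`, cell `k < D` of the natural
array `2` the number of the `k`-th `P`-greedy point, cell `(i, k)` of the real array `1` the value of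
the `k`-th Newton basis function at the arm number `i`, and the list of played arms is a list of
`T` arms which maximize the modified UCB. -/
def ShowsAPGUCBRun {X : Type*} (K : X → X → ℝ) {n : ℕ} (a : Fin n → X) (T : ℕ)
    (e lam R B δ : ℝ) (y : ℕ → ℝ) (D : ℕ) (s : State) : Prop :=
  ∃ (p : ℕ → Fin n) (N : ℕ → X → ℝ) (x : ℕ → Fin n),
    IsPGreedyOutput K (Set.range a) e D (fun k => a (p k)) N ∧
    IsUCBRun (Set.range a) D N lam R B δ e T (fun t => a (x t)) y ∧
    s.nat 1 0 = D ∧ (∀ k < D, s.nat 2 k = p k) ∧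
    (∀ (i : Fin n), ∀ k < D, s.real 1 i k = N k (a i)) ∧
    s.played = (List.range T).map (fun t => (x (t + 1) : ℕ))

end

end APGUCB

/-!
Why the theorem holds.

*Regret.* By induction, the Newton functions `N k` produced by the `P`-greedy selection are
orthonormal elements of the RKHS, and the residual of the kernel section at `x` after projecting
onto their span has squared norm `P_D²(x)` (`norm_sq_residual`,
`IsPGreedyOutput.exists_orthonormal`). Since `P_D < e` on the arms, the Cauchy–Schwarz inequality
gives `|f x - ⟨x̃, θ⟩| ≤ B e` with `θ` the coefficients of the projection of `f`, and `‖θ‖ ≤ B`,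
`‖x̃‖² ≤ K x x ≤ 1`. The learner therefore faces a linear bandit in dimension `D` with
misspecification `ε = B e`. Three facts bound its regret:

* Self-normalized concentration (`measure_exists_lt_invNorm_noiseSum_le`). The process
  `det(λ⁻¹ A_t)^{-1/2} exp(‖S_t‖²_{A_t⁻¹} / 2)`, where `S_t = ∑_{s ≤ t} x_s z_s`, is a
  supermartingale. No integration over `ℝ^D` is used for this: by the Sherman–Morrison formula and
  the matrix determinant lemma, the quotient of two consecutive values depends on the scalars
  `z ⬝ A⁻¹ z`, `z ⬝ A⁻¹ S` and on the noise only, and equals the mixture of `exp (g x - g² / 2)`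
  over a one-dimensional Gaussian exponent `g` (`mixture_succ`, `lintegral_gaussianPDF_mul_exp`).
  Ville's inequality turns this into a bound for all rounds at once.
* The confidence bound `|⟨x̃, θ̂_t - θ⟩| ≤ ‖x̃‖_{A_t⁻¹} (β_t + ε ψ_t)` on that event
  (`abs_dotProduct_thetaHat_sub_le`), from which optimism yields
  `R(T) ≤ 2 ε T + 2 (β_T + ε ψ_T) ψ_T` (`regret_le_of_confidence`).
* The elliptical potential lemma `ψ_T ≤ √(2 T D log (T + 1))` and the estimate
  `log det(λ⁻¹ A_T) ≤ D log (T + 1)` (`psi_le`, `log_det_scaled_gram_le`).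

Since `q ≥ 1/2` gives `ε T ≤ B α √T`, this leads to the exponent `c = 1` of the logarithm.

*Complexity.* The program `Program.apgucb` tabulates the Newton basis at all arms, one column per
selected point, and keeps the squared power function; this takes `O(n D²)` steps. The loop over the
selections runs `n` times, which suffices because no arm is selected twice
(`IsPartialGreedy.le_card`). In each round it maintains `A_t⁻¹` by the Sherman–Morrison formula,
`det(λ⁻¹ A_t)` by the matrix determinant lemma, the vector `∑ y_s z_s` and `ψ_t`, so that a round
costs `O(n D²)` steps, spent on one quadratic form per arm. Correctness and cost are proved together
by loop invariants; a syntactic frame rule (`exec_frame`) says that a program leaves alone all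
arrays it does not write to.
-/

namespace APGUCB

noncomputable section

/-! ### Rank-one updates and weighted norms -/

theorem posDef_add_vecMulVec_self {ι : Type*} [Fintype ι] {M : Matrix ι ι ℝ} (hM : M.PosDef)
    (z : ι → ℝ) : (M + Matrix.vecMulVec z z).PosDef :=
  hM.add_posSemidef (by simpa using Matrix.posSemidef_vecMulVec_self_star z)

section RankOne

variable {ι : Type*} [Fintype ι] [DecidableEq ι] {M : Matrix ι ι ℝ}

theorem dotProduct_inv_mulVec_comm (hM : M.PosDef) (u v : ι → ℝ) :
    u ⬝ᵥ (M⁻¹ *ᵥ v) = v ⬝ᵥ (M⁻¹ *ᵥ u) := by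
  have h : (M⁻¹)ᵀ = M⁻¹ := by simpa using hM.inv.isHermitian.eq
  rw [Matrix.dotProduct_mulVec, ← Matrix.mulVec_transpose, h, dotProduct_comm]

theorem dotProduct_inv_mulVec_nonneg (hM : M.PosDef) (v : ι → ℝ) : 0 ≤ v ⬝ᵥ (M⁻¹ *ᵥ v) := by
  simpa using hM.inv.posSemidef.dotProduct_mulVec_nonneg v

/-- The Sherman–Morrison formula. -/
theorem inv_add_vecMulVec_self (hM : M.PosDef) (z : ι → ℝ) :
    (M + Matrix.vecMulVec z z)⁻¹ =
      M⁻¹ - (1 + z ⬝ᵥ (M⁻¹ *ᵥ z))⁻¹ • Matrix.vecMulVec (M⁻¹ *ᵥ z) (M⁻¹ *ᵥ z) := by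
  have hw : (1 + z ⬝ᵥ (M⁻¹ *ᵥ z)) ≠ 0 := by
    have := dotProduct_inv_mulVec_nonneg hM z
    positivity
  have hu : IsUnit M.det := hM.det_pos.ne'.isUnit
  have ht : (M⁻¹)ᵀ = M⁻¹ := by simpa using hM.inv.isHermitian.eq
  apply Matrix.inv_eq_right_inv
  have e1 : M * Matrix.vecMulVec (M⁻¹ *ᵥ z) (M⁻¹ *ᵥ z) = Matrix.vecMulVec z (M⁻¹ *ᵥ z) := by
    rw [Matrix.mul_vecMulVec, Matrix.mulVec_mulVec, Matrix.mul_nonsing_inv _ hu,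
      Matrix.one_mulVec]
  have e2 : Matrix.vecMulVec z z * M⁻¹ = Matrix.vecMulVec z (M⁻¹ *ᵥ z) := by
    rw [Matrix.vecMulVec_mul, ← Matrix.mulVec_transpose, ht]
  have e3 : Matrix.vecMulVec z z * Matrix.vecMulVec (M⁻¹ *ᵥ z) (M⁻¹ *ᵥ z) =
      (z ⬝ᵥ (M⁻¹ *ᵥ z)) • Matrix.vecMulVec z (M⁻¹ *ᵥ z) := by
    rw [Matrix.vecMulVec_mul_vecMulVec, Matrix.vecMulVec_smul]
  rw [add_mul, mul_sub, mul_sub, Matrix.mul_nonsing_inv _ hu, Matrix.mul_smul, Matrix.mul_smul,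
    e1, e2, e3, smul_smul]
  have : (1 + z ⬝ᵥ (M⁻¹ *ᵥ z))⁻¹ + (1 + z ⬝ᵥ (M⁻¹ *ᵥ z))⁻¹ * z ⬝ᵥ (M⁻¹ *ᵥ z) = 1 := by
    field_simp
  have h2 := congrArg (fun c : ℝ => c • Matrix.vecMulVec z (M⁻¹ *ᵥ z)) this
  simp only [add_smul, one_smul] at h2
  ext i j
  have h3 := congrFun (congrFun h2 i) j
  simp only [Matrix.add_apply, Matrix.sub_apply, Matrix.smul_apply, smul_eq_mul] at h3 ⊢
  linear_combination -h3

/-- The matrix determinant lemma for a symmetric rank-one update. -/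
theorem det_add_vecMulVec_self (hM : M.PosDef) (z : ι → ℝ) :
    (M + Matrix.vecMulVec z z).det = M.det * (1 + z ⬝ᵥ (M⁻¹ *ᵥ z)) := by
  have hu : IsUnit M.det := hM.det_pos.ne'.isUnit
  have h : M + Matrix.vecMulVec z z = M * (1 + Matrix.vecMulVec (M⁻¹ *ᵥ z) z) := by
    rw [mul_add, mul_one, Matrix.mul_vecMulVec, Matrix.mulVec_mulVec, Matrix.mul_nonsing_inv _ hu,
      Matrix.one_mulVec]
  rw [h, Matrix.det_mul, Matrix.vecMulVec_eq (Fin 1),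
    Matrix.det_one_add_replicateCol_mul_replicateRow]

theorem dotProduct_inv_add_vecMulVec_self (hM : M.PosDef) (z u v : ι → ℝ) :
    u ⬝ᵥ ((M + Matrix.vecMulVec z z)⁻¹ *ᵥ v) =
      u ⬝ᵥ (M⁻¹ *ᵥ v) - (z ⬝ᵥ (M⁻¹ *ᵥ u)) * (z ⬝ᵥ (M⁻¹ *ᵥ v)) / (1 + z ⬝ᵥ (M⁻¹ *ᵥ z)) := by
  rw [inv_add_vecMulVec_self hM, Matrix.sub_mulVec, dotProduct_sub, Matrix.smul_mulVec,
    dotProduct_smul, Matrix.vecMulVec_mulVec, dotProduct_comm (M⁻¹ *ᵥ z) v]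
  simp only [op_smul_eq_smul, dotProduct_smul, smul_eq_mul]
  rw [dotProduct_inv_mulVec_comm hM u z, dotProduct_inv_mulVec_comm hM v z]
  ring

/-- The Cauchy–Schwarz inequality for the inner product given by `M⁻¹`. -/
theorem sq_dotProduct_inv_mulVec_le (hM : M.PosDef) (u v : ι → ℝ) :
    (u ⬝ᵥ (M⁻¹ *ᵥ v)) ^ 2 ≤ (u ⬝ᵥ (M⁻¹ *ᵥ u)) * (v ⬝ᵥ (M⁻¹ *ᵥ v)) := by
  have h : ∀ x : ℝ, 0 ≤ (v ⬝ᵥ (M⁻¹ *ᵥ v)) * (x * x) + (2 * (u ⬝ᵥ (M⁻¹ *ᵥ v))) * x +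
      u ⬝ᵥ (M⁻¹ *ᵥ u) := by
    intro x
    have := dotProduct_inv_mulVec_nonneg hM (u + x • v)
    simp only [Matrix.mulVec_add, Matrix.mulVec_smul, dotProduct_add, add_dotProduct,
      smul_dotProduct, dotProduct_smul, smul_eq_mul] at this
    rw [dotProduct_inv_mulVec_comm hM v u] at this
    linarith
  have := discrim_le_zero h
  rw [discrim] at this
  linarith

end RankOne

section Gram

variable {D : ℕ}

theorem invNorm_nonneg (M : Matrix (Fin D) (Fin D) ℝ) (v : Fin D → ℝ) : 0 ≤ invNorm M v :=
  Real.sqrt_nonneg _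

theorem sq_invNorm {M : Matrix (Fin D) (Fin D) ℝ} (hM : M.PosDef) (v : Fin D → ℝ) :
    invNorm M v ^ 2 = v ⬝ᵥ (M⁻¹ *ᵥ v) :=
  Real.sq_sqrt (dotProduct_inv_mulVec_nonneg hM v)

/-- The Cauchy–Schwarz inequality in terms of the norm `‖·‖_{M⁻¹}`. -/
theorem abs_dotProduct_inv_mulVec_le {M : Matrix (Fin D) (Fin D) ℝ} (hM : M.PosDef)
    (u v : Fin D → ℝ) : |u ⬝ᵥ (M⁻¹ *ᵥ v)| ≤ invNorm M u * invNorm M v := by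
  refine abs_le_of_sq_le_sq ?_ (mul_nonneg (invNorm_nonneg M u) (invNorm_nonneg M v))
  rw [mul_pow, sq_invNorm hM, sq_invNorm hM]
  exact sq_dotProduct_inv_mulVec_le hM u v

/-! ### The regularized Gram matrix -/

variable {lam : ℝ} (z : ℕ → Fin D → ℝ)

theorem gram_zero : gram lam z 0 = lam • 1 := by simp [gram]

theorem gram_succ (t : ℕ) :
    gram lam z (t + 1) = gram lam z t + Matrix.vecMulVec (z (t + 1)) (z (t + 1)) := by
  simp [gram, Finset.sum_Icc_succ_top, add_assoc]

theorem gram_posDef (hl : 0 < lam) (t : ℕ) : (gram lam z t).PosDef := by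
  induction t with
  | zero => rw [gram_zero]; exact Matrix.PosDef.one.smul hl
  | succ t ih => rw [gram_succ]; exact posDef_add_vecMulVec_self ih _

theorem inv_gram_zero : (gram lam z 0)⁻¹ = lam⁻¹ • 1 := by
  rcases eq_or_ne lam 0 with rfl | h
  · rw [gram_zero]; simp
  · rw [gram_zero]
    apply Matrix.inv_eq_right_inv
    simp [h]

theorem quad_inv_gram_succ_le (hl : 0 < lam) (t : ℕ) (v : Fin D → ℝ) :
    v ⬝ᵥ ((gram lam z (t + 1))⁻¹ *ᵥ v) ≤ v ⬝ᵥ ((gram lam z t)⁻¹ *ᵥ v) := by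
  rw [gram_succ, dotProduct_inv_add_vecMulVec_self (gram_posDef z hl t)]
  have := dotProduct_inv_mulVec_nonneg (gram_posDef z hl t) (z (t + 1))
  have h2 : 0 ≤ (z (t + 1) ⬝ᵥ ((gram lam z t)⁻¹ *ᵥ v)) * (z (t + 1) ⬝ᵥ ((gram lam z t)⁻¹ *ᵥ v)) /
    (1 + z (t + 1) ⬝ᵥ ((gram lam z t)⁻¹ *ᵥ z (t + 1))) :=
    div_nonneg (mul_self_nonneg _) (by positivity)
  linarith

theorem invNorm_gram_antitone (hl : 0 < lam) (v : Fin D → ℝ) :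
    Antitone fun t => invNorm (gram lam z t) v :=
  antitone_nat_of_succ_le fun t => Real.sqrt_le_sqrt (quad_inv_gram_succ_le z hl t v)

theorem quad_inv_gram_le (hl : 0 < lam) (t : ℕ) (v : Fin D → ℝ) :
    v ⬝ᵥ ((gram lam z t)⁻¹ *ᵥ v) ≤ (v ⬝ᵥ v) / lam := by
  induction t with
  | zero => rw [inv_gram_zero, Matrix.smul_mulVec, dotProduct_smul, Matrix.one_mulVec,
      smul_eq_mul]; exact le_of_eq (by ring)
  | succ t ih => exact (quad_inv_gram_succ_le z hl t v).trans ih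

theorem det_scaled_gram_zero (hl : 0 < lam) : (lam⁻¹ • gram lam z 0).det = 1 := by
  rw [gram_zero, smul_smul, inv_mul_cancel₀ hl.ne', one_smul, Matrix.det_one]

theorem det_scaled_gram_succ (hl : 0 < lam) (t : ℕ) :
    (lam⁻¹ • gram lam z (t + 1)).det = (lam⁻¹ • gram lam z t).det *
      (1 + z (t + 1) ⬝ᵥ ((gram lam z t)⁻¹ *ᵥ z (t + 1))) := by
  rw [Matrix.det_smul, Matrix.det_smul, gram_succ, det_add_vecMulVec_self (gram_posDef z hl t)]
  ring

theorem one_le_det_scaled_gram (hl : 0 < lam) (t : ℕ) : 1 ≤ (lam⁻¹ • gram lam z t).det := by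
  induction t with
  | zero => rw [det_scaled_gram_zero z hl]
  | succ t ih =>
    rw [det_scaled_gram_succ z hl]
    have := dotProduct_inv_mulVec_nonneg (gram_posDef z hl t) (z (t + 1))
    nlinarith

theorem det_scaled_gram_mono (hl : 0 < lam) : Monotone fun t => (lam⁻¹ • gram lam z t).det := by
  refine monotone_nat_of_le_succ fun t => ?_
  rw [det_scaled_gram_succ z hl]
  have := dotProduct_inv_mulVec_nonneg (gram_posDef z hl t) (z (t + 1))
  have := one_le_det_scaled_gram z hl t
  nlinarith

theorem beta_mono {R B δ : ℝ} (hl : 0 < lam) (hR : 0 ≤ R) (hδ : 0 < δ) :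
    Monotone fun t => beta lam R B δ z t := by
  intro s t hst
  have h1 := one_le_det_scaled_gram z hl s
  have h2 := det_scaled_gram_mono z hl hst
  have h3 : (lam⁻¹ • gram lam z s).det / δ ^ 2 ≤ (lam⁻¹ • gram lam z t).det / δ ^ 2 :=
    div_le_div_of_nonneg_right h2 (sq_nonneg δ)
  have h4 := Real.log_le_log (by positivity) h3
  exact add_le_add_left (mul_le_mul_of_nonneg_left (Real.sqrt_le_sqrt h4) hR) _

theorem psi_nonneg (t : ℕ) : 0 ≤ psi lam z t :=
  Finset.sum_nonneg fun _ _ => invNorm_nonneg _ _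

theorem psi_mono : Monotone fun t => psi lam z t := by
  intro s t hst
  exact Finset.sum_le_sum_of_subset_of_nonneg (Finset.Icc_subset_Icc_right hst)
    fun _ _ _ => invNorm_nonneg _ _

theorem gram_mulVec (t : ℕ) (v : Fin D → ℝ) :
    gram lam z t *ᵥ v = lam • v + ∑ s ∈ Finset.Icc 1 t, (z s ⬝ᵥ v) • z s := by
  simp [gram, Matrix.add_mulVec, Matrix.smul_mulVec, Matrix.sum_mulVec, Matrix.vecMulVec_mulVec]

/-- Every eigenvalue of `λ⁻¹ A_t` is at most `1 + t`, since the features have norm at most one. -/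
theorem det_scaled_gram_le (hl : 1 ≤ lam) (t : ℕ)
    (hz : ∀ s ∈ Finset.Icc 1 t, z s ⬝ᵥ z s ≤ 1) :
    (lam⁻¹ • gram lam z t).det ≤ (1 + t : ℝ) ^ D := by
  have hl0 : 0 < lam := by linarith
  have hP : (lam⁻¹ • gram lam z t).PosDef := (gram_posDef z hl0 t).smul (inv_pos.2 hl0)
  have hH := hP.isHermitian
  rw [hH.det_eq_prod_eigenvalues]
  have : ∏ i, hH.eigenvalues i ≤ ∏ _i : Fin D, (1 + t : ℝ) := by
    refine Finset.prod_le_prod (fun i _ => (hP.eigenvalues_pos i).le) fun i _ => ?_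
    rw [hH.eigenvalues_eq i]
    -- the eigenvalue is the value of the quadratic form at a unit eigenvector `v`
    set v : Fin D → ℝ := ⇑(hH.eigenvectorBasis i) with hv
    have hvv : v ⬝ᵥ v = 1 := by
      have := hH.eigenvectorBasis.orthonormal.1 i
      have h2 : inner ℝ (hH.eigenvectorBasis i) (hH.eigenvectorBasis i) = (1 : ℝ) := by
        rw [real_inner_self_eq_norm_sq, this]; norm_num
      rw [EuclideanSpace.inner_eq_star_dotProduct] at h2
      simpa using h2
    have hcs : ∀ s ∈ Finset.Icc 1 t, (z s ⬝ᵥ v) * (z s ⬝ᵥ v) ≤ 1 := by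
      intro s hs
      have h1 : (z s ⬝ᵥ v) ^ 2 ≤ (z s ⬝ᵥ z s) * (v ⬝ᵥ v) := by
        have := Finset.sum_mul_sq_le_sq_mul_sq Finset.univ (z s) v
        simpa [dotProduct, sq] using this
      have := hz s hs
      rw [hvv] at h1
      nlinarith
    simp only [star_trivial, RCLike.re_to_real, Matrix.smul_mulVec, gram_mulVec, dotProduct_smul,
      dotProduct_add, dotProduct_sum, hvv, smul_eq_mul, fun s => dotProduct_comm v (z s)]
    have hs : ∑ s ∈ Finset.Icc 1 t, (z s ⬝ᵥ v) * (z s ⬝ᵥ v) ≤ t := by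
      have := Finset.sum_le_sum hcs
      simpa using this
    have h0 : 0 ≤ ∑ s ∈ Finset.Icc 1 t, (z s ⬝ᵥ v) * (z s ⬝ᵥ v) :=
      Finset.sum_nonneg fun s _ => mul_self_nonneg _
    rw [mul_add, mul_one, inv_mul_cancel₀ hl0.ne']
    have : lam⁻¹ ≤ 1 := inv_le_one_of_one_le₀ hl
    nlinarith
  simpa using this

theorem log_det_scaled_gram_le (hl : 1 ≤ lam) (t : ℕ)
    (hz : ∀ s ∈ Finset.Icc 1 t, z s ⬝ᵥ z s ≤ 1) :
    Real.log (lam⁻¹ • gram lam z t).det ≤ D * Real.log (t + 1) := by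
  have h1 := one_le_det_scaled_gram z (by linarith : 0 < lam) t
  have h2 := Real.log_le_log (by linarith) (det_scaled_gram_le z hl t hz)
  rwa [Real.log_pow, add_comm (1 : ℝ)] at h2

/-- The elliptical potential lemma. -/
theorem sum_sq_invNorm_le (hl : 1 ≤ lam) (t : ℕ)
    (hz : ∀ s ∈ Finset.Icc 1 t, z s ⬝ᵥ z s ≤ 1) :
    ∑ s ∈ Finset.Icc 1 t, invNorm (gram lam z (s - 1)) (z s) ^ 2 ≤
      2 * Real.log (lam⁻¹ • gram lam z t).det := by
  have hl0 : 0 < lam := by linarith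
  induction t with
  | zero => simp [det_scaled_gram_zero z hl0]
  | succ t ih =>
    rw [Finset.sum_Icc_succ_top (by omega), det_scaled_gram_succ z hl0, Nat.add_sub_cancel,
      sq_invNorm (gram_posDef z hl0 t)]
    have h0 := dotProduct_inv_mulVec_nonneg (gram_posDef z hl0 t) (z (t + 1))
    have h1 := one_le_det_scaled_gram z hl0 t
    rw [Real.log_mul (by linarith) (by linarith)]
    have ih := ih fun s hs => hz s (by simp at hs ⊢; omega)
    have hw : z (t + 1) ⬝ᵥ ((gram lam z t)⁻¹ *ᵥ z (t + 1)) ≤ 1 := by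
      refine (quad_inv_gram_le z hl0 t _).trans ?_
      have := hz (t + 1) (by simp)
      rw [div_le_one hl0]; linarith
    -- `w ≤ 2 log (1 + w)` on `[0, 1]`, because `log (1 + w) ≥ 1 - 1 / (1 + w)`
    have hlog : z (t + 1) ⬝ᵥ ((gram lam z t)⁻¹ *ᵥ z (t + 1)) ≤
        2 * Real.log (1 + z (t + 1) ⬝ᵥ ((gram lam z t)⁻¹ *ᵥ z (t + 1))) := by
      set w := z (t + 1) ⬝ᵥ ((gram lam z t)⁻¹ *ᵥ z (t + 1))
      have h3 := Real.one_sub_inv_le_log_of_pos (by linarith : 0 < 1 + w)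
      have h4 : w / 2 ≤ 1 - (1 + w)⁻¹ := by
        have : 1 - (1 + w)⁻¹ = w / (1 + w) := by field_simp; ring
        rw [this]
        exact div_le_div_of_nonneg_left h0 (by linarith) (by linarith)
      linarith
    linarith

/-- The elliptical potential lemma for the sum of the norms, by the Cauchy–Schwarz inequality. -/
theorem psi_le (hl : 1 ≤ lam) (t : ℕ) (hz : ∀ s ∈ Finset.Icc 1 t, z s ⬝ᵥ z s ≤ 1) :
    psi lam z t ≤ √(2 * t * D * Real.log (t + 1)) := by
  refine Real.le_sqrt_of_sq_le ?_
  have h1 := sum_sq_invNorm_le z hl t hz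
  have h2 := log_det_scaled_gram_le z hl t hz
  have h3 := sq_sum_le_card_mul_sum_sq (s := Finset.Icc 1 t)
    (f := fun s => invNorm (gram lam z (s - 1)) (z s))
  simp only [Nat.card_Icc, Nat.add_sub_cancel] at h3
  calc psi lam z t ^ 2 ≤ _ := h3
    _ ≤ (t : ℝ) * (2 * (D * Real.log (t + 1))) := by gcongr; linarith
    _ = _ := by ring

end Gram

/-! ### Self-normalized concentration -/

section Concentration

open scoped ENNReal

section OneStep

variable {S : Type*} {m mS : MeasurableSpace S} {μ : Measure S} [IsProbabilityMeasure μ]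

/-- A bound on a conditional exponential moment, tested against an `ℝ≥0∞`-valued function that is
measurable for the conditioning σ-algebra. -/
theorem lintegral_mul_exp_le_of_condExp_le (hm : m ≤ mS) {g : S → ℝ} {c : ℝ}
    (hint : Integrable (fun ω => Real.exp (g ω)) μ)
    (hle : ∀ᵐ ω ∂μ, (μ[fun ω' => Real.exp (g ω') | m]) ω ≤ Real.exp c)
    {h : S → ℝ≥0∞} (hh : Measurable[m] h) :
    ∫⁻ ω, h ω * ENNReal.ofReal (Real.exp (g ω)) ∂μ ≤
      ENNReal.ofReal (Real.exp c) * ∫⁻ ω, h ω ∂μ := by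
  set d : S → ℝ≥0∞ := fun ω => ENNReal.ofReal (Real.exp (g ω)) with hd
  have hdm : AEMeasurable d μ := hint.aestronglyMeasurable.aemeasurable.ennreal_ofReal
  have key : (μ.withDensity d).trim hm ≤ ENNReal.ofReal (Real.exp c) • μ.trim hm := by
    refine Measure.le_iff.2 fun s hs => ?_
    rw [trim_measurableSet_eq hm hs, Measure.smul_apply, trim_measurableSet_eq hm hs,
      withDensity_apply _ (hm s hs), smul_eq_mul, hd,
      ← ofReal_integral_eq_lintegral_ofReal hint.integrableOn
        (ae_of_all _ fun _ => (Real.exp_pos _).le), ← setIntegral_condExp hm hint hs]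
    have h1 : ∫ ω in s, (μ[fun ω' => Real.exp (g ω') | m]) ω ∂μ ≤ ∫ _ω in s, Real.exp c ∂μ :=
      integral_mono_ae integrable_condExp.integrableOn (integrable_const _) (ae_restrict_of_ae hle)
    rw [setIntegral_const, smul_eq_mul] at h1
    refine (ENNReal.ofReal_le_ofReal h1).trans ?_
    rw [mul_comm, ENNReal.ofReal_mul (Real.exp_pos c).le, measureReal_def,
      ENNReal.ofReal_toReal (measure_ne_top μ s)]
  calc ∫⁻ ω, h ω * d ω ∂μ = ∫⁻ ω, h ω ∂(μ.withDensity d) := by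
        rw [lintegral_withDensity_eq_lintegral_mul₀ hdm (hh.mono hm le_rfl).aemeasurable]
        exact lintegral_congr fun ω => mul_comm _ _
    _ = ∫⁻ ω, h ω ∂((μ.withDensity d).trim hm) := (lintegral_trim hm hh).symm
    _ ≤ ∫⁻ ω, h ω ∂(ENNReal.ofReal (Real.exp c) • μ.trim hm) := lintegral_mono' key le_rfl
    _ = _ := by rw [lintegral_smul_measure, lintegral_trim hm hh, smul_eq_mul]

/-- The average of `exp (g x - g² / 2)` over a Gaussian exponent `g` of mean `b` and variance `w`,
by completing the square. -/
theorem lintegral_gaussianPDF_mul_exp {w : ℝ} (hw : 0 < w) (b x : ℝ) :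
    ∫⁻ g, gaussianPDF b w.toNNReal g * ENNReal.ofReal (Real.exp (g * x - g ^ 2 / 2)) =
      ENNReal.ofReal ((√(1 + w))⁻¹ *
        Real.exp ((2 * b * x + w * x ^ 2 - b ^ 2) / (2 * (1 + w)))) := by
  have hw1 : 0 < 1 + w := by linarith
  have hv : 0 < w / (1 + w) := by positivity
  set C := (√(1 + w))⁻¹ * Real.exp ((2 * b * x + w * x ^ 2 - b ^ 2) / (2 * (1 + w))) with hC
  have hC0 : 0 ≤ C := by positivity
  have hpt : ∀ g, gaussianPDF b w.toNNReal g * ENNReal.ofReal (Real.exp (g * x - g ^ 2 / 2)) =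
      ENNReal.ofReal C * gaussianPDF ((w * x + b) / (1 + w)) (w / (1 + w)).toNNReal g := by
    intro g
    rw [gaussianPDF, gaussianPDF, ← ENNReal.ofReal_mul (gaussianPDFReal_nonneg _ _ _),
      ← ENNReal.ofReal_mul hC0]
    congr 1
    rw [gaussianPDFReal, gaussianPDFReal, Real.coe_toNNReal _ hw.le, Real.coe_toNNReal _ hv.le, hC]
    have h1 : (√(2 * Real.pi * (w / (1 + w))))⁻¹ = (√(2 * Real.pi * w))⁻¹ * √(1 + w) := by
      rw [← mul_div_assoc, Real.sqrt_div (by positivity), inv_div, div_eq_mul_inv, mul_comm]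
    rw [h1]
    have h2 : Real.exp (-(g - b) ^ 2 / (2 * w)) * Real.exp (g * x - g ^ 2 / 2) =
        Real.exp ((2 * b * x + w * x ^ 2 - b ^ 2) / (2 * (1 + w))) *
          Real.exp (-(g - (w * x + b) / (1 + w)) ^ 2 / (2 * (w / (1 + w)))) := by
      rw [← Real.exp_add, ← Real.exp_add]
      congr 1
      field_simp
      ring
    have h3 : √(1 + w) ≠ 0 := by positivity
    rw [mul_assoc, h2]
    field_simp
  simp_rw [hpt]
  rw [lintegral_const_mul _ (measurable_gaussianPDF _ _), lintegral_gaussianPDF_eq_one, mul_one]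
  simpa using hv

theorem measurable_gaussianPDF_uncurry :
    Measurable fun p : (ℝ × ℝ) × ℝ => gaussianPDF p.1.1 p.1.2.toNNReal p.2 := by
  unfold gaussianPDF gaussianPDFReal
  fun_prop

/-- One step of the method of mixtures. The factor that multiplies `h ω` on the left is the average
of `exp (g x - g² / 2)` over a Gaussian exponent `g` whose mean `b` and variance `w` are known
before `x` is; for every fixed `g` the conditional expectation is at most one. -/
theorem lintegral_mul_mixture_le (hm : m ≤ mS) {x : S → ℝ} (hx : Measurable x)
    (hint : ∀ u : ℝ, Integrable (fun ω => Real.exp (u * x ω)) μ)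
    (hle : ∀ u : ℝ, ∀ᵐ ω ∂μ, (μ[fun ω' => Real.exp (u * x ω') | m]) ω ≤ Real.exp (u ^ 2 / 2))
    {h : S → ℝ≥0∞} (hh : Measurable[m] h) {b w : S → ℝ} (hb : Measurable[m] b)
    (hw : Measurable[m] w) (hw0 : ∀ ω, 0 ≤ w ω) (hbw : ∀ ω, w ω = 0 → b ω = 0) :
    ∫⁻ ω, h ω * ENNReal.ofReal ((√(1 + w ω))⁻¹ *
        Real.exp ((2 * b ω * x ω + w ω * x ω ^ 2 - b ω ^ 2) / (2 * (1 + w ω)))) ∂μ ≤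
      ∫⁻ ω, h ω ∂μ := by
  have hs : MeasurableSet[m] {ω | 0 < w ω} := hw measurableSet_Ioi
  set s := {ω | 0 < w ω} with hsdef
  set r : S → ℝ≥0∞ := fun ω => ENNReal.ofReal ((√(1 + w ω))⁻¹ *
        Real.exp ((2 * b ω * x ω + w ω * x ω ^ 2 - b ω ^ 2) / (2 * (1 + w ω)))) with hr
  have hhS : Measurable h := hh.mono hm le_rfl
  have hbS : Measurable b := hb.mono hm le_rfl
  have hwS : Measurable w := hw.mono hm le_rfl
  rw [← lintegral_add_compl _ (hm s hs), ← lintegral_add_compl h (hm s hs)]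
  refine add_le_add ?_ (le_of_eq ?_)
  · set h' : S → ℝ≥0∞ := s.indicator h with hh'
    have hh'm : Measurable[m] h' := hh.indicator hs
    have hh'S : Measurable h' := hh'm.mono hm le_rfl
    have hP : Measurable fun p : S × ℝ => gaussianPDF (b p.1) (w p.1).toNNReal p.2 :=
      measurable_gaussianPDF_uncurry.comp
        (((hbS.comp measurable_fst).prodMk (hwS.comp measurable_fst)).prodMk measurable_snd)
    have hPm : ∀ g, Measurable[m] fun ω => gaussianPDF (b ω) (w ω).toNNReal g := fun g =>
      measurable_gaussianPDF_uncurry.comp ((hb.prodMk hw).prodMk measurable_const)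
    rw [← lintegral_indicator (hm s hs), ← lintegral_indicator (hm s hs)]
    have e1 : ∀ ω, s.indicator (fun ω => h ω * r ω) ω =
        ∫⁻ g, h' ω * (gaussianPDF (b ω) (w ω).toNNReal g *
          ENNReal.ofReal (Real.exp (g * x ω - g ^ 2 / 2))) := by
      intro ω
      by_cases hω : ω ∈ s
      · rw [Set.indicator_of_mem hω, lintegral_const_mul _ (by fun_prop),
          lintegral_gaussianPDF_mul_exp hω, hh', Set.indicator_of_mem hω]
      · simp [hh', hω]
    have e2 : ∀ ω, ∫⁻ g : ℝ, h' ω * gaussianPDF (b ω) (w ω).toNNReal g = h' ω := by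
      intro ω
      by_cases hω : ω ∈ s
      · rw [lintegral_const_mul _ (by fun_prop), lintegral_gaussianPDF_eq_one, mul_one]
        simpa using (show 0 < w ω from hω)
      · simp [hh', hω]
    calc ∫⁻ ω, s.indicator (fun ω => h ω * r ω) ω ∂μ
        = ∫⁻ ω, (∫⁻ g : ℝ, h' ω * (gaussianPDF (b ω) (w ω).toNNReal g *
          ENNReal.ofReal (Real.exp (g * x ω - g ^ 2 / 2)))) ∂μ := lintegral_congr e1
      _ = ∫⁻ g : ℝ, ∫⁻ ω, h' ω * (gaussianPDF (b ω) (w ω).toNNReal g *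
          ENNReal.ofReal (Real.exp (g * x ω - g ^ 2 / 2))) ∂μ := by
        refine lintegral_lintegral_swap (Measurable.aemeasurable ?_)
        exact (hh'S.comp measurable_fst).mul (hP.mul (by fun_prop))
      _ ≤ ∫⁻ g : ℝ, ∫⁻ ω, h' ω * gaussianPDF (b ω) (w ω).toNNReal g ∂μ := by
        refine lintegral_mono fun g => ?_
        have h3 := lintegral_mul_exp_le_of_condExp_le hm (hint g) (hle g)
          (hh'm.mul ((hPm g).mul_const (ENNReal.ofReal (Real.exp (-(g ^ 2 / 2))))))
        rw [← lintegral_const_mul' _ _ ENNReal.ofReal_ne_top] at h3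
        refine (le_of_eq (lintegral_congr fun ω => ?_)).trans (h3.trans
          (le_of_eq (lintegral_congr fun ω => ?_)))
        · have : Real.exp (g * x ω - g ^ 2 / 2) =
              Real.exp (-(g ^ 2 / 2)) * Real.exp (g * x ω) := by
            rw [← Real.exp_add]; congr 1; ring
          rw [this, ENNReal.ofReal_mul (Real.exp_pos _).le]
          simp only [Pi.mul_apply, mul_assoc]
        · have : ENNReal.ofReal (Real.exp (g ^ 2 / 2)) *
              ENNReal.ofReal (Real.exp (-(g ^ 2 / 2))) = 1 := by
            rw [← ENNReal.ofReal_mul (Real.exp_pos _).le, ← Real.exp_add]; simp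
          simp only [Pi.mul_apply]
          calc _ = ENNReal.ofReal (Real.exp (g ^ 2 / 2)) *
              ENNReal.ofReal (Real.exp (-(g ^ 2 / 2))) *
                (h' ω * gaussianPDF (b ω) (w ω).toNNReal g) := by ring
            _ = _ := by rw [this, one_mul]
      _ = ∫⁻ ω, (∫⁻ g : ℝ, h' ω * gaussianPDF (b ω) (w ω).toNNReal g) ∂μ :=
        (lintegral_lintegral_swap
          ((hh'S.comp measurable_fst).mul hP).aemeasurable).symm
      _ = ∫⁻ ω, h' ω ∂μ := lintegral_congr e2
  · -- a degenerate prior leaves the process unchanged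
    refine setLIntegral_congr_fun (hm s hs).compl fun ω hω => ?_
    have h0 : w ω = 0 := le_antisymm (not_lt.1 hω) (hw0 ω)
    simp [h0, hbw ω h0]

end OneStep

/-- Ville's maximal inequality for a nonnegative supermartingale, over a finite horizon. -/
theorem mul_measure_exists_le_le_lintegral {S : Type*} {mS : MeasurableSpace S} {μ : Measure S}
    (G : Filtration ℕ mS) (X : ℕ → S → ℝ≥0∞) (n : ℕ) (hX : ∀ t ≤ n, Measurable[G t] (X t))
    (hsup : ∀ t < n, ∀ s, MeasurableSet[G t] s → ∫⁻ ω in s, X (t + 1) ω ∂μ ≤ ∫⁻ ω in s, X t ω ∂μ)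
    (c : ℝ≥0∞) :
    c * μ {ω | ∃ t ≤ n, c ≤ X t ω} ≤ ∫⁻ ω, X 0 ω ∂μ := by
  -- `E k` is the event that the level `c` has not been reached up to time `k`; the supermartingale
  -- property makes `c * μ (E k)ᶜ + ∫ X k` over `E k` nonincreasing in `k`
  let E : ℕ → Set S := fun k => {ω | ∀ t ≤ k, X t ω < c}
  have hE : ∀ k ≤ n, MeasurableSet[G k] (E k) := by
    intro k hk
    have : E k = ⋂ t ∈ Set.Iic k, {ω | X t ω < c} := by ext; simp [E]
    rw [this]
    refine MeasurableSet.biInter (Set.to_countable _) fun t ht => ?_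
    exact G.mono ht _ (hX t (le_trans ht hk) measurableSet_Iio)
  have hconst : ∀ (t : ℕ) (s : Set S), MeasurableSet s → t ≤ n → (∀ ω ∈ s, c ≤ X t ω) →
      c * μ s ≤ ∫⁻ ω in s, X t ω ∂μ := by
    intro t s hs _ h
    rw [← setLIntegral_const]
    exact setLIntegral_mono' hs h
  have key : ∀ k ≤ n, c * μ (E k)ᶜ + ∫⁻ ω in E k, X k ω ∂μ ≤ ∫⁻ ω, X 0 ω ∂μ := by
    intro k
    induction k with
    | zero =>
      intro hk
      have hm := G.le 0 _ (hE 0 hk)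
      have h0 : c * μ (E 0)ᶜ ≤ ∫⁻ ω in (E 0)ᶜ, X 0 ω ∂μ :=
        hconst 0 _ hm.compl hk fun ω hω => by simpa [E] using hω
      have h1 := lintegral_add_compl (μ := μ) (X 0) hm
      rw [← h1, add_comm]
      exact add_le_add_right h0 _
    | succ k ih =>
      intro hk
      have hm := G.le _ _ (hE k (by omega))
      have hm1 := G.le _ _ (hE (k + 1) hk)
      refine le_trans ?_ (ih (by omega))
      have hsub : E (k + 1) ⊆ E k := fun ω h t ht => h t (by omega)
      have hdiff : (E (k + 1))ᶜ = (E k)ᶜ ∪ (E k \ E (k + 1)) := by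
        ext ω
        have := @hsub ω
        simp only [Set.mem_compl_iff, Set.mem_union, Set.mem_sdiff]
        tauto
      have h1 : c * μ (E k \ E (k + 1)) ≤ ∫⁻ ω in E k \ E (k + 1), X (k + 1) ω ∂μ := by
        refine hconst _ _ (hm.diff hm1) hk fun ω hω => ?_
        by_contra hlt
        refine hω.2 fun t ht => ?_
        rcases Nat.lt_or_ge t (k + 1) with h | h
        · exact hω.1 t (by omega)
        · obtain rfl : t = k + 1 := le_antisymm ht h
          exact not_le.1 hlt
      have h2 : ∫⁻ ω in E k, X (k + 1) ω ∂μ = ∫⁻ ω in E (k + 1), X (k + 1) ω ∂μ +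
          ∫⁻ ω in E k \ E (k + 1), X (k + 1) ω ∂μ := by
        rw [← lintegral_inter_add_sdiff _ _ hm1, Set.inter_eq_right.2 hsub]
      calc c * μ (E (k + 1))ᶜ + ∫⁻ ω in E (k + 1), X (k + 1) ω ∂μ
          ≤ c * (μ (E k)ᶜ + μ (E k \ E (k + 1))) + ∫⁻ ω in E (k + 1), X (k + 1) ω ∂μ := by
            rw [hdiff]; gcongr; exact measure_union_le _ _
        _ = c * μ (E k)ᶜ + (∫⁻ ω in E (k + 1), X (k + 1) ω ∂μ + c * μ (E k \ E (k + 1))) := by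
            ring
        _ ≤ c * μ (E k)ᶜ + ∫⁻ ω in E k, X (k + 1) ω ∂μ := by rw [h2]; gcongr
        _ ≤ _ := add_le_add_right (hsup k (by omega) _ (hE k (by omega))) _
  refine le_trans ?_ (le_trans le_self_add (key n le_rfl))
  gcongr
  intro ω hω
  obtain ⟨t, ht, h⟩ := hω
  exact fun hE => absurd (hE t ht) (not_lt.2 h)

section SelfNormalized

variable {D : ℕ} {lam : ℝ}

/-- By the Sherman–Morrison recursion, so that measurability of the matrix inverse is not needed. -/
theorem measurable_dotProduct_inv_gram_mulVec {S : Type*} {m : MeasurableSpace S} (hl : 0 < lam)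
    (z : ℕ → S → Fin D → ℝ) (t : ℕ) (hz : ∀ s ∈ Finset.Icc 1 t, Measurable (z s)) :
    ∀ u v : S → Fin D → ℝ, Measurable u → Measurable v →
      Measurable fun ω => u ω ⬝ᵥ ((gram lam (fun s => z s ω) t)⁻¹ *ᵥ v ω) := by
  have hdot : ∀ u v : S → Fin D → ℝ, Measurable u → Measurable v →
      Measurable fun ω => u ω ⬝ᵥ v ω := by
    intro u v hu hv
    unfold dotProduct
    exact Finset.measurable_fun_sum _ fun i _ =>
      ((measurable_pi_apply i).comp hu).mul ((measurable_pi_apply i).comp hv)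
  induction t with
  | zero =>
    intro u v hu hv
    simp only [inv_gram_zero, Matrix.smul_mulVec, Matrix.one_mulVec, dotProduct_smul, smul_eq_mul]
    exact (hdot u v hu hv).const_mul _
  | succ t ih =>
    intro u v hu hv
    have ih := ih fun s hs => hz s (by simp at hs ⊢; omega)
    have hzt := hz (t + 1) (by simp)
    simp only [gram_succ, dotProduct_inv_add_vecMulVec_self (gram_posDef _ hl _)]
    exact (ih u v hu hv).sub (((ih _ u hzt hu).mul (ih _ v hzt hv)).div
      ((ih _ _ hzt hzt).const_add _))

theorem measurable_det_scaled_gram {S : Type*} {m : MeasurableSpace S} (hl : 0 < lam)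
    (z : ℕ → S → Fin D → ℝ) (t : ℕ) (hz : ∀ s ∈ Finset.Icc 1 t, Measurable (z s)) :
    Measurable fun ω => (lam⁻¹ • gram lam (fun s => z s ω) t).det := by
  induction t with
  | zero => simp only [det_scaled_gram_zero _ hl]; exact measurable_const
  | succ t ih =>
    have hz' : ∀ s ∈ Finset.Icc 1 t, Measurable (z s) := fun s hs => hz s (by simp at hs ⊢; omega)
    have hzt := hz (t + 1) (by simp)
    simp only [det_scaled_gram_succ _ hl]
    exact (ih hz').mul ((measurable_dotProduct_inv_gram_mulVec hl z t hz' _ _ hzt hzt).const_add _)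

/-- The noise term `∑_{s ≤ t} x_s z_s`. -/
def noiseSum (z : ℕ → Fin D → ℝ) (x : ℕ → ℝ) (t : ℕ) : Fin D → ℝ :=
  ∑ s ∈ Finset.Icc 1 t, x s • z s

theorem noiseSum_succ (z : ℕ → Fin D → ℝ) (x : ℕ → ℝ) (t : ℕ) :
    noiseSum z x (t + 1) = noiseSum z x t + x (t + 1) • z (t + 1) := by
  simp [noiseSum, Finset.sum_Icc_succ_top]

/-- The self-normalized process `det(λ⁻¹ A_t)^{-1/2} exp(‖∑_{s ≤ t} x_s z_s‖²_{A_t⁻¹} / 2)`. -/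
def mixture (lam : ℝ) (z : ℕ → Fin D → ℝ) (x : ℕ → ℝ) (t : ℕ) : ℝ :=
  (√(lam⁻¹ • gram lam z t).det)⁻¹ *
    Real.exp ((noiseSum z x t ⬝ᵥ ((gram lam z t)⁻¹ *ᵥ noiseSum z x t)) / 2)

theorem mixture_nonneg (z : ℕ → Fin D → ℝ) (x : ℕ → ℝ) (t : ℕ) : 0 ≤ mixture lam z x t := by
  unfold mixture; positivity

/-- The quotient of two consecutive values is the Gaussian average of
`lintegral_gaussianPDF_mul_exp` with mean `b = z ⬝ A⁻¹ S` and variance `w = z ⬝ A⁻¹ z`. -/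
theorem mixture_succ (hl : 0 < lam) (z : ℕ → Fin D → ℝ) (x : ℕ → ℝ) (t : ℕ) :
    mixture lam z x (t + 1) = mixture lam z x t *
      ((√(1 + z (t + 1) ⬝ᵥ ((gram lam z t)⁻¹ *ᵥ z (t + 1))))⁻¹ *
        Real.exp ((2 * (z (t + 1) ⬝ᵥ ((gram lam z t)⁻¹ *ᵥ noiseSum z x t)) * x (t + 1) +
          (z (t + 1) ⬝ᵥ ((gram lam z t)⁻¹ *ᵥ z (t + 1))) * x (t + 1) ^ 2 -
          (z (t + 1) ⬝ᵥ ((gram lam z t)⁻¹ *ᵥ noiseSum z x t)) ^ 2) /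
          (2 * (1 + z (t + 1) ⬝ᵥ ((gram lam z t)⁻¹ *ᵥ z (t + 1)))))) := by
  have hP := gram_posDef z hl t
  have hw := dotProduct_inv_mulVec_nonneg hP (z (t + 1))
  have hd := one_le_det_scaled_gram z hl t
  unfold mixture
  rw [det_scaled_gram_succ z hl, Real.sqrt_mul (by linarith), mul_inv, gram_succ,
    dotProduct_inv_add_vecMulVec_self hP, noiseSum_succ]
  simp only [Matrix.mulVec_add, Matrix.mulVec_smul, dotProduct_add, add_dotProduct,
    smul_dotProduct, dotProduct_smul, smul_eq_mul]
  rw [dotProduct_inv_mulVec_comm hP (noiseSum z x t) (z (t + 1))]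
  set w := z (t + 1) ⬝ᵥ ((gram lam z t)⁻¹ *ᵥ z (t + 1))
  set b := z (t + 1) ⬝ᵥ ((gram lam z t)⁻¹ *ᵥ noiseSum z x t)
  set q := noiseSum z x t ⬝ᵥ ((gram lam z t)⁻¹ *ᵥ noiseSum z x t)
  have hw1 : 1 + w ≠ 0 := by positivity
  have : ∀ A B C E : ℝ, A * B * (C * E) = A * C * (B * E) := by intros; ring
  rw [this, ← Real.exp_add]
  congr 2
  field_simp
  ring

variable {S : Type*} {mS : MeasurableSpace S} {μ : Measure S} [IsProbabilityMeasure μ]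
  (F : Filtration ℕ mS) {T : ℕ} {z : ℕ → S → Fin D → ℝ}

/-- The self-normalized bound for standard sub-Gaussian noise. -/
theorem measure_exists_inv_le_mixture_le {x : ℕ → S → ℝ} (hl : 0 < lam)
    (hsub : IsCondSubGaussian μ F 1 T x)
    (hz : ∀ t ∈ Finset.Icc 1 T, Measurable[F t] (z t))
    (hx : ∀ t ∈ Finset.Icc 1 T, Measurable[F (t + 1)] (x t)) {δ : ℝ} (hδ : 0 < δ) :
    μ {ω | ∃ t ≤ T, δ⁻¹ ≤ mixture lam (fun s => z s ω) (fun s => x s ω) t} ≤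
      ENNReal.ofReal δ := by
  -- the process at time `t` involves the noise of round `t`, which is known at time `t + 1` only
  let G : Filtration ℕ mS := ⟨fun t => F (t + 1), fun i j h => F.mono (by omega), fun i => F.le _⟩
  let X : ℕ → S → ℝ≥0∞ := fun t ω =>
    ENNReal.ofReal (mixture lam (fun s => z s ω) (fun s => x s ω) t)
  have hzG : ∀ t ≤ T, ∀ s ∈ Finset.Icc 1 t, Measurable[G t] (z s) := by
    intro t ht s hs
    rw [Finset.mem_Icc] at hs
    exact (hz s (by simp; omega)).mono (F.mono (by omega)) le_rfl
  have hNG : ∀ t ≤ T, Measurable[G t] fun ω => noiseSum (fun s => z s ω) (fun s => x s ω) t := by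
    intro t ht
    have : (fun ω => noiseSum (fun s => z s ω) (fun s => x s ω) t) =
        fun ω => ∑ s ∈ Finset.Icc 1 t, x s ω • z s ω := rfl
    rw [this]
    refine Finset.measurable_fun_sum _ fun s hs => ?_
    have hs' := Finset.mem_Icc.1 hs
    have h1 : Measurable[G t] (x s) :=
      (hx s (by simp; omega)).mono (F.mono (by omega)) le_rfl
    exact h1.smul (hzG t ht s hs)
  have hXG : ∀ t ≤ T, Measurable[G t] (X t) := by
    intro t ht
    refine Measurable.ennreal_ofReal ?_
    exact ((measurable_det_scaled_gram hl z t (hzG t ht)).sqrt.inv).mul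
      ((((measurable_dotProduct_inv_gram_mulVec hl z t (hzG t ht)) _ _ (hNG t ht)
        (hNG t ht)).div_const 2).exp)
  have hVille := mul_measure_exists_le_le_lintegral (μ := μ) G X T hXG (fun t ht s hs => by
    have htm : t + 1 ∈ Finset.Icc 1 T := by simp; omega
    have hzt : Measurable[G t] (z (t + 1)) := hz _ htm
    have hquad := measurable_dotProduct_inv_gram_mulVec hl z t (hzG t ht.le)
    have := lintegral_mul_mixture_le (μ := μ) (G.le t) ((hx _ htm).mono (F.le _) le_rfl)
      (fun u => (hsub _ htm u).1) (fun u => by simpa using (hsub _ htm u).2)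
      ((hXG t ht.le).indicator hs) (hquad _ _ hzt (hNG t ht.le)) (hquad _ _ hzt hzt)
      (fun ω => dotProduct_inv_mulVec_nonneg (gram_posDef _ hl t) _)
      (fun ω h0 => by
        have := sq_dotProduct_inv_mulVec_le (gram_posDef (fun s => z s ω) hl t) (z (t + 1) ω)
          (noiseSum (fun s => z s ω) (fun s => x s ω) t)
        rw [h0, zero_mul] at this
        exact pow_eq_zero_iff two_ne_zero |>.1 (le_antisymm this (sq_nonneg _)))
    rw [← lintegral_indicator (G.le t s hs), ← lintegral_indicator (G.le t s hs)]
    refine (le_of_eq (lintegral_congr fun ω => ?_)).trans this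
    by_cases hω : ω ∈ s
    · rw [Set.indicator_of_mem hω, Set.indicator_of_mem hω]
      simp only [X]
      rw [mixture_succ hl, ENNReal.ofReal_mul (mixture_nonneg _ _ _)]
    · simp [hω]) (ENNReal.ofReal δ⁻¹)
  have h0 : ∫⁻ ω, X 0 ω ∂μ = 1 := by
    simp only [X, mixture, det_scaled_gram_zero _ hl, noiseSum]
    simp
  rw [h0] at hVille
  have hset : {ω | ∃ t ≤ T, δ⁻¹ ≤ mixture lam (fun s => z s ω) (fun s => x s ω) t} =
      {ω | ∃ t ≤ T, ENNReal.ofReal δ⁻¹ ≤ X t ω} := by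
    ext ω
    simp only [Set.mem_ofPred_eq, X, ENNReal.ofReal_le_ofReal_iff (mixture_nonneg _ _ _)]
  rw [hset]
  have h1 : ENNReal.ofReal δ * ENNReal.ofReal δ⁻¹ = 1 := by
    rw [← ENNReal.ofReal_mul hδ.le, mul_inv_cancel₀ hδ.ne', ENNReal.ofReal_one]
  calc μ _ = ENNReal.ofReal δ *
        (ENNReal.ofReal δ⁻¹ * μ {ω | ∃ t ≤ T, ENNReal.ofReal δ⁻¹ ≤ X t ω}) := by
        rw [← mul_assoc, h1, one_mul]
    _ ≤ ENNReal.ofReal δ * 1 := by gcongr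
    _ = _ := mul_one _

/-- Noise which is conditionally `0`-sub-Gaussian vanishes, since `exp x + exp (-x) - 2` is
nonnegative, zero only at `x = 0`, and has nonpositive expectation. -/
theorem ae_eq_zero_of_isCondSubGaussian_zero {x : ℕ → S → ℝ} (hsub : IsCondSubGaussian μ F 0 T x)
    (t : ℕ) (ht : t ∈ Finset.Icc 1 T) : ∀ᵐ ω ∂μ, x t ω = 0 := by
  have hle : ∀ u : ℝ, ∫ ω, Real.exp (u * x t ω) ∂μ ≤ 1 := by
    intro u
    rw [← integral_condExp (F.le t)]
    have h := (hsub t ht u).2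
    simp only [ne_eq, OfNat.ofNat_ne_zero, not_false_eq_true, zero_pow, mul_zero, zero_div,
      Real.exp_zero] at h
    have := integral_mono_ae integrable_condExp (integrable_const (1 : ℝ)) h
    simpa using this
  have hi1 := (hsub t ht 1).1
  have hi2 := (hsub t ht (-1)).1
  have h2 : ∀ ω, 0 ≤ Real.exp (1 * x t ω) + Real.exp (-1 * x t ω) - 2 := by
    intro ω
    have h3 : Real.exp (1 * x t ω) * Real.exp (-1 * x t ω) = 1 := by
      rw [← Real.exp_add]; simp
    nlinarith [sq_nonneg (Real.exp (1 * x t ω) - Real.exp (-1 * x t ω)), Real.exp_pos (1 * x t ω),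
      Real.exp_pos (-1 * x t ω)]
  have hint : Integrable (fun ω => Real.exp (1 * x t ω) + Real.exp (-1 * x t ω) - 2) μ :=
    (hi1.add hi2).sub (integrable_const 2)
  have h0 : ∫ ω, (Real.exp (1 * x t ω) + Real.exp (-1 * x t ω) - 2) ∂μ = 0 := by
    refine le_antisymm ?_ (integral_nonneg h2)
    have h3 := integral_sub (hi1.add hi2) (integrable_const (2 : ℝ))
    simp only [Pi.add_apply] at h3
    rw [h3, integral_add hi1 hi2]
    have h5 := hle 1
    have h6 := hle (-1)
    rw [integral_const, probReal_univ, one_smul]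
    linarith
  filter_upwards [(integral_eq_zero_iff_of_nonneg h2 hint).1 h0] with ω hω
  by_contra hne
  have h4 := Real.add_one_lt_exp hne
  have h5 := Real.add_one_lt_exp (neg_ne_zero.2 hne)
  simp only [Pi.zero_apply, one_mul, neg_mul] at hω
  linarith

/-- The self-normalized concentration inequality: with probability at least `1 - δ`, the noise term
stays below the confidence radius in all rounds simultaneously. -/
theorem measure_exists_lt_invNorm_noiseSum_le {x : ℕ → S → ℝ} {R : ℝ} (hl : 0 < lam) (hR : 0 ≤ R)
    (hsub : IsCondSubGaussian μ F R T x)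
    (hz : ∀ t ∈ Finset.Icc 1 T, Measurable[F t] (z t))
    (hx : ∀ t ∈ Finset.Icc 1 T, Measurable[F (t + 1)] (x t)) {δ : ℝ} (hδ : 0 < δ) (hδ1 : δ < 1) :
    μ {ω | ∃ t ≤ T,
        R * √(Real.log ((lam⁻¹ • gram lam (fun s => z s ω) t).det / δ ^ 2)) <
          invNorm (gram lam (fun s => z s ω) t) (noiseSum (fun s => z s ω) (fun s => x s ω) t)} ≤
      ENNReal.ofReal δ := by
  rcases hR.eq_or_lt with rfl | hR
  · refine le_of_eq_of_le ?_ (zero_le)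
    have hae : ∀ᵐ ω ∂μ, ∀ t ∈ Finset.Icc 1 T, x t ω = 0 :=
      (ae_ball_iff (Finset.countable_toSet _)).2
        fun t ht => ae_eq_zero_of_isCondSubGaussian_zero F hsub t ht
    refine measure_mono_null ?_ (ae_iff.1 hae)
    rintro ω ⟨t, ht, hlt⟩ hall
    have : noiseSum (fun s => z s ω) (fun s => x s ω) t = 0 := by
      unfold noiseSum
      refine Finset.sum_eq_zero fun s hs => ?_
      have hs' := Finset.mem_Icc.1 hs
      simp [hall s (by simp; omega)]
    rw [this] at hlt
    simp [invNorm] at hlt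
  · -- rescale the noise to standard sub-Gaussian noise
    let x' : ℕ → S → ℝ := fun t ω => R⁻¹ * x t ω
    have hsub' : IsCondSubGaussian μ F 1 T x' := by
      intro t ht u
      have h := hsub t ht (u * R⁻¹)
      have e1 : (u * R⁻¹) ^ 2 * R ^ 2 / 2 = u ^ 2 * 1 ^ 2 / 2 := by field_simp
      simp only [mul_assoc u R⁻¹] at h
      rw [← mul_pow, mul_assoc, inv_mul_cancel₀ hR.ne', mul_one] at h
      simpa [x'] using h
    refine le_trans (measure_mono ?_) (measure_exists_inv_le_mixture_le F hl hsub' hz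
      (fun t ht => (hx t ht).const_mul _) hδ)
    rintro ω ⟨t, ht, hlt⟩
    refine ⟨t, ht, ?_⟩
    set zω : ℕ → Fin D → ℝ := fun s => z s ω
    set A := gram lam zω t with hA
    have hP : A.PosDef := gram_posDef zω hl t
    set d := (lam⁻¹ • A).det with hd
    have hd1 : 1 ≤ d := one_le_det_scaled_gram zω hl t
    have hN : noiseSum zω (fun s => x' s ω) t = R⁻¹ • noiseSum zω (fun s => x s ω) t := by
      simp [noiseSum, x', Finset.smul_sum, smul_smul]
    set N := noiseSum zω (fun s => x s ω) t
    have hlog0 : 0 ≤ Real.log (d / δ ^ 2) := by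
      refine Real.log_nonneg ?_
      rw [le_div_iff₀ (by positivity)]
      nlinarith
    have h1 : R ^ 2 * Real.log (d / δ ^ 2) < N ⬝ᵥ (A⁻¹ *ᵥ N) := by
      have := pow_lt_pow_left₀ hlt (by positivity) two_ne_zero
      rwa [sq_invNorm hP, mul_pow, Real.sq_sqrt hlog0] at this
    have h2 : Real.log (d / δ ^ 2) < (noiseSum zω (fun s => x' s ω) t) ⬝ᵥ
        (A⁻¹ *ᵥ (noiseSum zω (fun s => x' s ω) t)) := by
      rw [hN, Matrix.mulVec_smul, dotProduct_smul, smul_dotProduct, smul_eq_mul, smul_eq_mul,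
        ← mul_assoc, ← sq, inv_pow, ← div_eq_inv_mul, lt_div_iff₀ (by positivity)]
      linarith
    unfold mixture
    rw [← hA, ← hd]
    have h3 : δ⁻¹ = (√d)⁻¹ * Real.exp (Real.log (d / δ ^ 2) / 2) := by
      rw [Real.exp_half, Real.exp_log (by positivity), Real.sqrt_div (by linarith),
        Real.sqrt_sq hδ.le]
      have : √d ≠ 0 := by positivity
      field_simp
    rw [h3]
    gcongr

end SelfNormalized

end Concentration

/-! ### The Newton basis in the reproducing kernel Hilbert space -/

section Newton

variable {X : Type*} {K : X → X → ℝ}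

theorem IsPosDefKernel.diag_pos (hK : IsPosDefKernel K) (x : X) : 0 < K x x := by
  have := (hK.posDef 1 (fun _ => x) (Function.injective_of_subsingleton _)).diag_pos (i := 0)
  simpa using this

theorem powerSq_succ (N : ℕ → X → ℝ) (m : ℕ) (x : X) :
    powerSq K N (m + 1) x = powerSq K N m x - N m x ^ 2 := by
  simp [powerSq, Finset.sum_range_succ]; ring

theorem IsPGreedyOutput.powerSq_pos {A : Set X} {e : ℝ} {D : ℕ} {ξ : ℕ → X} {N : ℕ → X → ℝ}
    (hK : IsPosDefKernel K) (he : 0 < e) (h : IsPGreedyOutput K A e D ξ N) {m : ℕ} (hm : m < D) :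
    0 < powerSq K N m (ξ m) := by
  rcases Nat.eq_zero_or_pos m with rfl | hm0
  · simpa [powerSq] using hK.diag_pos (ξ 0)
  · have := h.continues m hm0 hm
    push Not at this
    obtain ⟨x, hx, hle⟩ := this
    have h1 := h.greedy m hm x hx
    have : 0 < e ^ 2 := by positivity
    linarith

variable {H : Type*} [NormedAddCommGroup H] [InnerProductSpace ℝ H] [CompleteSpace H]
  [RKHS ℝ H X ℝ]

/-- The reproducing property; scalar-valued RKHS are encoded with operator-valued kernels on `ℝ`,
whose sections are evaluated at the vector `1`. -/
theorem inner_kerFun_one (f : H) (x : X) : inner ℝ (RKHS.kerFun H x 1) f = f x := by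
  rw [RKHS.kerFun_inner]; simp

theorem RKHS_coe_sum {ι : Type*} (s : Finset ι) (g : ι → H) (x : X) :
    (∑ i ∈ s, g i : H) x = ∑ i ∈ s, g i x := by
  simp_rw [← inner_kerFun_one, inner_sum]

/-- The residual of the kernel section at `x` has squared norm equal to the squared power function,
provided that the Newton basis is orthonormal. -/
theorem norm_sq_residual (hH : IsRKHSOf H K) {N : ℕ → X → ℝ} {g : ℕ → H} {m : ℕ}
    (hg : ∀ k < m, ∀ x, g k x = N k x)
    (horth : ∀ i < m, ∀ j < m, inner ℝ (g i) (g j) = if i = j then (1 : ℝ) else 0) (x : X) :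
    ‖RKHS.kerFun H x 1 - ∑ k ∈ Finset.range m, N k x • g k‖ ^ 2 = powerSq K N m x := by
  have h1 : inner ℝ (RKHS.kerFun H x (1 : ℝ)) (RKHS.kerFun H x (1 : ℝ)) = K x x := by
    rw [inner_kerFun_one, RKHS.kerFun_apply, hH]
  have h2 : inner ℝ (RKHS.kerFun H x (1 : ℝ)) (∑ k ∈ Finset.range m, N k x • g k) =
      ∑ k ∈ Finset.range m, N k x ^ 2 := by
    rw [inner_sum]
    refine Finset.sum_congr rfl fun k hk => ?_
    rw [inner_smul_right, inner_kerFun_one, hg k (Finset.mem_range.1 hk), sq]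
  have h3 : inner ℝ (∑ k ∈ Finset.range m, N k x • g k) (∑ k ∈ Finset.range m, N k x • g k) =
      ∑ k ∈ Finset.range m, N k x ^ 2 := by
    rw [sum_inner]
    refine Finset.sum_congr rfl fun k hk => ?_
    rw [inner_sum, Finset.sum_eq_single_of_mem k hk]
    · rw [inner_smul_left, inner_smul_right, horth k (Finset.mem_range.1 hk) k
        (Finset.mem_range.1 hk)]
      simp [sq]
    · intro j hj hjk
      rw [inner_smul_left, inner_smul_right, horth k (Finset.mem_range.1 hk) j
        (Finset.mem_range.1 hj), if_neg (Ne.symm hjk)]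
      simp
  rw [norm_sub_sq_real, ← real_inner_self_eq_norm_sq, ← real_inner_self_eq_norm_sq, h1, h2, h3,
    powerSq]
  ring

/-- The Newton basis consists of orthonormal elements of the reproducing kernel Hilbert space. -/
theorem IsPGreedyOutput.exists_orthonormal (hK : IsPosDefKernel K) (hH : IsRKHSOf H K)
    {A : Set X} {e : ℝ} {D : ℕ} {ξ : ℕ → X} {N : ℕ → X → ℝ} (he : 0 < e)
    (h : IsPGreedyOutput K A e D ξ N) :
    ∃ g : ℕ → H, (∀ m < D, ∀ x, g m x = N m x) ∧
      ∀ i < D, ∀ j < D, inner ℝ (g i) (g j) = if i = j then (1 : ℝ) else 0 := by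
  have hex : ∀ m, m < D → ∃ v : H, ∀ x, v x = N m x := by
    intro m
    induction m using Nat.strong_induction_on with
    | _ m ih =>
      intro hm
      have ih' : ∀ k, k < m → ∃ v : H, ∀ x, v x = N k x := fun k hk => ih k hk (hk.trans hm)
      choose! g hg using ih'
      refine ⟨(√(powerSq K N m (ξ m)))⁻¹ •
        (RKHS.kerFun H (ξ m) 1 - ∑ k ∈ Finset.range m, N k (ξ m) • g k), fun x => ?_⟩
      rw [h.newton m hm x, RKHS.coe_smul, Pi.smul_apply, RKHS.coe_sub, Pi.sub_apply,
        RKHS.kerFun_apply, hH, RKHS_coe_sum, smul_eq_mul, div_eq_inv_mul]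
      congr 2
      refine Finset.sum_congr rfl fun k hk => ?_
      rw [RKHS.coe_smul, Pi.smul_apply, hg k (Finset.mem_range.1 hk), smul_eq_mul]
  choose! g hg using hex
  have hgm : ∀ m < D, g m = (√(powerSq K N m (ξ m)))⁻¹ •
      (RKHS.kerFun H (ξ m) 1 - ∑ k ∈ Finset.range m, N k (ξ m) • g k) := by
    intro m hm
    refine RKHS.ext fun x => ?_
    rw [hg m hm, h.newton m hm x, RKHS.coe_smul, Pi.smul_apply, RKHS.coe_sub, Pi.sub_apply,
      RKHS.kerFun_apply, hH, RKHS_coe_sum, smul_eq_mul, div_eq_inv_mul]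
    congr 2
    refine Finset.sum_congr rfl fun k hk => ?_
    rw [RKHS.coe_smul, Pi.smul_apply, hg k ((Finset.mem_range.1 hk).trans hm), smul_eq_mul]
  refine ⟨g, hg, ?_⟩
  have key : ∀ m ≤ D, ∀ i < m, ∀ j < m, inner ℝ (g i) (g j) = if i = j then (1 : ℝ) else 0 := by
    intro m
    induction m with
    | zero => intro _ i hi; omega
    | succ m ih =>
      intro hm
      have ih := ih (by omega)
      have hnew : ∀ j < m, inner ℝ (g m) (g j) = (0 : ℝ) := by
        intro j hj
        rw [hgm m hm, inner_smul_left, inner_sub_left, inner_kerFun_one, sum_inner,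
          Finset.sum_eq_single_of_mem j (Finset.mem_range.2 hj), inner_smul_left, ih j hj j hj,
          hg j (by omega)]
        · simp
        · intro k hk hkj
          rw [inner_smul_left, ih k (Finset.mem_range.1 hk) j hj, if_neg hkj, mul_zero]
      have hself : inner ℝ (g m) (g m) = (1 : ℝ) := by
        have hp := h.powerSq_pos hK he (show m < D by omega)
        rw [real_inner_self_eq_norm_sq, hgm m hm, norm_smul, mul_pow,
          norm_sq_residual hH (fun k hk => hg k (by omega)) ih, norm_inv, inv_pow,
          Real.norm_eq_abs, sq_abs, Real.sq_sqrt hp.le, inv_mul_cancel₀ hp.ne']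
      intro i hi j hj
      rcases Nat.lt_or_ge i m with hi' | hi' <;> rcases Nat.lt_or_ge j m with hj' | hj'
      · exact ih i hi' j hj'
      · obtain rfl : j = m := by omega
        rw [real_inner_comm, hnew i hi', if_neg (by omega)]
      · obtain rfl : i = m := by omega
        rw [hnew j hj', if_neg (by omega)]
      · obtain rfl : i = m := by omega
        obtain rfl : j = i := by omega
        rw [hself, if_pos rfl]
  exact key D le_rfl

theorem IsPGreedyOutput.feature_dotProduct_self_le (hK : IsPosDefKernel K) (hH : IsRKHSOf H K)
    {A : Set X} {e : ℝ} {D : ℕ} {ξ : ℕ → X} {N : ℕ → X → ℝ} (he : 0 < e)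
    (h : IsPGreedyOutput K A e D ξ N) (x : X) :
    feature N D x ⬝ᵥ feature N D x ≤ K x x := by
  obtain ⟨g, hg, horth⟩ := h.exists_orthonormal hK hH he
  have h1 := norm_sq_residual hH hg horth x
  have h2 : feature N D x ⬝ᵥ feature N D x = ∑ k ∈ Finset.range D, N k x ^ 2 := by
    rw [dotProduct, ← Fin.sum_univ_eq_sum_range (fun k => N k x ^ 2)]
    simp [feature, sq]
  have h3 := sq_nonneg ‖RKHS.kerFun H x (1 : ℝ) - ∑ k ∈ Finset.range D, N k x • g k‖
  rw [h1, powerSq] at h3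
  linarith

/-- Projection onto the span of the Newton basis: every `f` in the RKHS is linear in the features up
to an error controlled by the power function. -/
theorem IsPGreedyOutput.exists_linear_approx (hK : IsPosDefKernel K) (hH : IsRKHSOf H K)
    {A : Set X} {e : ℝ} {D : ℕ} {ξ : ℕ → X} {N : ℕ → X → ℝ} (he : 0 < e)
    (h : IsPGreedyOutput K A e D ξ N) (f : H) :
    ∃ θ : Fin D → ℝ, θ ⬝ᵥ θ ≤ ‖f‖ ^ 2 ∧ ∀ x ∈ A, |f x - feature N D x ⬝ᵥ θ| ≤ ‖f‖ * e := by
  obtain ⟨g, hg, horth⟩ := h.exists_orthonormal hK hH he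
  refine ⟨fun i => inner ℝ (g i) f, ?_, fun x hx => ?_⟩
  · have ho : Orthonormal ℝ fun i : Fin D => g i := by
      rw [orthonormal_iff_ite]
      intro i j
      rw [horth i i.2 j j.2]
      simp [Fin.ext_iff]
    have := ho.sum_inner_products_le f (s := Finset.univ)
    simpa [dotProduct, sq] using this
  · have h1 := norm_sq_residual hH hg horth x
    have h2 : f x - feature N D x ⬝ᵥ (fun i : Fin D => inner ℝ (g i) f) =
        inner ℝ (RKHS.kerFun H x (1 : ℝ) - ∑ k ∈ Finset.range D, N k x • g k) f := by
      rw [inner_sub_left, inner_kerFun_one, sum_inner, dotProduct,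
        ← Fin.sum_univ_eq_sum_range (fun k => inner ℝ (N k x • g k) f)]
      simp [feature, inner_smul_left]
    rw [h2]
    refine (abs_real_inner_le_norm _ _).trans ?_
    rw [mul_comm]
    refine mul_le_mul_of_nonneg_left ?_ (norm_nonneg f)
    refine le_of_lt (lt_of_pow_lt_pow_left₀ 2 he.le ?_)
    rw [h1]
    exact h.stops x hx

/-- An element of the RKHS is measurable on `A` as soon as the kernel sections at points of `A` are:
on `A` it agrees with its projection onto the closed span of these sections. -/
theorem measurable_restrict_of_mem_RKHS [MeasurableSpace X] (hH : IsRKHSOf H K) {A : Set X}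
    (hA : ∀ ξ ∈ A, Measurable fun x : A => K x ξ) (f : H) : Measurable fun x : A => f x := by
  set V := Submodule.span ℝ ((fun ξ => RKHS.kerFun H ξ (1 : ℝ)) '' A) with hV
  have hspan : ∀ v ∈ V, Measurable fun x : A => v x := by
    intro v hv
    induction hv using Submodule.span_induction with
    | mem v hv =>
      obtain ⟨ξ, hξ, rfl⟩ := hv
      simp only [RKHS.kerFun_apply]
      simpa only [hH _ ξ] using hA ξ hξ
    | zero => simp only [RKHS.coe_zero, Pi.zero_apply]; exact measurable_const
    | add u v _ _ hu hv => simp only [RKHS.coe_add, Pi.add_apply]; exact hu.add hv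
    | smul c v _ hv => simp only [RKHS.coe_smul, Pi.smul_apply]; exact hv.const_smul c
  obtain ⟨p, hp, r, hr, rfl⟩ := V.topologicalClosure.exists_add_mem_mem_orthogonal f
  obtain ⟨u, hu, hlim⟩ := mem_closure_iff_seq_limit.1 hp
  have hp' : Measurable fun x : A => p x :=
    measurable_of_tendsto_metrizable (fun n => hspan (u n) (hu n))
      (tendsto_pi_nhds.2 fun x => ((RKHS.continuous_eval (x : X)).tendsto p).comp hlim)
  convert hp' using 2 with x
  have : r x = 0 := by
    rw [← inner_kerFun_one]
    exact (Submodule.mem_orthogonal _ _).1 hr _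
      (Submodule.le_topologicalClosure _ (Submodule.subset_span ⟨x, x.2, rfl⟩))
  simp [this]

theorem IsPGreedyOutput.measurable_feature [MeasurableSpace X] {A : Set X} {e : ℝ} {D : ℕ}
    {ξ : ℕ → X} {N : ℕ → X → ℝ} (h : IsPGreedyOutput K A e D ξ N)
    (hA : ∀ ξ ∈ A, Measurable fun x : A => K x ξ) : Measurable fun x : A => feature N D x := by
  have key : ∀ m, m < D → Measurable fun x : A => N m x := by
    intro m
    induction m using Nat.strong_induction_on with
    | _ m ih =>
      intro hm
      simp only [h.newton m hm]
      refine ((hA _ (h.mem m hm)).sub (Finset.measurable_fun_sum _ fun k hk => ?_)).div_const _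
      have hk := Finset.mem_range.1 hk
      exact (ih k hk (hk.trans hm)).const_mul _
  exact measurable_pi_lambda _ fun i => key i i.2

end Newton

/-! ### The regret bound -/

section Regret

variable {D : ℕ} {lam : ℝ}

/-- The misspecified confidence bound: rewards which are linear in the features up to errors at most
`eps` and up to the noise `x`. -/
theorem abs_dotProduct_thetaHat_sub_le {R B δ eps : ℝ} (hl : 0 < lam) (hB : 0 ≤ B)
    (heps : 0 ≤ eps) (z : ℕ → Fin D → ℝ) (x y : ℕ → ℝ) (θ : Fin D → ℝ) (hθ : θ ⬝ᵥ θ ≤ B ^ 2) (t : ℕ)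
    (hy : ∀ s ∈ Finset.Icc 1 t, |y s - z s ⬝ᵥ θ - x s| ≤ eps)
    (hx : invNorm (gram lam z t) (noiseSum z x t) ≤
      R * √(Real.log ((lam⁻¹ • gram lam z t).det / δ ^ 2))) (v : Fin D → ℝ) :
    |v ⬝ᵥ thetaHat lam z y t - v ⬝ᵥ θ| ≤
      invNorm (gram lam z t) v * (beta lam R B δ z t + eps * psi lam z t) := by
  have hP := gram_posDef z hl t
  set A := gram lam z t with hA
  have hu : IsUnit A.det := hP.det_pos.ne'.isUnit
  have hsum : ∑ s ∈ Finset.Icc 1 t, y s • z s =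
      A *ᵥ θ - lam • θ + ∑ s ∈ Finset.Icc 1 t, (y s - z s ⬝ᵥ θ - x s) • z s + noiseSum z x t := by
    rw [hA, gram_mulVec, add_sub_cancel_left, noiseSum, ← Finset.sum_add_distrib,
      ← Finset.sum_add_distrib]
    refine Finset.sum_congr rfl fun s _ => ?_
    rw [← add_smul, ← add_smul]
    congr 1
    ring
  have hdec : v ⬝ᵥ thetaHat lam z y t - v ⬝ᵥ θ = -(lam * (v ⬝ᵥ (A⁻¹ *ᵥ θ))) +
      ∑ s ∈ Finset.Icc 1 t, (y s - z s ⬝ᵥ θ - x s) * (v ⬝ᵥ (A⁻¹ *ᵥ z s)) +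
      v ⬝ᵥ (A⁻¹ *ᵥ noiseSum z x t) := by
    rw [thetaHat, ← hA, hsum, Matrix.mulVec_add, Matrix.mulVec_add, Matrix.mulVec_sub,
      Matrix.mulVec_mulVec, Matrix.nonsing_inv_mul _ hu, Matrix.one_mulVec, Matrix.mulVec_smul,
      Matrix.mulVec_sum, dotProduct_add, dotProduct_add, dotProduct_sub, dotProduct_smul,
      dotProduct_sum, smul_eq_mul]
    simp only [Matrix.mulVec_smul, dotProduct_smul, smul_eq_mul]
    ring
  have hv0 := invNorm_nonneg A v
  have b1 : |lam * (v ⬝ᵥ (A⁻¹ *ᵥ θ))| ≤ invNorm A v * (√lam * B) := by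
    rw [abs_mul, abs_of_pos hl]
    have h1 := abs_dotProduct_inv_mulVec_le hP v θ
    have h2 : invNorm A θ ≤ B / √lam := by
      refine Real.sqrt_le_iff.2 ⟨by positivity, ?_⟩
      rw [div_pow, Real.sq_sqrt hl.le]
      exact (quad_inv_gram_le z hl t θ).trans (by gcongr)
    calc lam * |v ⬝ᵥ (A⁻¹ *ᵥ θ)| ≤ lam * (invNorm A v * (B / √lam)) := by
          gcongr; exact h1.trans (by gcongr)
      _ = invNorm A v * ((lam / √lam) * B) := by ring
      _ = _ := by rw [Real.div_sqrt]
  have b2 : |∑ s ∈ Finset.Icc 1 t, (y s - z s ⬝ᵥ θ - x s) * (v ⬝ᵥ (A⁻¹ *ᵥ z s))| ≤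
      invNorm A v * (eps * psi lam z t) := by
    refine (Finset.abs_sum_le_sum_abs _ _).trans ?_
    rw [psi, Finset.mul_sum, Finset.mul_sum]
    refine Finset.sum_le_sum fun s hs => ?_
    rw [abs_mul]
    have hs' := Finset.mem_Icc.1 hs
    have h1 := abs_dotProduct_inv_mulVec_le hP v (z s)
    have h2 : invNorm A (z s) ≤ invNorm (gram lam z (s - 1)) (z s) :=
      invNorm_gram_antitone z hl (z s) (by omega : s - 1 ≤ t)
    calc |y s - z s ⬝ᵥ θ - x s| * |v ⬝ᵥ (A⁻¹ *ᵥ z s)|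
        ≤ eps * (invNorm A v * invNorm (gram lam z (s - 1)) (z s)) := by
          gcongr
          · exact hy s hs
          · exact h1.trans (by gcongr)
      _ = _ := by ring
  have b3 : |v ⬝ᵥ (A⁻¹ *ᵥ noiseSum z x t)| ≤
      invNorm A v * (R * √(Real.log ((lam⁻¹ • A).det / δ ^ 2))) :=
    (abs_dotProduct_inv_mulVec_le hP v _).trans (by gcongr)
  rw [hdec, beta, ← hA]
  calc _ ≤ |lam * (v ⬝ᵥ (A⁻¹ *ᵥ θ))| +
        |∑ s ∈ Finset.Icc 1 t, (y s - z s ⬝ᵥ θ - x s) * (v ⬝ᵥ (A⁻¹ *ᵥ z s))| +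
        |v ⬝ᵥ (A⁻¹ *ᵥ noiseSum z x t)| := by
        refine (abs_add_le _ _).trans (add_le_add_left ((abs_add_le _ _).trans ?_) _)
        rw [abs_neg]
    _ ≤ _ := by linarith

/-- The regret on the event that the confidence bounds hold, in terms of the potential `ψ_T`. -/
theorem regret_le_of_confidence {X : Type*} {A : Set X} (hA : A.Nonempty) {N : ℕ → X → ℝ}
    {f : X → ℝ} {R B δ e : ℝ} {T : ℕ} (hl : 0 < lam) (hR : 0 ≤ R) (hB : 0 ≤ B) (hδ : 0 < δ)
    (he : 0 ≤ e) (θ : Fin D → ℝ) (hθ : θ ⬝ᵥ θ ≤ B ^ 2)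
    (hf : ∀ a ∈ A, |f a - feature N D a ⬝ᵥ θ| ≤ B * e) (x : ℕ → X) (noise : ℕ → ℝ)
    (hrun : IsUCBRun A D N lam R B δ e T x (fun t => f (x t) + noise t))
    (hgood : ∀ t ≤ T, invNorm (gram lam (fun s => feature N D (x s)) t)
        (noiseSum (fun s => feature N D (x s)) noise t) ≤
      R * √(Real.log ((lam⁻¹ • gram lam (fun s => feature N D (x s)) t).det / δ ^ 2))) :
    regret A f T x ≤ 2 * (B * e) * T +
      2 * (beta lam R B δ (fun s => feature N D (x s)) T +
        B * e * psi lam (fun s => feature N D (x s)) T) *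
        psi lam (fun s => feature N D (x s)) T := by
  set z : ℕ → Fin D → ℝ := fun s => feature N D (x s) with hz
  set y : ℕ → ℝ := fun t => f (x t) + noise t with hy
  have hxA : ∀ s ∈ Finset.Icc 1 T, x s ∈ A := by
    intro s hs
    have hs' := Finset.mem_Icc.1 hs
    have := (hrun (s - 1) (by omega)).1
    rwa [Nat.sub_add_cancel hs'.1] at this
  have heps : 0 ≤ B * e := mul_nonneg hB he
  set W := beta lam R B δ z T + B * e * psi lam z T with hW
  have : Nonempty A := hA.to_subtype
  refine ciSup_le fun a => ?_
  have hround : ∀ s ∈ Finset.Icc 1 T, f a - f (x s) ≤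
      2 * (B * e) + 2 * W * invNorm (gram lam z (s - 1)) (z s) := by
    intro s hs
    have hs' := Finset.mem_Icc.1 hs
    obtain ⟨t, rfl⟩ : ∃ t, s = t + 1 := ⟨s - 1, by omega⟩
    rw [Nat.add_sub_cancel]
    have hconf := abs_dotProduct_thetaHat_sub_le (R := R) (δ := δ) hl hB heps z noise y θ hθ t
      (fun s hs => by
        have hs'' := Finset.mem_Icc.1 hs
        have := hf (x s) (hxA s (by simp; omega))
        have e1 : y s - z s ⬝ᵥ θ - noise s = f (x s) - feature N D (x s) ⬝ᵥ θ := by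
          simp only [hy, hz]; ring
        rwa [e1]) (hgood t (by omega))
    have h1 := (abs_le.1 (hconf (feature N D a))).1
    have h2 := (abs_le.1 (hconf (z (t + 1)))).2
    have h3 := (hrun t (by omega)).2 a a.2
    have h4 := (abs_le.1 (hf a a.2)).2
    have h5 := (abs_le.1 (hf (x (t + 1)) (hxA _ hs))).1
    have h6 : beta lam R B δ z t + B * e * psi lam z t ≤ W := by
      have := beta_mono z (B := B) hl hR hδ (by omega : t ≤ T)
      have := mul_le_mul_of_nonneg_left (psi_mono z (lam := lam) (by omega : t ≤ T)) heps
      simp only [hW] at *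
      linarith
    have h7 := mul_le_mul_of_nonneg_left h6 (invNorm_nonneg (gram lam z t) (z (t + 1)))
    simp only [ucb] at h3
    change _ ≤ z (t + 1) ⬝ᵥ thetaHat lam z y t + invNorm (gram lam z t) (z (t + 1)) *
      (beta lam R B δ z t + B * e * psi lam z t) at h3
    change -(B * e) ≤ f (x (t + 1)) - z (t + 1) ⬝ᵥ θ at h5
    linarith
  refine (Finset.sum_le_sum hround).trans (le_of_eq ?_)
  rw [Finset.sum_add_distrib, Finset.sum_const, ← Finset.mul_sum]
  change _ + 2 * W * psi lam z T = _
  simp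
  ring

/-- The arithmetic of the regret bound, free of square roots: `s`, `g`, `a`, `l` stand for the
square roots of `T`, `D`, `log (T + 1)` and `log (1 / δ)`, `b` for `β_T`, `p` for `ψ_T`, `e` for the
error of the greedy selection and `Λ` for `√λ B`. -/
theorem regret_algebra {R B α Λ a l g s e p b : ℝ} (hR : 0 ≤ R) (hB : 0 ≤ B) (hα : 0 ≤ α)
    (hΛ : 0 ≤ Λ) (ha0 : 1 / 2 ≤ a) (hl0 : 0 ≤ l) (hg1 : 1 ≤ g) (hs1 : 1 ≤ s) (hp0 : 0 ≤ p)
    (hp' : p ≤ 2 * (s * g * a)) (hpp : p ^ 2 ≤ 2 * (s * g * a) ^ 2)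
    (hb' : b ≤ R * (g * a + 2 * l) + Λ) (hrate : e ≤ α / s) :
    2 * (B * e) * s ^ 2 + 2 * (b + B * e * p) * p ≤
      (12 * (B * α) + 16 * R + 8 * Λ) * a ^ 2 * (s * g * l + g ^ 2 * s) := by
  have hs0 : 0 < s := by linarith
  -- lower powers of `log (T + 1)` are absorbed in higher ones, since `a ≥ 1 / 2`
  have ha2 : a ≤ 2 * a ^ 2 := by nlinarith
  have hBe : B * e ≤ B * α / s := by rw [mul_div_assoc]; gcongr
  have t1 : B * e * s ^ 2 ≤ 4 * (B * α) * (a ^ 2 * (g ^ 2 * s)) := by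
    calc B * e * s ^ 2 ≤ B * α / s * s ^ 2 := by gcongr
      _ = (B * α) * s := by field_simp
      _ ≤ (B * α) * (4 * a ^ 2 * (g ^ 2 * s)) := by
        have h1 : 1 ≤ 4 * a ^ 2 := by nlinarith
        have h2 : s ≤ g ^ 2 * s := le_mul_of_one_le_left hs0.le (one_le_pow₀ hg1)
        refine mul_le_mul_of_nonneg_left ?_ (by positivity)
        exact h2.trans (le_mul_of_one_le_left (by positivity) h1)
      _ = _ := by ring
  have t2 : B * e * p ^ 2 ≤ 2 * (B * α) * (a ^ 2 * (g ^ 2 * s)) := by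
    calc B * e * p ^ 2 ≤ B * α / s * (2 * (s * g * a) ^ 2) := by gcongr
      _ = _ := by field_simp
  have hW0 : 0 ≤ R * (g * a + 2 * l) + Λ := by positivity
  have t3 : b * p ≤ (R * (g * a + 2 * l) + Λ) * (2 * (s * g * a)) := by
    calc b * p ≤ (R * (g * a + 2 * l) + Λ) * p := by gcongr
      _ ≤ _ := by gcongr
  have t4 : s * g * a * l ≤ 2 * (a ^ 2 * (s * g * l)) := by
    have := mul_le_mul_of_nonneg_left ha2 (by positivity : 0 ≤ s * g * l)
    linarith
  have t5 : s * g * a ≤ 2 * (a ^ 2 * (g ^ 2 * s)) := by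
    have h1 := mul_le_mul_of_nonneg_left ha2 (by positivity : 0 ≤ s * g)
    have h2 : s * g ≤ g ^ 2 * s := by nlinarith
    have h3 := mul_le_mul_of_nonneg_right h2 (by positivity : 0 ≤ 2 * a ^ 2)
    linarith
  have t4' := mul_le_mul_of_nonneg_left t4 hR
  have t5' := mul_le_mul_of_nonneg_left t5 (by positivity : 0 ≤ Λ)
  have hRr : 0 ≤ R * (a ^ 2 * (g ^ 2 * s)) := by positivity
  have hBr : 0 ≤ (B * α) * (a ^ 2 * (s * g * l)) := by positivity
  have hlr : 0 ≤ Λ * (a ^ 2 * (s * g * l)) := by positivity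
  have e1 : 2 * (B * e) * s ^ 2 + 2 * (b + B * e * p) * p =
      2 * (B * e * s ^ 2) + 2 * (b * p) + 2 * (B * e * p ^ 2) := by ring
  have e2 : (R * (g * a + 2 * l) + Λ) * (2 * (s * g * a)) =
      2 * (R * (a ^ 2 * (g ^ 2 * s))) + 4 * (R * (s * g * a * l)) + 2 * (Λ * (s * g * a)) := by ring
  have e3 : (12 * (B * α) + 16 * R + 8 * Λ) * a ^ 2 * (s * g * l + g ^ 2 * s) =
      12 * ((B * α) * (a ^ 2 * (s * g * l))) + 12 * ((B * α) * (a ^ 2 * (g ^ 2 * s))) +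
      (16 * (R * (a ^ 2 * (s * g * l))) + 16 * (R * (a ^ 2 * (g ^ 2 * s)))) +
      (8 * (Λ * (a ^ 2 * (s * g * l))) + 8 * (Λ * (a ^ 2 * (g ^ 2 * s)))) := by ring
  rw [e1, e3]
  rw [e2] at t3
  rw [mul_assoc] at t1 t2
  rw [mul_left_comm R 2] at t4'
  rw [mul_left_comm Λ 2] at t5'
  generalize a ^ 2 * (g ^ 2 * s) = x at *
  generalize a ^ 2 * (s * g * l) = y at *
  linarith

/-- The bounds on `β_T` and `ψ_T`, inserted into the regret bound of `regret_le_of_confidence`. -/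
theorem regret_terms_le {R B lam α q δ : ℝ} {T D : ℕ} (hR : 0 ≤ R) (hB : 0 ≤ B) (hα : 0 < α)
    (hT : 1 ≤ T) (hq : 1 / 2 ≤ q) (hδ : 0 < δ) (hδ1 : δ < 1) (hD : 1 ≤ D) {b p : ℝ} (hp0 : 0 ≤ p)
    (hp : p ≤ √(2 * T * D * Real.log (T + 1)))
    (hb : b ≤ R * √(D * Real.log (T + 1) + 2 * Real.log (1 / δ)) + √lam * B) :
    2 * (B * (α / (T : ℝ) ^ q)) * T + 2 * (b + B * (α / (T : ℝ) ^ q) * p) * p ≤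
      (12 * (B * α) + 16 * R + 8 * (√lam * B)) * Real.log (T + 1) ^ 1 *
        (√(T * D * Real.log (1 / δ)) + D * √T) := by
  have hT1 : (1 : ℝ) ≤ T := by exact_mod_cast hT
  have hD1 : (1 : ℝ) ≤ D := by exact_mod_cast hD
  have hℓ : 0 ≤ Real.log (1 / δ) := Real.log_nonneg (by rw [le_div_iff₀ hδ]; linarith)
  have hL : 1 / 4 ≤ Real.log ((T : ℝ) + 1) := by
    have h1 := Real.log_two_gt_d9
    have h2 := Real.log_le_log (by norm_num : (0 : ℝ) < 2) (by linarith : (2 : ℝ) ≤ (T : ℝ) + 1)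
    linarith
  obtain ⟨a, ha0, hLa⟩ : ∃ a : ℝ, 1 / 2 ≤ a ∧ Real.log ((T : ℝ) + 1) = a ^ 2 :=
    ⟨√(Real.log (T + 1)), Real.le_sqrt_of_sq_le (by norm_num; linarith),
      (Real.sq_sqrt (by linarith)).symm⟩
  obtain ⟨l, hl0, hℓl⟩ : ∃ l : ℝ, 0 ≤ l ∧ Real.log (1 / δ) = l ^ 2 :=
    ⟨√(Real.log (1 / δ)), Real.sqrt_nonneg _, (Real.sq_sqrt hℓ).symm⟩
  obtain ⟨g, hg1, hDg⟩ : ∃ g : ℝ, 1 ≤ g ∧ (D : ℝ) = g ^ 2 :=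
    ⟨√D, Real.one_le_sqrt.2 hD1, (Real.sq_sqrt (by linarith)).symm⟩
  obtain ⟨s, hs1, hsT, hTs⟩ : ∃ s : ℝ, 1 ≤ s ∧ √(T : ℝ) = s ∧ (T : ℝ) = s ^ 2 :=
    ⟨√T, Real.one_le_sqrt.2 hT1, rfl, (Real.sq_sqrt (by linarith)).symm⟩
  have hrate : α / (T : ℝ) ^ q ≤ α / s := by
    have : s ≤ (T : ℝ) ^ q := by
      rw [← hsT, Real.sqrt_eq_rpow]
      exact Real.rpow_le_rpow_of_exponent_le hT1 hq
    gcongr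
  have hrate0 : 0 ≤ α / (T : ℝ) ^ q := by positivity
  generalize α / (T : ℝ) ^ q = e at hrate hrate0 ⊢
  rw [hLa, hDg, hTs] at hp
  rw [hLa, hDg, hℓl] at hb
  rw [hLa, hDg, hTs, hℓl]
  have hp' : p ≤ 2 * (s * g * a) := by
    refine hp.trans (Real.sqrt_le_iff.2 ⟨by positivity, ?_⟩)
    have : 0 ≤ (s * g * a) ^ 2 := sq_nonneg _
    nlinarith
  have hpp : p ^ 2 ≤ 2 * (s * g * a) ^ 2 := by
    have := pow_le_pow_left₀ hp0 hp 2
    rw [Real.sq_sqrt (by positivity)] at this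
    nlinarith
  have hb' : b ≤ R * (g * a + 2 * l) + √lam * B := by
    refine hb.trans ?_
    gcongr
    refine Real.sqrt_le_iff.2 ⟨by positivity, ?_⟩
    have : 0 ≤ g * a * l := by positivity
    nlinarith [sq_nonneg l]
  have hsq : √(s ^ 2 * g ^ 2 * l ^ 2) = s * g * l := by
    rw [← mul_pow, ← mul_pow, Real.sqrt_sq (by positivity)]
  rw [hsq, Real.sqrt_sq (by linarith), pow_one]
  exact regret_algebra hR hB hα.le (by positivity) ha0 hl0 hg1 hs1 hp0 hp' hpp hb' hrate

/-- The regret bound with probability at least `1 - δ`. -/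
theorem le_measureReal_regret_le {X : Type*} [MeasurableSpace X] {K : X → X → ℝ}
    (hK : IsPosDefKernel K) (hK1 : ∀ x, K x x ≤ 1) {H : Type*} [NormedAddCommGroup H]
    [InnerProductSpace ℝ H] [CompleteSpace H] [RKHS ℝ H X ℝ] (hH : IsRKHSOf H K) {R B lam α : ℝ}
    (hR : 0 ≤ R) (hl : 1 ≤ lam) (hα : 0 < α) (f : H) (hf : ‖f‖ ≤ B) {A : Set X} (hA : A.Nonempty)
    (hAm : ∀ ξ ∈ A, Measurable fun x : A => K x ξ) {T : ℕ} {q δ : ℝ} (hT : 1 ≤ T)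
    (hq : 1 / 2 ≤ q) (hδ : 0 < δ) (hδ1 : δ < 1) {ξ : ℕ → X} {N : ℕ → X → ℝ}
    (hG : IsPGreedyOutput K A (α / (T : ℝ) ^ q) D ξ N) {S : Type*} [mS : MeasurableSpace S]
    (μ : Measure S) [IsProbabilityMeasure μ] (F : Filtration ℕ mS) (x : ℕ → S → X)
    (noise : ℕ → S → ℝ) (hx : ∀ t ∈ Finset.Icc 1 T, Measurable[F t] (x t))
    (hy : ∀ t ∈ Finset.Icc 1 T, Measurable[F (t + 1)] fun ω => f (x t ω) + noise t ω)
    (hsub : IsCondSubGaussian μ F R T noise)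
    (hrun : ∀ ω, IsUCBRun A D N lam R B δ (α / (T : ℝ) ^ q) T
      (fun t => x t ω) (fun t => f (x t ω) + noise t ω)) :
    1 - δ ≤ μ.real {ω | regret A f T (fun t => x t ω) ≤
      (12 * (B * α) + 16 * R + 8 * (√lam * B)) * Real.log (T + 1) ^ 1 *
        (√(T * D * Real.log (1 / δ)) + D * √T)} := by
  have hl0 : 0 < lam := by linarith
  have hB : 0 ≤ B := (norm_nonneg f).trans hf
  have hT0 : (0 : ℝ) < T := by exact_mod_cast hT
  have he : 0 < α / (T : ℝ) ^ q := by positivity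
  have hxA : ∀ t ∈ Finset.Icc 1 T, ∀ ω, x t ω ∈ A := by
    intro t ht ω
    have ht' := Finset.mem_Icc.1 ht
    have := (hrun ω (t - 1) (by omega)).1
    simpa only [Nat.sub_add_cancel ht'.1] using this
  have hz : ∀ t ∈ Finset.Icc 1 T, Measurable[F t] fun ω => feature N D (x t ω) := by
    intro t ht
    have h1 : Measurable[F t] fun ω => (⟨x t ω, hxA t ht ω⟩ : A) := (hx t ht).subtype_mk
    exact (hG.measurable_feature hAm).comp h1
  -- the noise is the observation minus `f (x t)`, and `f` is measurable on the arms
  have hn : ∀ t ∈ Finset.Icc 1 T, Measurable[F (t + 1)] (noise t) := by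
    intro t ht
    have h1 : Measurable[F t] fun ω => (⟨x t ω, hxA t ht ω⟩ : A) := (hx t ht).subtype_mk
    have h2 : Measurable[F (t + 1)] fun ω => f (x t ω) :=
      ((measurable_restrict_of_mem_RKHS hH hAm f).comp h1).mono (F.mono (by omega)) le_rfl
    have h3 := (hy t ht).sub h2
    have h4 : (fun ω => f (x t ω) + noise t ω) - (fun ω => f (x t ω)) = noise t := by
      ext ω; simp
    rwa [h4] at h3
  have hbad := measure_exists_lt_invNorm_noiseSum_le F hl0 hR hsub hz hn hδ hδ1
  set bad := {ω | ∃ t ≤ T,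
        R * √(Real.log ((lam⁻¹ • gram lam (fun s => feature N D (x s ω)) t).det / δ ^ 2)) <
          invNorm (gram lam (fun s => feature N D (x s ω)) t)
            (noiseSum (fun s => feature N D (x s ω)) (fun s => noise s ω) t)} with hbadDef
  obtain ⟨θ, hθ, hfθ⟩ := hG.exists_linear_approx hK hH he f
  set good := {ω | regret A f T (fun t => x t ω) ≤
      (12 * (B * α) + 16 * R + 8 * (√lam * B)) * Real.log (T + 1) ^ 1 *
        (√(T * D * Real.log (1 / δ)) + D * √T)} with hgoodDef
  have hsubset : goodᶜ ⊆ bad := by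
    intro ω hω
    by_contra hnb
    refine hω ?_
    have hgood : ∀ t ≤ T, invNorm (gram lam (fun s => feature N D (x s ω)) t)
            (noiseSum (fun s => feature N D (x s ω)) (fun s => noise s ω) t) ≤
          R * √(Real.log ((lam⁻¹ • gram lam (fun s => feature N D (x s ω)) t).det / δ ^ 2)) := by
      intro t ht
      by_contra hlt
      exact hnb ⟨t, ht, not_le.1 hlt⟩
    have h1 := regret_le_of_confidence hA hl0 hR hB hδ he.le θ
      (hθ.trans (pow_le_pow_left₀ (norm_nonneg f) hf 2))
      (fun a ha => (hfθ a ha).trans (by gcongr)) (fun t => x t ω) (fun t => noise t ω) (hrun ω)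
      hgood
    refine h1.trans ?_
    have hzz : ∀ s ∈ Finset.Icc 1 T,
        feature N D (x s ω) ⬝ᵥ feature N D (x s ω) ≤ 1 := fun s _ =>
      (hG.feature_dotProduct_self_le hK hH he _).trans (hK1 _)
    refine regret_terms_le hR hB hα hT hq hδ hδ1 hG.pos (psi_nonneg _ _)
      (psi_le _ hl T hzz) ?_
    have hd := one_le_det_scaled_gram (fun s => feature N D (x s ω)) hl0 T
    have hlog := log_det_scaled_gram_le (fun s => feature N D (x s ω)) hl T hzz
    rw [beta, Real.log_div (by linarith) (by positivity), Real.log_pow]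
    have : Real.log (1 / δ) = -Real.log δ := by rw [one_div, Real.log_inv]
    rw [this]
    gcongr
    push_cast
    linarith
  have h1 : μ.real goodᶜ ≤ δ := by
    rw [measureReal_def]
    refine ENNReal.toReal_le_of_le_ofReal hδ.le ((measure_mono hsubset).trans hbad)
  have h2 : 1 ≤ μ.real good + μ.real goodᶜ := by
    have := measureReal_union_le (μ := μ) good goodᶜ
    rwa [Set.union_compl_self, probReal_univ] at this
  linarith

end Regret

/-! ### Reasoning about programs of the real RAM -/

section Machine

theorem State.writeNat_nat (s : State) (arr i v a j : ℕ) :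
    (s.writeNat arr i v).nat a j = if a = arr ∧ j = i then v else s.nat a j := by
  unfold State.writeNat
  by_cases ha : a = arr
  · subst ha
    by_cases hj : j = i <;> simp [hj]
  · simp [ha]

theorem State.writeReal_real (s : State) (arr i j : ℕ) (v : ℝ) (a i' j' : ℕ) :
    (s.writeReal arr i j v).real a i' j' =
      if a = arr ∧ i' = i ∧ j' = j then v else s.real a i' j' := by
  unfold State.writeReal
  by_cases ha : a = arr
  · subst ha
    by_cases hi : i' = i
    · subst hi
      by_cases hj : j' = j <;> simp [hj]
    · simp [hi]
  · simp [ha]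

/-- The natural arrays which occur as targets in a program. -/
def Program.natWrites : Program → List ℕ
  | setNat arr _ _ => [arr]
  | setReal _ _ _ _ => []
  | play _ _ _ _ => []
  | seq p q => p.natWrites ++ q.natWrites
  | ite _ p q => p.natWrites ++ q.natWrites
  | loop v _ p => v :: p.natWrites

/-- The real arrays which occur as targets in a program. -/
def Program.realWrites : Program → List ℕ
  | setNat _ _ _ => []
  | setReal arr _ _ _ => [arr]
  | play _ arr _ _ => [arr]
  | seq p q => p.realWrites ++ q.realWrites
  | ite _ p q => p.realWrites ++ q.realWrites
  | loop _ _ p => p.realWrites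

/-- Whether a program contains no `play` instruction. -/
def Program.silent : Program → Bool
  | setNat _ _ _ => true
  | setReal _ _ _ _ => true
  | play _ _ _ _ => false
  | seq p q => p.silent && q.silent
  | ite _ p q => p.silent && q.silent
  | loop _ _ p => p.silent

/-- The memory of `s'` differs from that of `s` at most in the arrays which `p` writes to. -/
structure Frame (p : Program) (s s' : State) : Prop where
  nat : ∀ a, a ∉ p.natWrites → s'.nat a = s.nat a
  real : ∀ a, a ∉ p.realWrites → s'.real a = s.real a
  played : p.silent = true → s'.played = s.played

variable (κ : ℕ → ℕ → ℝ) (y : ℕ → ℝ)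

/-- The execution of a loop as an explicit recursion on the number of iterations. -/
theorem exec_loop_eq (v : ℕ) (b : NatExpr) (p : Program) (s : State) :
    (Program.loop v b p).exec κ y s =
      Nat.rec (s.charge (b.cost + 1))
        (fun k s' => p.exec κ y ((s'.writeNat v 0 k).charge 1)) (b.eval s) := rfl

theorem loopStart_frame {v : ℕ} {b : NatExpr} {p : Program} {s s' : State} (k : ℕ)
    (h : Frame (.loop v b p) s s') : Frame (.loop v b p) s ((s'.writeNat v 0 k).charge 1) := by
  refine ⟨fun a ha => ?_, h.real, h.played⟩
  rw [← h.nat a ha]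
  funext j
  have : a ≠ v := fun h => ha (by simp [Program.natWrites, h])
  exact (State.writeNat_nat s' v 0 k a j).trans (by simp [this])

/-- The frame rule: every program leaves alone the arrays it does not write to. -/
theorem exec_frame (p : Program) (s : State) : Frame p s (p.exec κ y s) := by
  induction p generalizing s with
  | setNat arr i e =>
    refine ⟨fun a ha => ?_, fun _ _ => rfl, fun _ => rfl⟩
    funext j
    have : a ≠ arr := fun h => ha (by simp [Program.natWrites, h])
    exact (State.writeNat_nat s arr (i.eval s) (e.eval s) a j).trans (by simp [this])
  | setReal arr i j e =>
    refine ⟨fun _ _ => rfl, fun a ha => ?_, fun _ => rfl⟩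
    funext i' j'
    have : a ≠ arr := fun h => ha (by simp [Program.realWrites, h])
    exact (State.writeReal_real s arr (i.eval s) (j.eval s) (e.eval κ s) a i' j').trans
      (by simp [this])
  | play k arr i j =>
    refine ⟨fun _ _ => rfl, fun a ha => ?_, fun h => by simp [Program.silent] at h⟩
    funext i' j'
    have : a ≠ arr := fun h => ha (by simp [Program.realWrites, h])
    exact (State.writeReal_real s arr (i.eval s) (j.eval s) _ a i' j').trans (by simp [this])
  | seq p q ihp ihq =>
    refine ⟨fun a ha => ?_, fun a ha => ?_, fun h => ?_⟩
    · simp only [Program.natWrites, List.mem_append, not_or] at ha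
      exact ((ihq _).nat a ha.2).trans ((ihp s).nat a ha.1)
    · simp only [Program.realWrites, List.mem_append, not_or] at ha
      exact ((ihq _).real a ha.2).trans ((ihp s).real a ha.1)
    · simp only [Program.silent, Bool.and_eq_true] at h
      exact ((ihq _).played h.2).trans ((ihp s).played h.1)
  | ite b p q ihp ihq =>
    simp only [Program.exec]
    split_ifs
    · refine ⟨fun a ha => ?_, fun a ha => ?_, fun h => ?_⟩
      · simp only [Program.natWrites, List.mem_append, not_or] at ha
        exact (ihp _).nat a ha.1
      · simp only [Program.realWrites, List.mem_append, not_or] at ha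
        exact (ihp _).real a ha.1
      · simp only [Program.silent, Bool.and_eq_true] at h
        exact (ihp _).played h.1
    · refine ⟨fun a ha => ?_, fun a ha => ?_, fun h => ?_⟩
      · simp only [Program.natWrites, List.mem_append, not_or] at ha
        exact (ihq _).nat a ha.2
      · simp only [Program.realWrites, List.mem_append, not_or] at ha
        exact (ihq _).real a ha.2
      · simp only [Program.silent, Bool.and_eq_true] at h
        exact (ihq _).played h.2
  | loop v b p ih =>
    rw [exec_loop_eq]
    generalize b.eval s = n
    induction n with
    | zero => exact ⟨fun _ _ => rfl, fun _ _ => rfl, fun _ => rfl⟩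
    | succ k ihk =>
      have h1 := loopStart_frame k ihk
      refine ⟨fun a ha => ((ih _).nat a fun h => ha ?_).trans (h1.nat a ha),
        fun a ha => ((ih _).real a ha).trans (h1.real a ha),
        fun h => ((ih _).played h).trans (h1.played h)⟩
      simp [Program.natWrites, h]

variable {κ y}

/-- The invariant rule for loops. The invariant `I` holds before the counter is written; the frame
of the whole loop is available in every iteration. -/
theorem exec_loop {v : ℕ} {b : NatExpr} {p : Program} {s : State} {n : ℕ} (hn : b.eval s = n)
    (I : ℕ → State → Prop) (h0 : I 0 (s.charge (b.cost + 1)))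
    (hstep : ∀ k < n, ∀ s', Frame (.loop v b p) s s' → I k s' →
      I (k + 1) (p.exec κ y ((s'.writeNat v 0 k).charge 1))) :
    I n ((Program.loop v b p).exec κ y s) := by
  rw [exec_loop_eq, hn]
  have key : ∀ k ≤ n, Frame (.loop v b p) s
      (Nat.rec (motive := fun _ => State) (s.charge (b.cost + 1))
        (fun k s' => p.exec κ y ((s'.writeNat v 0 k).charge 1)) k) ∧
      I k (Nat.rec (motive := fun _ => State) (s.charge (b.cost + 1))
        (fun k s' => p.exec κ y ((s'.writeNat v 0 k).charge 1)) k) := by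
    intro k
    induction k with
    | zero => exact fun _ => ⟨⟨fun _ _ => rfl, fun _ _ => rfl, fun _ => rfl⟩, h0⟩
    | succ k ih =>
      intro hk
      obtain ⟨hF, hI⟩ := ih (by omega)
      refine ⟨?_, hstep k (by omega) _ hF hI⟩
      have h1 := loopStart_frame k hF
      refine ⟨fun a ha => ((exec_frame κ y p _).nat a fun h => ha ?_).trans (h1.nat a ha),
        fun a ha => ((exec_frame κ y p _).real a ha).trans (h1.real a ha),
        fun h => ((exec_frame κ y p _).played h).trans (h1.played h)⟩
      simp [Program.natWrites, h]
  exact (key n le_rfl).2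

/-- The invariant rule for loops whose body makes at most `c` steps, for an invariant which mentions
only the real memory. -/
theorem exec_loop_real {v : ℕ} {b : NatExpr} {p : Program} {s : State} {n : ℕ}
    (hn : b.eval s = n) (c : ℕ) (P : ℕ → (ℕ → ℕ → ℕ → ℝ) → Prop) (h0 : P 0 s.real)
    (hstep : ∀ k < n, ∀ s', Frame (.loop v b p) s s' → s'.nat v 0 = k → P k s'.real →
      P (k + 1) (p.exec κ y s').real ∧ (p.exec κ y s').steps ≤ s'.steps + c) :
    P n ((Program.loop v b p).exec κ y s).real ∧
      ((Program.loop v b p).exec κ y s).steps ≤ s.steps + (b.cost + 1 + n * (c + 1)) := by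
  refine exec_loop hn
    (fun k s' => P k s'.real ∧ s'.steps ≤ s.steps + (b.cost + 1 + k * (c + 1)))
    ⟨h0, by simp [State.charge]⟩ fun k hk s' hF hI => ?_
  have h := hstep k hk _ (loopStart_frame k hF)
    ((State.writeNat_nat s' v 0 k v 0).trans (by simp)) hI.1
  refine ⟨h.1, h.2.trans ?_⟩
  have h2 := hI.2
  simp only [State.charge, State.writeNat]
  rw [add_mul]
  omega

end Machine

/-! ### The program -/

/-!
Layout of the memory. Natural arrays: `0` holds the number of arms and the horizon, `1` the number
of selected points, `2` the selected points, `3` the flag of the stopping test, `4` the result of a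
maximization; `5` to `8` are loop counters. Real arrays: `0` holds the parameters `e`, `λ`, `R`,
`B`, `δ`, `1` the Newton basis (arm, index), `2` the squared power function, `4` the inverse Gram
matrix, `5` the vector `∑ y_s z_s`, `8` the scaled determinant, `9` the potential `ψ_t`, `10` the
factor `β_t + ε ψ_t`, `11` the upper confidence bounds, `12` a product of `A_t⁻¹` with a feature
vector, `13` the last reward; `3`, `6`, `7` are accumulators.
-/

namespace Program

/-- The number of arms. -/
def arms : NatExpr := .get 0 (.lit 0)

/-- The horizon. -/
def horizon : NatExpr := .get 0 (.lit 1)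

/-- The number of points selected so far. -/
def dim : NatExpr := .get 1 (.lit 0)

/-- The scalar stored in a natural array. -/
def cell (a : ℕ) : NatExpr := .get a (.lit 0)

/-- The scalar stored in a real array. -/
def scalar (r : ℕ) : RealExpr := .get r (.lit 0) (.lit 0)

/-- Store in the scalar `r` the sum of the values of `e` over the counter `v` below `dim`. -/
def sum (r v : ℕ) (e : RealExpr) : Program :=
  .seq (.setReal r (.lit 0) (.lit 0) (.lit 0))
    (.loop v dim (.setReal r (.lit 0) (.lit 0) (.add (scalar r) e)))

/-- Store in the vector `12` the product of the matrix `4` and the row of the array `1` whose number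
is in the cell `a`. -/
def matVec (a : ℕ) : Program :=
  .loop 7 dim (.seq
    (sum 3 8 (.mul (.get 4 (cell 7) (cell 8)) (.get 1 (cell a) (cell 8))))
    (.setReal 12 (.lit 0) (cell 7) (scalar 3)))

/-- Store in the cell `4` an index at which the column `0` of the array `r` is maximal. The
instruction set has no empty program; the second branch rewrites the cell `4` instead. -/
def argmax (r : ℕ) : Program :=
  .seq (.setNat 4 (.lit 0) (.lit 0))
    (.loop 6 arms (.ite (.leReal (.get r (cell 4) (.lit 0)) (.get r (cell 6) (.lit 0)))
      (.setNat 4 (.lit 0) (cell 6)) (.setNat 4 (.lit 0) (cell 4))))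

/-- The column number `dim` of the Newton basis, at all arms; the new point is in the cell `4`. -/
def newtonColumn : Program :=
  .loop 6 arms (.seq
    (sum 3 7 (.mul (.get 1 (cell 4) (cell 7)) (.get 1 (cell 6) (cell 7))))
    (.setReal 1 (cell 6) dim
      (.div (.sub (.kern (cell 6) (cell 4)) (scalar 3)) (.sqrt (.get 2 (cell 4) (.lit 0))))))

/-- Update of the squared power function. -/
def powerUpdate : Program :=
  .loop 6 arms (.setReal 2 (cell 6) (.lit 0)
    (.sub (.get 2 (cell 6) (.lit 0)) (.mul (.get 1 (cell 6) dim) (.get 1 (cell 6) dim))))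

/-- The stopping test of the `P`-greedy algorithm; the cell `3` is set to `1` if it succeeds. -/
def stopTest : Program :=
  .ite (.leReal (.mul (scalar 0) (scalar 0)) (.get 2 (cell 4) (.lit 0)))
    (.setNat 3 (.lit 0) (.lit 0)) (.setNat 3 (.lit 0) (.lit 1))

/-- One selection of the `P`-greedy algorithm, given the next point in the cell `4`. -/
def greedyStep : Program :=
  .seq (.setNat 2 dim (cell 4)) <| .seq newtonColumn <| .seq powerUpdate <|
    .seq (.setNat 1 (.lit 0) (.add dim (.lit 1))) <| .seq (argmax 2) stopTest

/-- The `P`-greedy algorithm. There is no conditional loop: one iteration per arm suffices for all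
selections, and the iterations after the stopping test has succeeded do nothing of consequence. -/
def greedy : Program :=
  .seq (.loop 6 arms (.setReal 2 (cell 6) (.lit 0) (.kern (cell 6) (cell 6)))) <|
    .seq (argmax 2) <|
      .loop 5 arms (.ite (.ltNat (cell 3) (.lit 1)) greedyStep (.setNat 6 (.lit 0) (.lit 0)))

/-- Initialization of the inverse of the Gram matrix (array `4`) and of the scaled determinant
(array `8`). -/
def gramInit : Program :=
  .seq (.loop 7 dim (.seq (.loop 8 dim (.setReal 4 (cell 7) (cell 8) (.lit 0)))
      (.setReal 4 (cell 7) (cell 7) (.div (.lit 1) (.get 0 (.lit 0) (.lit 1))))))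
    (.setReal 8 (.lit 0) (.lit 0) (.lit 1))

/-- The factor `β_t + ε ψ_t`, stored in the array `10`. -/
def width : Program :=
  .setReal 10 (.lit 0) (.lit 0)
    (.add (.add (.mul (.get 0 (.lit 0) (.lit 2)) (.sqrt (.log (.div (scalar 8)
        (.mul (.get 0 (.lit 0) (.lit 4)) (.get 0 (.lit 0) (.lit 4)))))))
      (.mul (.sqrt (.get 0 (.lit 0) (.lit 1))) (.get 0 (.lit 0) (.lit 3))))
      (.mul (.mul (.get 0 (.lit 0) (.lit 3)) (scalar 0)) (scalar 9)))

/-- The upper confidence bounds of all arms, stored in the array `11`. -/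
def bounds : Program :=
  .loop 6 arms (.seq (matVec 6) <|
    .seq (sum 6 7 (.mul (.get 12 (.lit 0) (cell 7)) (.get 5 (.lit 0) (cell 7)))) <|
    .seq (sum 7 7 (.mul (.get 1 (cell 6) (cell 7)) (.get 12 (.lit 0) (cell 7)))) <|
    .setReal 11 (cell 6) (.lit 0) (.add (scalar 6) (.mul (.sqrt (scalar 7)) (scalar 10))))

/-- Update of the vector `∑ y_s z_s` (array `5`) with the reward in the array `13`. -/
def rewardUpdate : Program :=
  .loop 7 dim (.setReal 5 (.lit 0) (cell 7) (.add (.get 5 (.lit 0) (cell 7))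
    (.mul (scalar 13) (.get 1 (cell 4) (cell 7)))))

/-- The Sherman–Morrison update of the inverse of the Gram matrix. -/
def inverseUpdate : Program :=
  .loop 7 dim (.loop 8 dim (.setReal 4 (cell 7) (cell 8) (.sub (.get 4 (cell 7) (cell 8))
    (.div (.mul (.get 12 (.lit 0) (cell 7)) (.get 12 (.lit 0) (cell 8)))
      (.add (.lit 1) (scalar 7))))))

/-- One round of the modified LinUCB algorithm. -/
def ucbRound : Program :=
  .seq width <| .seq bounds <| .seq (argmax 11) <|
    .seq (.play (cell 4) 13 (.lit 0) (.lit 0)) <| .seq (matVec 4) <|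
    .seq (sum 7 7 (.mul (.get 1 (cell 4) (cell 7)) (.get 12 (.lit 0) (cell 7)))) <|
    .seq (.setReal 9 (.lit 0) (.lit 0) (.add (scalar 9) (.sqrt (scalar 7)))) <|
    .seq (.setReal 8 (.lit 0) (.lit 0) (.mul (scalar 8) (.add (.lit 1) (scalar 7)))) <|
    .seq rewardUpdate inverseUpdate

/-- The APG-UCB algorithm. -/
def apgucb : Program :=
  .seq greedy <| .seq gramInit <| .loop 5 horizon ucbRound

end Program

/-! ### Correctness and cost of the building blocks -/

section Blocks

variable {κ : ℕ → ℕ → ℝ} {y : ℕ → ℝ}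

theorem exec_seq (p q : Program) (s : State) :
    (Program.seq p q).exec κ y s = q.exec κ y (p.exec κ y s) := rfl

theorem exec_ite_of_holds {b : Test} {s : State} (h : b.holds κ s) (p q : Program) :
    (Program.ite b p q).exec κ y s = p.exec κ y (s.charge b.cost) := by
  simp only [Program.exec, if_pos h]

theorem exec_ite_of_not_holds {b : Test} {s : State} (h : ¬ b.holds κ s) (p q : Program) :
    (Program.ite b p q).exec κ y s = q.exec κ y (s.charge b.cost) := by
  simp only [Program.exec, if_neg h]

theorem exec_setNat_nat (arr : ℕ) (i e : NatExpr) (s : State) (a j : ℕ) :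
    ((Program.setNat arr i e).exec κ y s).nat a j =
      if a = arr ∧ j = i.eval s then e.eval s else s.nat a j :=
  State.writeNat_nat ..

theorem exec_setReal_real (arr : ℕ) (i j : NatExpr) (e : RealExpr) (s : State) (a i' j' : ℕ) :
    ((Program.setReal arr i j e).exec κ y s).real a i' j' =
      if a = arr ∧ i' = i.eval s ∧ j' = j.eval s then e.eval κ s else s.real a i' j' :=
  State.writeReal_real ..

theorem exec_setNat_steps (arr : ℕ) (i e : NatExpr) (s : State) :
    ((Program.setNat arr i e).exec κ y s).steps = s.steps + (i.cost + e.cost + 1) := rfl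

theorem exec_setReal_steps (arr : ℕ) (i j : NatExpr) (e : RealExpr) (s : State) :
    ((Program.setReal arr i j e).exec κ y s).steps =
      s.steps + (i.cost + j.cost + e.cost + 1) := rfl

/-- The rule for sums: the summand `e` may be evaluated in any state which differs from `s` in the
counter and the accumulator only. -/
theorem exec_sum {r v : ℕ} {e : RealExpr} {s : State} {D : ℕ} (hD : s.nat 1 0 = D)
    (g : ℕ → ℝ) (he : ∀ k < D, ∀ s', s'.nat v 0 = k → (∀ a, a ≠ v → s'.nat a = s.nat a) →
      (∀ a, a ≠ r → s'.real a = s.real a) → e.eval κ s' = g k) :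
    ((Program.sum r v e).exec κ y s).real r 0 0 = ∑ k ∈ Finset.range D, g k ∧
      ((Program.sum r v e).exec κ y s).steps ≤ s.steps + (7 + D * (e.cost + 8)) := by
  rw [Program.sum, exec_seq]
  set s1 := (Program.setReal r (.lit 0) (.lit 0) (.lit 0)).exec κ y s with hs1
  have hF1 : Frame (.setReal r (.lit 0) (.lit 0) (.lit 0)) s s1 := exec_frame κ y _ s
  have h := exec_loop_real (κ := κ) (y := y) (v := v) (b := Program.dim)
    (p := .setReal r (.lit 0) (.lit 0) (.add (Program.scalar r) e)) (s := s1) (n := D) hD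
    (e.cost + 7) (fun k m => m r 0 0 = ∑ k ∈ Finset.range k, g k)
    (by rw [hs1, exec_setReal_real]; simp [NatExpr.eval, RealExpr.eval])
    (fun k hk s' hF hv' hP => by
      constructor
      · rw [exec_setReal_real]
        simp only [NatExpr.eval, and_self, if_true, RealExpr.eval, Program.scalar]
        rw [hP, Finset.sum_range_succ]
        congr 1
        refine he k hk s' hv' (fun a ha => ?_) (fun a ha => ?_)
        · rw [hF.nat a (by simpa [Program.natWrites] using ha),
            hF1.nat a (by simp [Program.natWrites])]
        · rw [hF.real a (by simpa [Program.realWrites] using ha),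
            hF1.real a (by simpa [Program.realWrites] using ha)]
      · rw [exec_setReal_steps]
        simp only [NatExpr.cost, RealExpr.cost, Program.scalar]
        omega)
  refine ⟨h.1, h.2.trans ?_⟩
  rw [hs1, exec_setReal_steps]
  simp only [NatExpr.cost, RealExpr.cost, Program.dim]
  rw [add_assoc e.cost 7 1]
  omega

theorem exec_matVec {a : ℕ} (ha : a = 4 ∨ a = 6) {s : State} {D : ℕ} (hD : s.nat 1 0 = D) :
    (∀ j < D, ((Program.matVec a).exec κ y s).real 12 0 j =
      ∑ k ∈ Finset.range D, s.real 4 j k * s.real 1 (s.nat a 0) k) ∧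
      ((Program.matVec a).exec κ y s).steps ≤ s.steps + (3 + D * (7 + D * 19 + 8 + 1)) := by
  have h := exec_loop_real (κ := κ) (y := y) (v := 7) (b := Program.dim)
    (p := .seq (Program.sum 3 8 (.mul (.get 4 (Program.cell 7) (Program.cell 8))
        (.get 1 (Program.cell a) (Program.cell 8))))
      (.setReal 12 (.lit 0) (Program.cell 7) (Program.scalar 3))) (s := s) (n := D) hD
    (7 + D * 19 + 8)
    (fun i m => ∀ j < i, m 12 0 j = ∑ k ∈ Finset.range D, s.real 4 j k * s.real 1 (s.nat a 0) k)
    (fun j hj => absurd hj (by omega))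
    (fun i hi s' hF hv' hP => by
      have n1 : s'.nat 1 = s.nat 1 := hF.nat 1 (by simp [Program.natWrites, Program.sum])
      have na : s'.nat a = s.nat a :=
        hF.nat a (by rcases ha with rfl | rfl <;> simp [Program.natWrites, Program.sum])
      have r4 : s'.real 4 = s.real 4 := hF.real 4 (by simp [Program.realWrites, Program.sum])
      have r1 : s'.real 1 = s.real 1 := hF.real 1 (by simp [Program.realWrites, Program.sum])
      rw [exec_seq]
      set p1 := Program.sum 3 8 (.mul (.get 4 (Program.cell 7) (Program.cell 8))
        (.get 1 (Program.cell a) (Program.cell 8))) with hp1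
      have hs := exec_sum (κ := κ) (y := y) (r := 3) (v := 8)
        (e := .mul (.get 4 (Program.cell 7) (Program.cell 8))
        (.get 1 (Program.cell a) (Program.cell 8))) (s := s') (D := D)
        (by rw [n1, hD]) (fun k => s.real 4 i k * s.real 1 (s.nat a 0) k)
        (fun k _ s'' hk hn hr => by
          simp only [RealExpr.eval, NatExpr.eval, Program.cell]
          rw [hr 4 (by norm_num), hr 1 (by norm_num), r4, r1, hk, hn 7 (by norm_num), hv',
            hn a (by rcases ha with rfl | rfl <;> norm_num), na])
      rw [← hp1] at hs
      have hF1 := exec_frame κ y p1 s'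
      set s1 := p1.exec κ y s' with hs1
      have n7 : s1.nat 7 0 = i := by
        rw [hF1.nat 7 (by simp [Program.natWrites, Program.sum, hp1]), hv']
      constructor
      · intro j hj
        rw [exec_setReal_real]
        simp only [NatExpr.eval, RealExpr.eval, Program.cell, Program.scalar, n7, true_and]
        split_ifs with hji
        · subst hji; exact hs.1
        · rw [hF1.real 12 (by simp [Program.realWrites, Program.sum, hp1])]
          exact hP j (by omega)
      · rw [exec_setReal_steps]
        have h2 : s1.steps ≤ s'.steps + (7 + D * 19) := hs.2
        simp only [NatExpr.cost, RealExpr.cost, Program.cell, Program.scalar]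
        omega)
  exact h

theorem exec_argmax {r : ℕ} {s : State} {n : ℕ} (hn : s.nat 0 0 = n) (hn1 : 1 ≤ n) :
    ((Program.argmax r).exec κ y s).nat 4 0 < n ∧
      (∀ i < n, s.real r i 0 ≤ s.real r (((Program.argmax r).exec κ y s).nat 4 0) 0) ∧
      ((Program.argmax r).exec κ y s).steps ≤ s.steps + (6 + n * 15) := by
  rw [Program.argmax, exec_seq]
  set s1 := (Program.setNat 4 (.lit 0) (.lit 0)).exec κ y s with hs1
  have h40 : s1.nat 4 0 = 0 := by rw [hs1, exec_setNat_nat]; simp [NatExpr.eval]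
  have hn' : s1.nat 0 0 = n := by rw [hs1, exec_setNat_nat]; simp [hn]
  have hst : s1.steps = s.steps + 3 := by
    rw [hs1, exec_setNat_steps]; simp [NatExpr.cost]
  have h := exec_loop (κ := κ) (y := y) (v := 6) (b := Program.arms)
    (p := .ite (.leReal (.get r (Program.cell 4) (.lit 0)) (.get r (Program.cell 6) (.lit 0)))
      (.setNat 4 (.lit 0) (Program.cell 6)) (.setNat 4 (.lit 0) (Program.cell 4)))
    (s := s1) (n := n) hn'
    (fun k s' => s'.nat 4 0 < n ∧ (∀ i < k, s.real r i 0 ≤ s.real r (s'.nat 4 0) 0) ∧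
      s'.steps ≤ s.steps + (6 + k * 15))
    ⟨by simp [State.charge, h40]; omega, fun i hi => absurd hi (by omega), by
      simp [State.charge, NatExpr.cost, Program.arms, hst]⟩
    (fun k hk s' hF hI => by
      obtain ⟨h1, h2, h3⟩ := hI
      have hr : s'.real r = s.real r := hF.real r (by simp [Program.realWrites])
      set s2 := (s'.writeNat 6 0 k).charge 1 with hs2
      have e4 : s2.nat 4 0 = s'.nat 4 0 := by
        change (s'.writeNat 6 0 k).nat 4 0 = _; rw [State.writeNat_nat]; simp
      have e6 : s2.nat 6 0 = k := by
        change (s'.writeNat 6 0 k).nat 6 0 = _; rw [State.writeNat_nat]; simp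
      have er : s2.real r = s.real r := hr
      have es : s2.steps = s'.steps + 1 := rfl
      simp only [Program.exec]
      split_ifs with hle
      · simp only [Test.holds, RealExpr.eval, NatExpr.eval, Program.cell, e4, e6, er] at hle
        refine ⟨?_, ?_, ?_⟩
        · simp [State.charge, State.writeNat_nat, NatExpr.eval, Program.cell, e6, hk]
        · intro i hi
          simp only [State.charge, State.writeNat_nat, NatExpr.eval, Program.cell, e6, and_self,
            if_true]
          rcases Nat.lt_or_ge i k with h | h
          · exact (h2 i h).trans hle
          · obtain rfl : i = k := by omega
            exact le_rfl
        · simp only [State.charge, State.writeNat, NatExpr.cost, RealExpr.cost, Test.cost,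
            Program.cell, es]
          omega
      · simp only [Test.holds, RealExpr.eval, NatExpr.eval, Program.cell, e4, e6, er,
          not_le] at hle
        refine ⟨?_, ?_, ?_⟩
        · simp [State.charge, State.writeNat_nat, NatExpr.eval, Program.cell, e4, h1]
        · intro i hi
          simp only [State.charge, State.writeNat_nat, NatExpr.eval, Program.cell, e4, and_self,
            if_true]
          rcases Nat.lt_or_ge i k with h | h
          · exact h2 i h
          · obtain rfl : i = k := by omega
            exact hle.le
        · simp only [State.charge, State.writeNat, NatExpr.cost, RealExpr.cost, Test.cost,
            Program.cell, es]
          omega)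
  exact h

end Blocks

/-! ### Correctness and cost of the greedy selection -/

section PartialGreedy

variable {X : Type*} {K : X → X → ℝ} {n : ℕ} {a : Fin n → X} {e : ℝ}

/-- The first `m` selections of a run of the `P`-greedy algorithm on the numbered arms `a`, where
`p k` is the number of the `k`-th selected arm. The stopping test has failed after each of the first
`m - 1` selections; nothing is said about the test after the last one. -/
structure IsPartialGreedy (K : X → X → ℝ) (a : Fin n → X) (e : ℝ) (m : ℕ) (p : ℕ → Fin n)
    (N : ℕ → X → ℝ) : Prop where
  greedy : ∀ k < m, ∀ i, powerSq K N k (a i) ≤ powerSq K N k (a (p k))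
  newton : ∀ k < m, ∀ x, N k x =
    (K x (a (p k)) - ∑ l ∈ Finset.range k, N l (a (p k)) * N l x) / √(powerSq K N k (a (p k)))
  continues : ∀ k, 1 ≤ k → k < m → e ^ 2 ≤ powerSq K N k (a (p k))

theorem powerSq_congr {N N' : ℕ → X → ℝ} {m : ℕ} (h : ∀ k < m, N k = N' k) (x : X) :
    powerSq K N m x = powerSq K N' m x := by
  unfold powerSq
  congr 1
  exact Finset.sum_congr rfl fun k hk => by rw [h k (Finset.mem_range.1 hk)]

theorem powerSq_antitone (N : ℕ → X → ℝ) (x : X) : Antitone fun m => powerSq K N m x :=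
  antitone_nat_of_succ_le fun m => by
    rw [powerSq_succ]; linarith [sq_nonneg (N m x)]

/-- A further selection at a maximizer `b` of the power function, after a failed stopping test. -/
theorem IsPartialGreedy.extend {m : ℕ} {p : ℕ → Fin n} {N : ℕ → X → ℝ}
    (h : IsPartialGreedy K a e m p N) (b : Fin n)
    (hb : ∀ i, powerSq K N m (a i) ≤ powerSq K N m (a b))
    (hc : 1 ≤ m → e ^ 2 ≤ powerSq K N m (a b)) :
    IsPartialGreedy K a e (m + 1) (Function.update p m b) (Function.update N m fun x =>
      (K x (a b) - ∑ l ∈ Finset.range m, N l (a b) * N l x) / √(powerSq K N m (a b))) := by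
  set N' := Function.update N m fun x =>
      (K x (a b) - ∑ l ∈ Finset.range m, N l (a b) * N l x) / √(powerSq K N m (a b)) with hN'
  have hlt : ∀ k < m, N' k = N k := fun k hk => by
    rw [hN', Function.update_of_ne (by omega)]
  have hp : ∀ k ≤ m, ∀ x, powerSq K N' k x = powerSq K N k x := fun k hk x =>
    powerSq_congr (fun l hl => hlt l (by omega)) x
  have hsum : ∀ k ≤ m, ∀ x w, ∑ l ∈ Finset.range k, N' l x * N' l w =
      ∑ l ∈ Finset.range k, N l x * N l w := fun k hk x w =>
    Finset.sum_congr rfl fun l hl => by rw [hlt l (by have := Finset.mem_range.1 hl; omega)]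
  refine ⟨fun k hk i => ?_, fun k hk x => ?_, fun k hk1 hk => ?_⟩
  · rw [hp k (by omega), hp k (by omega)]
    rcases Nat.lt_or_ge k m with h1 | h1
    · rw [Function.update_of_ne (by omega)]; exact h.greedy k h1 i
    · obtain rfl : k = m := by omega
      rw [Function.update_self]; exact hb i
  · rw [hp k (by omega), hsum k (by omega)]
    rcases Nat.lt_or_ge k m with h1 | h1
    · rw [Function.update_of_ne (by omega), hlt k h1]; exact h.newton k h1 x
    · obtain rfl : k = m := by omega
      rw [Function.update_self, hN', Function.update_self]
  · rw [hp k (by omega)]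
    rcases Nat.lt_or_ge k m with h1 | h1
    · rw [Function.update_of_ne (by omega)]; exact h.continues k hk1 h1
    · obtain rfl : k = m := by omega
      rw [Function.update_self]; exact hc hk1

theorem IsPartialGreedy.powerSq_pos (hK : IsPosDefKernel K) (he : 0 < e) {m : ℕ} {p : ℕ → Fin n}
    {N : ℕ → X → ℝ} (h : IsPartialGreedy K a e m p N) {k : ℕ} (hk : k < m) :
    0 < powerSq K N k (a (p k)) := by
  rcases Nat.eq_zero_or_pos k with rfl | h0
  · simpa [powerSq] using hK.diag_pos _
  · exact (by positivity : 0 < e ^ 2).trans_le (h.continues k h0 hk)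

/-- The power function vanishes at a selected point after its selection. -/
theorem IsPartialGreedy.powerSq_selected_nonpos (hK : IsPosDefKernel K) (he : 0 < e) {m : ℕ}
    {p : ℕ → Fin n} {N : ℕ → X → ℝ} (h : IsPartialGreedy K a e m p N) {j k : ℕ} (hj : j < m)
    (hjk : j < k) : powerSq K N k (a (p j)) ≤ 0 := by
  refine (powerSq_antitone N (a (p j)) (Nat.succ_le_of_lt hjk)).trans (le_of_eq ?_)
  have hpos := h.powerSq_pos hK he hj
  have hnum : K (a (p j)) (a (p j)) - ∑ l ∈ Finset.range j, N l (a (p j)) * N l (a (p j)) =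
      powerSq K N j (a (p j)) := by simp [powerSq, sq]
  change powerSq K N (j + 1) (a (p j)) = 0
  rw [powerSq_succ, h.newton j hj, hnum, div_pow, Real.sq_sqrt hpos.le]
  field_simp
  ring

/-- No arm is selected twice, so that there are at most `n` selections. -/
theorem IsPartialGreedy.le_card (hK : IsPosDefKernel K) (he : 0 < e) {m : ℕ} {p : ℕ → Fin n}
    {N : ℕ → X → ℝ} (h : IsPartialGreedy K a e m p N) : m ≤ n := by
  have hinj : Function.Injective fun k : Fin m => p k := by
    have key : ∀ j k : Fin m, j < k → p j ≠ p k := by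
      intro j k hjk heq
      have h1 := h.powerSq_selected_nonpos hK he j.2 (show (j : ℕ) < k from hjk)
      have h2 := h.powerSq_pos hK he k.2
      rw [heq] at h1
      linarith
    intro j k hjk
    rcases lt_trichotomy j k with h1 | h1 | h1
    · exact absurd hjk (key j k h1)
    · exact h1
    · exact absurd hjk.symm (key k j h1)
  simpa using Fintype.card_le_of_injective _ hinj

theorem IsPartialGreedy.isPGreedyOutput {m : ℕ} {p : ℕ → Fin n} {N : ℕ → X → ℝ}
    (h : IsPartialGreedy K a e m p N) (hm : 1 ≤ m) (hsmall : ∀ i, powerSq K N m (a i) < e ^ 2) :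
    IsPGreedyOutput K (Set.range a) e m (fun k => a (p k)) N where
  pos := hm
  mem k _ := ⟨p k, rfl⟩
  greedy k hk := by rintro _ ⟨i, rfl⟩; exact h.greedy k hk i
  newton := h.newton
  continues k hk1 hk hall := absurd (hall _ ⟨p k, rfl⟩) (not_lt.2 (h.continues k hk1 hk))
  stops := by rintro _ ⟨i, rfl⟩; exact hsmall i

end PartialGreedy

section GreedyProgram

variable {κ : ℕ → ℕ → ℝ} {y : ℕ → ℝ}

theorem exec_newtonColumn {s : State} {n m : ℕ} (hn : s.nat 0 0 = n) (hm : s.nat 1 0 = m) :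
    ((∀ i < n, (Program.newtonColumn.exec κ y s).real 1 i m =
      (κ i (s.nat 4 0) - ∑ k ∈ Finset.range m, s.real 1 (s.nat 4 0) k * s.real 1 i k) /
        √(s.real 2 (s.nat 4 0) 0)) ∧
      ∀ i, ∀ j ≠ m, (Program.newtonColumn.exec κ y s).real 1 i j = s.real 1 i j) ∧
      (Program.newtonColumn.exec κ y s).steps ≤ s.steps + (3 + n * (27 + m * 19 + 1)) := by
  refine exec_loop_real (κ := κ) (y := y) (v := 6) (b := Program.arms) (s := s) hn
    (27 + m * 19) (fun l mem => (∀ i < l, mem 1 i m =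
      (κ i (s.nat 4 0) - ∑ k ∈ Finset.range m, s.real 1 (s.nat 4 0) k * s.real 1 i k) /
        √(s.real 2 (s.nat 4 0) 0)) ∧ ∀ i, ∀ j ≠ m, mem 1 i j = s.real 1 i j)
    ⟨fun i hi => absurd hi (by omega), fun _ _ _ => rfl⟩ fun l hl s' hF hv hP => ?_
  have n1 : s'.nat 1 = s.nat 1 := hF.nat 1 (by simp [Program.natWrites, Program.sum])
  have n4 : s'.nat 4 = s.nat 4 := hF.nat 4 (by simp [Program.natWrites, Program.sum])
  have r2 : s'.real 2 = s.real 2 := hF.real 2 (by simp [Program.realWrites, Program.sum])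
  rw [exec_seq]
  have hs := exec_sum (κ := κ) (y := y) (r := 3) (v := 7)
    (e := .mul (.get 1 (Program.cell 4) (Program.cell 7))
      (.get 1 (Program.cell 6) (Program.cell 7)))
    (s := s') (D := m) (by rw [n1, hm])
    (fun k => s.real 1 (s.nat 4 0) k * s.real 1 l k)
    (fun k hk s'' h7 hn hr => by
      simp only [RealExpr.eval, NatExpr.eval, Program.cell]
      rw [hr 1 (by norm_num), h7, hn 4 (by norm_num), hn 6 (by norm_num), hv, n4,
        hP.2 _ k (by omega), hP.2 _ k (by omega)])
  have hF1 := exec_frame κ y (Program.sum 3 7 (.mul (.get 1 (Program.cell 4) (Program.cell 7))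
    (.get 1 (Program.cell 6) (Program.cell 7)))) s'
  set s1 := (Program.sum 3 7 (.mul (.get 1 (Program.cell 4) (Program.cell 7))
    (.get 1 (Program.cell 6) (Program.cell 7)))).exec κ y s' with hs1
  have m6 : s1.nat 6 0 = l := by
    rw [hF1.nat 6 (by simp [Program.natWrites, Program.sum]), hv]
  have m1 : s1.nat 1 0 = m := by
    rw [hF1.nat 1 (by simp [Program.natWrites, Program.sum]), n1, hm]
  have m4 : s1.nat 4 = s.nat 4 := by
    rw [hF1.nat 4 (by simp [Program.natWrites, Program.sum]), n4]
  have q1 : s1.real 1 = s'.real 1 := hF1.real 1 (by simp [Program.realWrites, Program.sum])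
  have q2 : s1.real 2 = s.real 2 := by
    rw [hF1.real 2 (by simp [Program.realWrites, Program.sum]), r2]
  refine ⟨⟨fun i hi => ?_, fun i j hj => ?_⟩, ?_⟩
  · rw [exec_setReal_real]
    simp only [NatExpr.eval, RealExpr.eval, Program.cell, Program.scalar, Program.dim, m6, m1, m4,
      q2, hs.1, true_and, and_true]
    split_ifs with h
    · rw [h]
    · rw [q1]; exact hP.1 i (by omega)
  · rw [exec_setReal_real]
    simp only [NatExpr.eval, Program.cell, Program.dim, m1, m6]
    rw [if_neg (fun h => hj h.2.2), q1]
    exact hP.2 i j hj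
  · have h2 : s1.steps ≤ s'.steps + (7 + m * 19) := hs.2
    rw [exec_setReal_steps]
    simp only [NatExpr.cost, RealExpr.cost, Program.cell, Program.scalar, Program.dim]
    omega

theorem exec_powerUpdate {s : State} {n m : ℕ} (hn : s.nat 0 0 = n) (hm : s.nat 1 0 = m) :
    (∀ i < n, (Program.powerUpdate.exec κ y s).real 2 i 0 =
      s.real 2 i 0 - s.real 1 i m * s.real 1 i m) ∧
      (Program.powerUpdate.exec κ y s).steps ≤ s.steps + (3 + n * (20 + 1)) := by
  have h := exec_loop_real (κ := κ) (y := y) (v := 6) (b := Program.arms) (s := s)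
    (p := .setReal 2 (Program.cell 6) (.lit 0) (.sub (.get 2 (Program.cell 6) (.lit 0))
      (.mul (.get 1 (Program.cell 6) Program.dim) (.get 1 (Program.cell 6) Program.dim)))) hn 20
    (fun l mem => (∀ i < l, mem 2 i 0 = s.real 2 i 0 - s.real 1 i m * s.real 1 i m) ∧
      ∀ i ≥ l, mem 2 i 0 = s.real 2 i 0)
    ⟨fun i hi => absurd hi (by omega), fun _ _ => rfl⟩ fun l hl s' hF hv hP => by
      have n1 : s'.nat 1 = s.nat 1 := hF.nat 1 (by simp [Program.natWrites])
      have r1 : s'.real 1 = s.real 1 := hF.real 1 (by simp [Program.realWrites])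
      refine ⟨⟨fun i hi => ?_, fun i hi => ?_⟩, ?_⟩
      · rw [exec_setReal_real]
        simp only [NatExpr.eval, RealExpr.eval, Program.cell, Program.dim, hv, n1, hm, r1,
          true_and, and_true]
        split_ifs with h
        · rw [h, hP.2 l le_rfl]
        · exact hP.1 i (by omega)
      · rw [exec_setReal_real]
        simp only [NatExpr.eval, Program.cell, hv]
        rw [if_neg (by omega)]
        exact hP.2 i (by omega)
      · rw [exec_setReal_steps]
        simp only [NatExpr.cost, RealExpr.cost, Program.cell, Program.dim]
        omega
  exact ⟨h.1.1, h.2⟩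

theorem exec_stopTest (s : State) :
    (s.real 0 0 0 ^ 2 ≤ s.real 2 (s.nat 4 0) 0 → (Program.stopTest.exec κ y s).nat 3 0 = 0) ∧
      (s.real 2 (s.nat 4 0) 0 < s.real 0 0 0 ^ 2 → (Program.stopTest.exec κ y s).nat 3 0 = 1) ∧
      (Program.stopTest.exec κ y s).steps = s.steps + 15 := by
  have h : Test.holds κ s (.leReal (.mul (Program.scalar 0) (Program.scalar 0))
      (.get 2 (Program.cell 4) (.lit 0))) ↔ s.real 0 0 0 ^ 2 ≤ s.real 2 (s.nat 4 0) 0 := by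
    rw [sq]; rfl
  unfold Program.stopTest
  by_cases hle : s.real 0 0 0 ^ 2 ≤ s.real 2 (s.nat 4 0) 0
  · rw [exec_ite_of_holds (h.2 hle)]
    refine ⟨fun _ => ?_, fun hlt => absurd hlt (not_lt.2 hle), rfl⟩
    rw [exec_setNat_nat]; simp [NatExpr.eval]
  · rw [exec_ite_of_not_holds fun hh => hle (h.1 hh)]
    refine ⟨fun hh => absurd hh hle, fun _ => ?_, rfl⟩
    rw [exec_setNat_nat]; simp [NatExpr.eval]

variable {X : Type*} {K : X → X → ℝ} {n : ℕ} {a : Fin n → X} {e : ℝ}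

/-- The memory holds the first `m` selections of the `P`-greedy algorithm, together with the
corresponding columns of the Newton basis, the current power function, and a maximizer of it. -/
structure HoldsGreedy (K : X → X → ℝ) (a : Fin n → X) (m : ℕ) (p : ℕ → Fin n) (N : ℕ → X → ℝ)
    (s : State) : Prop where
  arms : s.nat 0 0 = n
  dim : s.nat 1 0 = m
  points : ∀ k < m, s.nat 2 k = p k
  newton : ∀ (i : Fin n), ∀ k < m, s.real 1 i k = N k (a i)
  power : ∀ i : Fin n, s.real 2 i 0 = powerSq K N m (a i)
  best_lt : s.nat 4 0 < n
  best : ∀ i < n, s.real 2 i 0 ≤ s.real 2 (s.nat 4 0) 0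

theorem exec_greedyStep {m : ℕ} {p : ℕ → Fin n} {N : ℕ → X → ℝ} {s : State}
    (hs : HoldsGreedy K a m p N s) :
    HoldsGreedy K a (m + 1) (Function.update p m ⟨s.nat 4 0, hs.best_lt⟩)
      (Function.update N m fun x => (K x (a ⟨s.nat 4 0, hs.best_lt⟩) -
        ∑ l ∈ Finset.range m, N l (a ⟨s.nat 4 0, hs.best_lt⟩) * N l x) /
          √(powerSq K N m (a ⟨s.nat 4 0, hs.best_lt⟩)))
      (Program.greedyStep.exec (kernelTable K a) y s) ∧
    (s.real 0 0 0 ^ 2 ≤ (Program.greedyStep.exec (kernelTable K a) y s).real 2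
      ((Program.greedyStep.exec (kernelTable K a) y s).nat 4 0) 0 →
      (Program.greedyStep.exec (kernelTable K a) y s).nat 3 0 = 0) ∧
    ((Program.greedyStep.exec (kernelTable K a) y s).real 2
      ((Program.greedyStep.exec (kernelTable K a) y s).nat 4 0) 0 < s.real 0 0 0 ^ 2 →
      (Program.greedyStep.exec (kernelTable K a) y s).nat 3 0 = 1) ∧
    (Program.greedyStep.exec (kernelTable K a) y s).steps ≤ s.steps + 102 * (n * (m + 1)) := by
  obtain ⟨hn, hm, hp, hN, hP, hb, hbest⟩ := hs
  set b : Fin n := ⟨s.nat 4 0, hb⟩ with hbdef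
  have hn1 : 1 ≤ n := by omega
  set κ := kernelTable K a with hκ
  have hκe : ∀ i j : Fin n, κ i j = K (a i) (a j) := fun i j => by simp [hκ, kernelTable]
  have F1 := exec_frame κ y (.setNat 2 Program.dim (Program.cell 4)) s
  have E1 := exec_setNat_nat (κ := κ) (y := y) 2 Program.dim (Program.cell 4) s
  have C1 : (Program.exec κ y (.setNat 2 Program.dim (Program.cell 4)) s).steps = s.steps + 5 := rfl
  set s1 := Program.exec κ y (.setNat 2 Program.dim (Program.cell 4)) s
  have a1 : s1.nat 0 = s.nat 0 := F1.nat 0 (by simp [Program.natWrites])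
  have a2 : s1.nat 1 = s.nat 1 := F1.nat 1 (by simp [Program.natWrites])
  have a4 : s1.nat 4 = s.nat 4 := F1.nat 4 (by simp [Program.natWrites])
  have ar : ∀ r, s1.real r = s.real r := fun r => F1.real r (by simp [Program.realWrites])
  have F2 := exec_frame κ y Program.newtonColumn s1
  obtain ⟨⟨E2, E2'⟩, C2⟩ := exec_newtonColumn (κ := κ) (y := y) (s := s1) (n := n) (m := m)
    (by rw [a1, hn]) (by rw [a2, hm])
  rw [a4, ar, ar] at E2
  set s2 := Program.exec κ y Program.newtonColumn s1
  have b0 : s2.nat 0 = s.nat 0 := by rw [F2.nat 0 (by decide), a1]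
  have b1 : s2.nat 1 = s.nat 1 := by rw [F2.nat 1 (by decide), a2]
  have F3 := exec_frame κ y Program.powerUpdate s2
  obtain ⟨E3, C3⟩ := exec_powerUpdate (κ := κ) (y := y) (s := s2) (n := n) (m := m)
    (by rw [b0, hn]) (by rw [b1, hm])
  set s3 := Program.exec κ y Program.powerUpdate s2
  have F4 := exec_frame κ y (.setNat 1 (.lit 0) (.add Program.dim (.lit 1))) s3
  have E4 := exec_setNat_nat (κ := κ) (y := y) 1 (.lit 0) (.add Program.dim (.lit 1)) s3
  have C4 : (Program.exec κ y (.setNat 1 (.lit 0) (.add Program.dim (.lit 1))) s3).steps =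
    s3.steps + 6 := rfl
  set s4 := Program.exec κ y (.setNat 1 (.lit 0) (.add Program.dim (.lit 1))) s3
  have F5 := exec_frame κ y (Program.argmax 2) s4
  obtain ⟨E5, E5', C5⟩ := exec_argmax (κ := κ) (y := y) (r := 2) (s := s4) (n := n)
    (by rw [F4.nat 0 (by decide), F3.nat 0 (by decide), b0, hn]) hn1
  set s5 := Program.exec κ y (Program.argmax 2) s4
  have F6 := exec_frame κ y Program.stopTest s5
  obtain ⟨E6, E6', C6⟩ := exec_stopTest (κ := κ) (y := y) s5
  set s6 := Program.exec κ y Program.stopTest s5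
  rw [show Program.exec κ y Program.greedyStep s = s6 from rfl]
  set N' := Function.update N m fun x =>
      (K x (a b) - ∑ l ∈ Finset.range m, N l (a b) * N l x) / √(powerSq K N m (a b)) with hN'
  have r2 : s6.real 2 = s3.real 2 := by
    rw [F6.real 2 (by decide), F5.real 2 (by decide), F4.real 2 (by decide)]
  have r1 : s6.real 1 = s2.real 1 := by
    rw [F6.real 1 (by decide), F5.real 1 (by decide), F4.real 1 (by decide), F3.real 1 (by decide)]
  have n1 : s6.nat 1 0 = m + 1 := by
    rw [F6.nat 1 (by decide), F5.nat 1 (by decide), E4]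
    simp [NatExpr.eval, Program.dim, F3.nat 1 (by decide), b1, hm]
  have n2 : s6.nat 2 = s1.nat 2 := by
    rw [F6.nat 2 (by decide), F5.nat 2 (by decide), F4.nat 2 (by decide), F3.nat 2 (by decide),
      F2.nat 2 (by decide)]
  have n4 : s6.nat 4 = s5.nat 4 := F6.nat 4 (by decide)
  have hcol : ∀ i : Fin n, s2.real 1 i m = N' m (a i) := by
    intro i
    have hb' : s.nat 4 0 = (b : ℕ) := rfl
    rw [E2 i i.2, hN', Function.update_self, hb', hκe, hP b]
    congr 2
    refine Finset.sum_congr rfl fun l hl => ?_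
    rw [hN b l (Finset.mem_range.1 hl), hN i l (Finset.mem_range.1 hl)]
  have r0 : s5.real 0 = s.real 0 := by
    rw [F5.real 0 (by decide), F4.real 0 (by decide), F3.real 0 (by decide), F2.real 0 (by decide),
      ar]
  have r5 : s5.real 2 = s6.real 2 := (F6.real 2 (by decide)).symm
  rw [r0, r5, ← n4] at E6 E6'
  refine ⟨⟨?_, n1, ?_, ?_, ?_, ?_, ?_⟩, E6, E6', ?_⟩
  · rw [F6.nat 0 (by decide), F5.nat 0 (by decide), F4.nat 0 (by decide), F3.nat 0 (by decide),
      b0, hn]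
  · intro k hk
    rw [n2, E1]
    simp only [NatExpr.eval, Program.dim, Program.cell, hm, true_and]
    split_ifs with h
    · rw [h, Function.update_self]
    · rw [Function.update_of_ne h]; exact hp k (by omega)
  · intro i k hk
    rw [r1]
    rcases Nat.lt_or_ge k m with h | h
    · rw [E2' i k (by omega), ar, hN i k h, hN', Function.update_of_ne (by omega)]
    · obtain rfl : k = m := by omega
      exact hcol i
  · intro i
    have hpm : powerSq K N' m (a i) = powerSq K N m (a i) :=
      powerSq_congr (fun k hk => by rw [hN', Function.update_of_ne (by omega)]) _
    rw [r2, E3 i i.2, hcol i, F2.real 2 (by decide), ar, hP i, powerSq_succ, hpm, sq]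
  · rw [n4]; exact E5
  · intro i hi
    rw [n4, r2, ← F4.real 2 (by decide)]
    exact E5' i hi
  · have : 102 * (n * (m + 1)) = 102 * n + 102 * (n * m) := by ring
    have : n * (27 + m * 19 + 1) = 28 * n + 19 * (n * m) := by ring
    omega

/-- Correctness and cost of the greedy selection. -/
theorem exec_greedy (hK : IsPosDefKernel K) (he : 0 < e) (hn1 : 1 ≤ n) {s : State}
    (hn : s.nat 0 0 = n) (hdim : s.nat 1 0 = 0) (hflag : s.nat 3 0 = 0) (hse : s.real 0 0 0 = e) :
    ∃ (D : ℕ) (p : ℕ → Fin n) (N : ℕ → X → ℝ),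
      IsPGreedyOutput K (Set.range a) e D (fun k => a (p k)) N ∧
      HoldsGreedy K a D p N (Program.greedy.exec (kernelTable K a) y s) ∧
      (Program.greedy.exec (kernelTable K a) y s).steps ≤ s.steps + 155 * (n * D ^ 2) := by
  set κ := kernelTable K a with hκ
  simp only [Program.greedy, exec_seq]
  set p0 : Program := .loop 6 Program.arms (.setReal 2 (Program.cell 6) (.lit 0)
    (.kern (Program.cell 6) (Program.cell 6))) with hp0
  have F1 := exec_frame κ y p0 s
  obtain ⟨E1, C1⟩ := exec_loop_real (κ := κ) (y := y) (v := 6) (b := Program.arms) (s := s)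
    (p := .setReal 2 (Program.cell 6) (.lit 0) (.kern (Program.cell 6) (Program.cell 6))) hn 9
    (fun l mem => ∀ i < l, mem 2 i 0 = κ i i) (fun i hi => absurd hi (by omega))
    (fun l hl s' hF hv hP => by
      refine ⟨fun i hi => ?_, ?_⟩
      · rw [exec_setReal_real]
        simp only [NatExpr.eval, RealExpr.eval, Program.cell, hv, true_and, and_true]
        split_ifs with h
        · rw [h]
        · exact hP i (by omega)
      · rw [exec_setReal_steps]
        simp only [NatExpr.cost, RealExpr.cost, Program.cell]
        omega)
  rw [← hp0] at E1 C1
  have C1' : (p0.exec κ y s).steps ≤ s.steps + (3 + n * 10) := C1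
  set s1 := p0.exec κ y s
  have F2 := exec_frame κ y (Program.argmax 2) s1
  obtain ⟨E2, E2', C2⟩ := exec_argmax (κ := κ) (y := y) (r := 2) (s := s1) (n := n)
    (by rw [F1.nat 0 (by simp [hp0, Program.natWrites]), hn]) hn1
  set s2 := Program.exec κ y (Program.argmax 2) s1
  have a0 : s2.nat 0 0 = n := by
    rw [F2.nat 0 (by decide), F1.nat 0 (by simp [hp0, Program.natWrites]), hn]
  have a1 : s2.nat 1 0 = 0 := by
    rw [F2.nat 1 (by decide), F1.nat 1 (by simp [hp0, Program.natWrites]), hdim]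
  have a3 : s2.nat 3 0 = 0 := by
    rw [F2.nat 3 (by decide), F1.nat 3 (by simp [hp0, Program.natWrites]), hflag]
  have r0 : s2.real 0 0 0 = e := by
    rw [F2.real 0 (by decide), F1.real 0 (by simp [hp0, Program.realWrites]), hse]
  have hinit : HoldsGreedy K a 0 (fun _ => ⟨0, hn1⟩) (fun _ _ => 0) s2 := by
    refine ⟨a0, a1, fun k hk => absurd hk (by omega), fun i k hk => absurd hk (by omega), ?_, E2,
      ?_⟩
    · intro i
      rw [F2.real 2 (by decide), E1 i i.2]
      simp [powerSq, hκ, kernelTable]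
    · intro i hi
      rw [F2.real 2 (by decide)]
      exact E2' i hi
  -- the number of selections equals the number of iterations until the stopping test succeeds
  have h := exec_loop (κ := κ) (y := y) (v := 5) (b := Program.arms)
    (p := .ite (.ltNat (Program.cell 3) (.lit 1)) Program.greedyStep (.setNat 6 (.lit 0) (.lit 0)))
    (s := s2) (n := n) a0
    (fun k s' => ∃ (m : ℕ) (p : ℕ → Fin n) (N : ℕ → X → ℝ), IsPartialGreedy K a e m p N ∧
      HoldsGreedy K a m p N s' ∧ s'.steps ≤ s2.steps + (3 + 8 * k + 102 * (n * m ^ 2)) ∧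
      ((s'.nat 3 0 = 0 ∧ m = k ∧ (1 ≤ m → e ^ 2 ≤ s'.real 2 (s'.nat 4 0) 0)) ∨
        (s'.nat 3 0 = 1 ∧ 1 ≤ m ∧ ∀ i, powerSq K N m (a i) < e ^ 2)))
    ⟨0, fun _ => ⟨0, hn1⟩, fun _ _ => 0, ⟨fun k hk => absurd hk (by omega),
      fun k hk => absurd hk (by omega), fun k _ hk => absurd hk (by omega)⟩,
      ⟨hinit.1, hinit.2, hinit.3, hinit.4, hinit.5, hinit.6, hinit.7⟩,
      by simp [State.charge, NatExpr.cost, Program.arms],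
      Or.inl ⟨a3, rfl, fun h => absurd h (by omega)⟩⟩
    (fun k hk s' hF hI => by
      obtain ⟨m, p, N, hpart, hhold, hsteps, hcase⟩ := hI
      have hre : s'.real 0 0 0 = e := by rw [hF.real 0 (by decide), r0]
      have hcharge : ∀ c, HoldsGreedy K a m p N (((s'.writeNat 5 0 k).charge 1).charge c) := by
        intro c
        obtain ⟨h1, h2, h3, h4, h5, h6, h7⟩ := hhold
        have hne : ∀ q ≠ 5, (((s'.writeNat 5 0 k).charge 1).charge c).nat q = s'.nat q := by
          intro q hq
          funext j
          exact (State.writeNat_nat s' 5 0 k q j).trans (by simp [hq])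
        refine ⟨?_, ?_, ?_, h4, h5, ?_, ?_⟩
        · rw [hne 0 (by norm_num), h1]
        · rw [hne 1 (by norm_num), h2]
        · rw [hne 2 (by norm_num)]; exact h3
        · rw [hne 4 (by norm_num)]; exact h6
        · rw [hne 4 (by norm_num)]; exact h7
      have hne : ∀ c, ∀ q ≠ 5, (((s'.writeNat 5 0 k).charge 1).charge c).nat q = s'.nat q := by
        intro c q hq
        funext j
        exact (State.writeNat_nat s' 5 0 k q j).trans (by simp [hq])
      rcases hcase with ⟨hfl, hmk, hbig⟩ | ⟨hfl, hm1, hsmall⟩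
      · have htest : Test.holds κ ((s'.writeNat 5 0 k).charge 1)
            (.ltNat (Program.cell 3) (.lit 1)) := by
          change ((s'.writeNat 5 0 k).charge 1).nat 3 0 < 1
          rw [show ((s'.writeNat 5 0 k).charge 1).nat 3 = s'.nat 3 from hne 0 3 (by norm_num), hfl]
          norm_num
        rw [exec_ite_of_holds htest]
        have hH := hcharge (Test.cost (.ltNat (Program.cell 3) (.lit 1)))
        have hC : (((s'.writeNat 5 0 k).charge 1).charge
          (Test.cost (.ltNat (Program.cell 3) (.lit 1)))).steps = s'.steps + 5 := rfl
        have hR : (((s'.writeNat 5 0 k).charge 1).charge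
          (Test.cost (.ltNat (Program.cell 3) (.lit 1)))).real = s'.real := rfl
        have h4 := hne (Test.cost (.ltNat (Program.cell 3) (.lit 1))) 4 (by norm_num)
        set s3 := ((s'.writeNat 5 0 k).charge 1).charge
          (Test.cost (.ltNat (Program.cell 3) (.lit 1)))
        obtain ⟨G1, G2, G2', G3⟩ := exec_greedyStep (y := y) hH
        set b : Fin n := ⟨s3.nat 4 0, hH.best_lt⟩
        have hb : ∀ i, powerSq K N m (a i) ≤ powerSq K N m (a b) := by
          intro i
          rw [← hH.power, ← hH.power]
          exact hH.best i i.2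
        have hc : 1 ≤ m → e ^ 2 ≤ powerSq K N m (a b) := by
          intro hm
          rw [← hH.power, hR]
          have := hbig hm
          rwa [← h4] at this
        refine ⟨m + 1, _, _, hpart.extend b hb hc, G1, ?_, ?_⟩
        · refine G3.trans ?_
          have : n * (m + 1) ^ 2 = n * m ^ 2 + n * (m + 1) + n * m := by ring
          rw [this, hC]
          omega
        · rw [hR, hre] at G2 G2'
          set s4 := Program.exec (kernelTable K a) y Program.greedyStep s3
          rcases le_or_gt (e ^ 2) (s4.real 2 (s4.nat 4 0) 0) with hle | hlt
          · left
            exact ⟨G2 hle, by omega, fun _ => hle⟩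
          · right
            refine ⟨G2' hlt, by omega, fun i => ?_⟩
            rw [← G1.power]
            exact (G1.best i i.2).trans_lt hlt
      · have htest : ¬ Test.holds κ ((s'.writeNat 5 0 k).charge 1)
            (.ltNat (Program.cell 3) (.lit 1)) := by
          change ¬ ((s'.writeNat 5 0 k).charge 1).nat 3 0 < 1
          rw [show ((s'.writeNat 5 0 k).charge 1).nat 3 = s'.nat 3 from hne 0 3 (by norm_num), hfl]
          norm_num
        rw [exec_ite_of_not_holds htest]
        have hH := hcharge (Test.cost (.ltNat (Program.cell 3) (.lit 1)))
        have h3 := hne (Test.cost (.ltNat (Program.cell 3) (.lit 1))) 3 (by norm_num)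
        have hC : (((s'.writeNat 5 0 k).charge 1).charge
          (Test.cost (.ltNat (Program.cell 3) (.lit 1)))).steps = s'.steps + 5 := rfl
        set s3 := ((s'.writeNat 5 0 k).charge 1).charge
          (Test.cost (.ltNat (Program.cell 3) (.lit 1)))
        have F3 := exec_frame κ y (.setNat 6 (.lit 0) (.lit 0)) s3
        have hC' : (Program.exec κ y (.setNat 6 (.lit 0) (.lit 0)) s3).steps = s3.steps + 3 := rfl
        set s4 := Program.exec κ y (.setNat 6 (.lit 0) (.lit 0)) s3
        have hr : s4.real = s3.real := rfl
        refine ⟨m, p, N, hpart, ?_, by omega, Or.inr ⟨?_, hm1, hsmall⟩⟩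
        · obtain ⟨h1, h2, h3, h4, h5, h6, h7⟩ := hH
          have q0 := F3.nat 0 (by decide)
          have q1 := F3.nat 1 (by decide)
          have q2 := F3.nat 2 (by decide)
          have q4 := F3.nat 4 (by decide)
          exact ⟨by rw [q0, h1], by rw [q1, h2], by rw [q2]; exact h3, h4, h5,
            by rw [q4]; exact h6, by rw [q4]; exact h7⟩
        · rw [F3.nat 3 (by decide), h3, hfl])
  obtain ⟨D, p, N, hpart, hhold, hsteps, hcase⟩ := h
  set s3 := Program.exec κ y (.loop 5 Program.arms
    (.ite (.ltNat (Program.cell 3) (.lit 1)) Program.greedyStep (.setNat 6 (.lit 0) (.lit 0)))) s2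
  have hfin : 1 ≤ D ∧ ∀ i, powerSq K N D (a i) < e ^ 2 := by
    rcases hcase with ⟨_, hDn, hbig⟩ | ⟨_, h1, h2⟩
    · -- with `n` selections and a failing test, one more selection would be possible
      exfalso
      have hext := hpart.extend ⟨s3.nat 4 0, hhold.best_lt⟩
        (fun i => by rw [← hhold.power, ← hhold.power]; exact hhold.best i i.2)
        (fun hm => by rw [← hhold.power]; exact hbig hm)
      have := hext.le_card hK he
      omega
    · exact ⟨h1, h2⟩
  refine ⟨D, p, N, hpart.isPGreedyOutput hfin.1 hfin.2, hhold, hsteps.trans ?_⟩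
  have : n ≤ n * D ^ 2 := Nat.le_mul_of_pos_right n (pow_pos hfin.1 2)
  omega

end GreedyProgram

/-! ### Correctness and cost of the initialization and of the updates -/

section UCBProgram

variable {κ : ℕ → ℕ → ℝ} {y : ℕ → ℝ}

/-- Filling the row of the matrix `4` whose number is in the cell `7`. -/
theorem exec_rowFill {e : RealExpr} {s : State} {D i : ℕ} (hD : s.nat 1 0 = D)
    (hi : s.nat 7 0 = i) (g : ℕ → ℝ)
    (he : ∀ k < D, ∀ s', s'.nat 8 0 = k → (∀ a, a ≠ 8 → s'.nat a = s.nat a) →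
      (∀ q, q ≠ 4 → s'.real q = s.real q) → s'.real 4 i k = s.real 4 i k → e.eval κ s' = g k) :
    ((∀ k < D, ((Program.loop 8 Program.dim
        (.setReal 4 (Program.cell 7) (Program.cell 8) e)).exec κ y s).real 4 i k = g k) ∧
      ∀ j ≠ i, ∀ k, ((Program.loop 8 Program.dim
        (.setReal 4 (Program.cell 7) (Program.cell 8) e)).exec κ y s).real 4 j k =
          s.real 4 j k) ∧
    ((Program.loop 8 Program.dim
        (.setReal 4 (Program.cell 7) (Program.cell 8) e)).exec κ y s).steps ≤
      s.steps + (3 + D * (e.cost + 5 + 1)) := by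
  have h := exec_loop_real (κ := κ) (y := y) (v := 8) (b := Program.dim) (s := s)
    (p := .setReal 4 (Program.cell 7) (Program.cell 8) e) hD (e.cost + 5)
    (fun l mem => (∀ k < l, mem 4 i k = g k) ∧ (∀ k ≥ l, mem 4 i k = s.real 4 i k) ∧
      ∀ j ≠ i, ∀ k, mem 4 j k = s.real 4 j k)
    ⟨fun k hk => absurd hk (by omega), fun _ _ => rfl, fun _ _ _ => rfl⟩
    fun l hl s' hF hv hP => by
      have n7 : s'.nat 7 0 = i := by rw [hF.nat 7 (by simp [Program.natWrites]), hi]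
      have hg : e.eval κ s' = g l := he l hl s' hv
        (fun a ha => hF.nat a (by simpa [Program.natWrites] using ha))
        (fun q hq => hF.real q (by simpa [Program.realWrites] using hq)) (hP.2.1 l le_rfl)
      refine ⟨⟨fun k hk => ?_, fun k hk => ?_, fun j hj k => ?_⟩, ?_⟩
      · rw [exec_setReal_real]
        simp only [NatExpr.eval, Program.cell, hv, n7, hg, true_and]
        split_ifs with h
        · rw [h]
        · exact hP.1 k (by omega)
      · rw [exec_setReal_real]
        simp only [NatExpr.eval, Program.cell, hv, n7, true_and]
        rw [if_neg (by omega)]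
        exact hP.2.1 k (by omega)
      · rw [exec_setReal_real]
        simp only [NatExpr.eval, Program.cell, hv, n7, true_and]
        rw [if_neg (fun h => hj h.1)]
        exact hP.2.2 j hj k
      · rw [exec_setReal_steps]
        simp only [NatExpr.cost, Program.cell]
        omega
  exact ⟨⟨h.1.1, h.1.2.2⟩, h.2⟩

theorem exec_gramInit {s : State} {D : ℕ} (hD : s.nat 1 0 = D) :
    (∀ j < D, ∀ k < D, (Program.gramInit.exec κ y s).real 4 j k =
      if j = k then 1 / s.real 0 0 1 else 0) ∧
      (Program.gramInit.exec κ y s).real 8 0 0 = 1 ∧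
      (Program.gramInit.exec κ y s).steps ≤ s.steps + (7 + D * (14 + 7 * D)) := by
  obtain ⟨h1, h2⟩ := exec_loop_real (κ := κ) (y := y) (v := 7) (b := Program.dim) (s := s)
    (p := .seq (.loop 8 Program.dim (.setReal 4 (Program.cell 7) (Program.cell 8) (.lit 0)))
      (.setReal 4 (Program.cell 7) (Program.cell 7) (.div (.lit 1) (.get 0 (.lit 0) (.lit 1)))))
    hD (13 + 7 * D)
    (fun i mem => ∀ j < i, ∀ k < D, mem 4 j k = if j = k then 1 / s.real 0 0 1 else 0)
    (fun j hj => absurd hj (by omega))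
    fun i hi s' hF hv hP => by
      have n1 : s'.nat 1 0 = D := by rw [hF.nat 1 (by decide), hD]
      have r0 : s'.real 0 = s.real 0 := hF.real 0 (by decide)
      rw [exec_seq]
      obtain ⟨⟨E, E'⟩, C⟩ := exec_rowFill (κ := κ) (y := y) (e := .lit 0) n1 hv (fun _ => 0)
        (fun k _ s'' _ _ _ _ => by simp [RealExpr.eval])
      have F1 := exec_frame κ y
        (.loop 8 Program.dim (.setReal 4 (Program.cell 7) (Program.cell 8) (.lit 0))) s'
      set s1 := Program.exec κ y
        (.loop 8 Program.dim (.setReal 4 (Program.cell 7) (Program.cell 8) (.lit 0))) s'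
      have m7 : s1.nat 7 0 = i := by rw [F1.nat 7 (by decide), hv]
      refine ⟨fun j hj k hk => ?_, ?_⟩
      · rw [exec_setReal_real]
        simp only [NatExpr.eval, RealExpr.eval, Program.cell, m7, true_and, Nat.cast_one]
        rw [F1.real 0 (by decide), r0]
        rcases Nat.lt_or_ge j i with hji | hji
        · rw [if_neg (by omega), E' j (by omega) k, hP j hji k hk]
        · obtain rfl : j = i := by omega
          simp only [true_and]
          split_ifs with h h' h'
          · rfl
          · exact absurd h.symm h'
          · exact absurd h'.symm h
          · exact E k hk
      · have C' : s1.steps ≤ s'.steps + (3 + D * 7) := C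
        rw [exec_setReal_steps]
        simp only [NatExpr.cost, RealExpr.cost, Program.cell]
        omega
  rw [Program.gramInit, exec_seq]
  set s1 := Program.exec κ y (.loop 7 Program.dim
    (.seq (.loop 8 Program.dim (.setReal 4 (Program.cell 7) (Program.cell 8) (.lit 0)))
      (.setReal 4 (Program.cell 7) (Program.cell 7)
        (.div (.lit 1) (.get 0 (.lit 0) (.lit 1)))))) s
  refine ⟨fun j hj k hk => ?_, ?_, ?_⟩
  · rw [exec_setReal_real]; simpa using h1 j hj k hk
  · rw [exec_setReal_real]; simp [NatExpr.eval, RealExpr.eval]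
  · have h2' : s1.steps ≤ s.steps + (3 + D * (13 + 7 * D + 1)) := h2
    rw [show 13 + 7 * D + 1 = 14 + 7 * D by ring] at h2'
    rw [exec_setReal_steps]
    simp only [NatExpr.cost, RealExpr.cost]
    omega

theorem exec_inverseUpdate {s : State} {D : ℕ} (hD : s.nat 1 0 = D) :
    (∀ j < D, ∀ k < D, (Program.inverseUpdate.exec κ y s).real 4 j k =
      s.real 4 j k - s.real 12 0 j * s.real 12 0 k / (1 + s.real 7 0 0)) ∧
      (Program.inverseUpdate.exec κ y s).steps ≤ s.steps + (3 + D * (4 + 27 * D)) := by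
  obtain ⟨h1, h2⟩ := exec_loop_real (κ := κ) (y := y) (v := 7) (b := Program.dim) (s := s)
    (p := .loop 8 Program.dim (.setReal 4 (Program.cell 7) (Program.cell 8)
      (.sub (.get 4 (Program.cell 7) (Program.cell 8))
        (.div (.mul (.get 12 (.lit 0) (Program.cell 7)) (.get 12 (.lit 0) (Program.cell 8)))
          (.add (.lit 1) (Program.scalar 7))))))
    hD (3 + 27 * D)
    (fun i mem => (∀ j < i, ∀ k < D, mem 4 j k =
      s.real 4 j k - s.real 12 0 j * s.real 12 0 k / (1 + s.real 7 0 0)) ∧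
      ∀ j ≥ i, ∀ k, mem 4 j k = s.real 4 j k)
    ⟨fun j hj => absurd hj (by omega), fun _ _ _ => rfl⟩
    fun i hi s' hF hv hP => by
      have n1 : s'.nat 1 0 = D := by rw [hF.nat 1 (by decide), hD]
      have r12 : s'.real 12 = s.real 12 := hF.real 12 (by decide)
      have r7 : s'.real 7 = s.real 7 := hF.real 7 (by decide)
      obtain ⟨⟨E, E'⟩, C⟩ := exec_rowFill (κ := κ) (y := y)
        (e := (.sub (.get 4 (Program.cell 7) (Program.cell 8))
        (.div (.mul (.get 12 (.lit 0) (Program.cell 7)) (.get 12 (.lit 0) (Program.cell 8)))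
          (.add (.lit 1) (Program.scalar 7))))) n1 hv
        (fun k => s.real 4 i k - s.real 12 0 i * s.real 12 0 k / (1 + s.real 7 0 0))
        (fun k _ s'' h8 hn hr h4 => by
          simp only [RealExpr.eval, NatExpr.eval, Program.cell, Program.scalar, h8,
            hn 7 (by norm_num), hv, hr 12 (by norm_num), hr 7 (by norm_num), h4, r12, r7,
            hP.2 i le_rfl k, Nat.cast_one])
      refine ⟨⟨fun j hj k hk => ?_, fun j hj k => ?_⟩, ?_⟩
      · rcases Nat.lt_or_ge j i with hji | hji
        · rw [E' j (by omega) k, hP.1 j hji k hk]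
        · obtain rfl : j = i := by omega
          exact E k hk
      · rw [E' j (by omega) k, hP.2 j (by omega) k]
      · have C' : _ ≤ s'.steps + (3 + D * 27) := C
        omega
  refine ⟨h1.1, h2.trans ?_⟩
  rw [show 3 + 27 * D + 1 = 4 + 27 * D by ring]
  exact le_rfl

theorem exec_rewardUpdate {s : State} {D : ℕ} (hD : s.nat 1 0 = D) :
    (∀ j < D, (Program.rewardUpdate.exec κ y s).real 5 0 j =
      s.real 5 0 j + s.real 13 0 0 * s.real 1 (s.nat 4 0) j) ∧
      (Program.rewardUpdate.exec κ y s).steps ≤ s.steps + (3 + D * (18 + 1)) := by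
  obtain ⟨h1, h2⟩ := exec_loop_real (κ := κ) (y := y) (v := 7) (b := Program.dim) (s := s)
    (p := .setReal 5 (.lit 0) (Program.cell 7) (.add (.get 5 (.lit 0) (Program.cell 7))
      (.mul (Program.scalar 13) (.get 1 (Program.cell 4) (Program.cell 7))))) hD 18
    (fun i mem => (∀ j < i, mem 5 0 j = s.real 5 0 j + s.real 13 0 0 * s.real 1 (s.nat 4 0) j) ∧
      ∀ j ≥ i, mem 5 0 j = s.real 5 0 j)
    ⟨fun j hj => absurd hj (by omega), fun _ _ => rfl⟩
    fun i hi s' hF hv hP => by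
      have n4 : s'.nat 4 = s.nat 4 := hF.nat 4 (by decide)
      have r1 : s'.real 1 = s.real 1 := hF.real 1 (by decide)
      have r13 : s'.real 13 = s.real 13 := hF.real 13 (by decide)
      refine ⟨⟨fun j hj => ?_, fun j hj => ?_⟩, ?_⟩
      · rw [exec_setReal_real]
        simp only [NatExpr.eval, RealExpr.eval, Program.cell, Program.scalar, hv, n4, r1, r13,
          true_and]
        split_ifs with h
        · rw [h, hP.2 i le_rfl]
        · exact hP.1 j (by omega)
      · rw [exec_setReal_real]
        simp only [NatExpr.eval, Program.cell, hv, true_and]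
        rw [if_neg (by omega)]
        exact hP.2 j (by omega)
      · rw [exec_setReal_steps]
        simp only [NatExpr.cost, RealExpr.cost, Program.cell, Program.scalar]
        omega
  exact ⟨h1.1, h2⟩

theorem exec_bounds {s : State} {n D : ℕ} (hn : s.nat 0 0 = n) (hD : s.nat 1 0 = D)
    (u : ℕ → ℕ → ℝ)
    (hu : ∀ i < n, ∀ j < D, u i j = ∑ k ∈ Finset.range D, s.real 4 j k * s.real 1 i k) :
    (∀ i < n, (Program.bounds.exec κ y s).real 11 i 0 =
      ∑ j ∈ Finset.range D, u i j * s.real 5 0 j +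
        √(∑ j ∈ Finset.range D, s.real 1 i j * u i j) * s.real 10 0 0) ∧
      (Program.bounds.exec κ y s).steps ≤
        s.steps + (3 + n * (33 + D * (16 + D * 19) + D * 35 + 1)) := by
  refine exec_loop_real (κ := κ) (y := y) (v := 6) (b := Program.arms) (s := s) hn
    (33 + D * (16 + D * 19) + D * 35)
    (fun l mem => ∀ i < l, mem 11 i 0 = ∑ j ∈ Finset.range D, u i j * s.real 5 0 j +
        √(∑ j ∈ Finset.range D, s.real 1 i j * u i j) * s.real 10 0 0)
    (fun i hi => absurd hi (by omega)) fun l hl s' hF hv hP => ?_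
  simp only [exec_seq]
  have n1 : s'.nat 1 0 = D := by rw [hF.nat 1 (by decide), hD]
  have r1 : s'.real 1 = s.real 1 := hF.real 1 (by decide)
  have r4 : s'.real 4 = s.real 4 := hF.real 4 (by decide)
  have r5 : s'.real 5 = s.real 5 := hF.real 5 (by decide)
  have r10 : s'.real 10 = s.real 10 := hF.real 10 (by decide)
  have F1 := exec_frame κ y (Program.matVec 6) s'
  obtain ⟨E1, C1⟩ := exec_matVec (κ := κ) (y := y) (a := 6) (Or.inr rfl) n1
  set s1 := Program.exec κ y (Program.matVec 6) s'
  have hu1 : ∀ j < D, s1.real 12 0 j = u l j := by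
    intro j hj
    rw [E1 j hj, hv, r4, r1, hu l hl j hj]
  have c1 : s1.nat 1 0 = D := by rw [F1.nat 1 (by decide), n1]
  set e2 : RealExpr := .mul (.get 12 (.lit 0) (Program.cell 7)) (.get 5 (.lit 0) (Program.cell 7))
    with he2
  have F2 := exec_frame κ y (Program.sum 6 7 e2) s1
  obtain ⟨E2, C2⟩ := exec_sum (κ := κ) (y := y) (r := 6) (v := 7) (e := e2) c1
    (fun j => u l j * s.real 5 0 j) (fun j hj s'' h7 _ hr => by
      simp only [he2, RealExpr.eval, NatExpr.eval, Program.cell]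
      rw [hr 12 (by norm_num), hr 5 (by norm_num), h7, hu1 j hj, F1.real 5 (by decide), r5])
  set s2 := Program.exec κ y (Program.sum 6 7 e2) s1
  have c2 : s2.nat 1 0 = D := by rw [F2.nat 1 (by decide), c1]
  have c6 : s2.nat 6 0 = l := by rw [F2.nat 6 (by decide), F1.nat 6 (by decide), hv]
  set e3 : RealExpr := .mul (.get 1 (Program.cell 6) (Program.cell 7))
    (.get 12 (.lit 0) (Program.cell 7)) with he3
  have F3 := exec_frame κ y (Program.sum 7 7 e3) s2
  obtain ⟨E3, C3⟩ := exec_sum (κ := κ) (y := y) (r := 7) (v := 7) (e := e3) c2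
    (fun j => s.real 1 l j * u l j) (fun j hj s'' h7 hn hr => by
      simp only [he3, RealExpr.eval, NatExpr.eval, Program.cell]
      rw [hr 12 (by norm_num), hr 1 (by norm_num), h7, hn 6 (by norm_num), c6,
        F2.real 12 (by decide), hu1 j hj, F2.real 1 (by decide), F1.real 1 (by decide), r1])
  set s3 := Program.exec κ y (Program.sum 7 7 e3) s2
  have d6 : s3.nat 6 0 = l := by rw [F3.nat 6 (by decide), c6]
  have q6 : s3.real 6 = s2.real 6 := F3.real 6 (by decide)
  have q10 : s3.real 10 = s.real 10 := by
    rw [F3.real 10 (by decide), F2.real 10 (by decide), F1.real 10 (by decide), r10]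
  have q11 : s3.real 11 = s'.real 11 := by
    rw [F3.real 11 (by decide), F2.real 11 (by decide), F1.real 11 (by decide)]
  refine ⟨fun i hi => ?_, ?_⟩
  · rw [exec_setReal_real]
    simp only [NatExpr.eval, RealExpr.eval, Program.cell, Program.scalar, d6, q6, E2, E3, q10,
      true_and, and_true]
    split_ifs with h
    · rw [h]
    · rw [q11]; exact hP i (by omega)
  · have C2' : s2.steps ≤ s1.steps + (7 + D * 17) := C2
    have C3' : s3.steps ≤ s2.steps + (7 + D * 18) := C3
    have C1' : s1.steps ≤ s'.steps + (3 + D * (16 + D * 19)) := by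
      refine C1.trans (le_of_eq ?_)
      ring
    rw [exec_setReal_steps]
    simp only [NatExpr.cost, RealExpr.cost, Program.cell, Program.scalar]
    omega

end UCBProgram

/-! ### Dependence on the past only -/

section Congr

variable {D : ℕ} {lam : ℝ} {z z' : ℕ → Fin D → ℝ}

theorem gram_congr {t : ℕ} (h : ∀ s ≤ t, z s = z' s) : gram lam z t = gram lam z' t := by
  unfold gram
  congr 1
  exact Finset.sum_congr rfl fun s hs => by rw [h s (Finset.mem_Icc.1 hs).2]

theorem psi_congr {t : ℕ} (h : ∀ s ≤ t, z s = z' s) : psi lam z t = psi lam z' t := by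
  unfold psi
  refine Finset.sum_congr rfl fun s hs => ?_
  have hs := Finset.mem_Icc.1 hs
  rw [h s hs.2, gram_congr fun r hr => h r (by omega)]

theorem sum_smul_congr {y : ℕ → ℝ} {t : ℕ} (h : ∀ s ≤ t, z s = z' s) :
    ∑ s ∈ Finset.Icc 1 t, y s • z s = ∑ s ∈ Finset.Icc 1 t, y s • z' s :=
  Finset.sum_congr rfl fun s hs => by rw [h s (Finset.mem_Icc.1 hs).2]

theorem ucb_congr {R B δ eps : ℝ} {y : ℕ → ℝ} {t : ℕ} (h : ∀ s ≤ t, z s = z' s)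
    (v : Fin D → ℝ) : ucb lam R B δ eps z y t v = ucb lam R B δ eps z' y t v := by
  unfold ucb thetaHat beta
  rw [gram_congr h, psi_congr h, sum_smul_congr h]

end Congr

/-! ### Correctness and cost of the rounds and of the whole program -/

section Rounds

variable {y : ℕ → ℝ} {X : Type*} {K : X → X → ℝ} {n : ℕ} {a : Fin n → X} {e lam R B δ : ℝ} {D : ℕ}
  {N : ℕ → X → ℝ}

/-- The inputs, the dimension and the Newton basis at all arms are in place. -/
structure HoldsData (a : Fin n → X) (e lam R B δ : ℝ) (D : ℕ) (N : ℕ → X → ℝ) (s : State) :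
    Prop where
  arms : s.nat 0 0 = n
  dim : s.nat 1 0 = D
  newton : ∀ (i : Fin n), ∀ k < D, s.real 1 i k = N k (a i)
  error : s.real 0 0 0 = e
  reg : s.real 0 0 1 = lam
  noise : s.real 0 0 2 = R
  bound : s.real 0 0 3 = B
  conf : s.real 0 0 4 = δ

/-- After `t` rounds, in which the arms number `x 1, …, x t` have been played, the memory holds the
inverse Gram matrix, the reward vector, the scaled determinant and `ψ_t`. -/
structure HoldsRounds (a : Fin n → X) (e lam R B δ : ℝ) (D : ℕ) (N : ℕ → X → ℝ) (y : ℕ → ℝ)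
    (t : ℕ) (x : ℕ → Fin n) (s : State) : Prop where
  played : s.played = (List.range t).map fun r => (x (r + 1) : ℕ)
  run : IsUCBRun (Set.range a) D N lam R B δ e t (fun r => a (x r)) y
  inverse : ∀ j k : Fin D, s.real 4 j k = (gram lam (fun r => feature N D (a (x r))) t)⁻¹ j k
  reward : ∀ j : Fin D, s.real 5 0 j =
    (∑ r ∈ Finset.Icc 1 t, y r • feature N D (a (x r))) j
  det : s.real 8 0 0 = (lam⁻¹ • gram lam (fun r => feature N D (a (x r))) t).det
  psi : s.real 9 0 0 = psi lam (fun r => feature N D (a (x r))) t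

/-- Correctness and cost of one round. The witness `x'` extends `x` by the arm played in this
round. -/
theorem exec_ucbRound (hl : 0 < lam) {s : State} (hd : HoldsData a e lam R B δ D N s) {t : ℕ}
    {x : ℕ → Fin n} (hn1 : 1 ≤ n) (hD1 : 1 ≤ D) (hs : HoldsRounds a e lam R B δ D N y t x s) :
    (∃ x', HoldsRounds a e lam R B δ D N y (t + 1) x'
      (Program.ucbRound.exec (kernelTable K a) y s)) ∧
    (Program.ucbRound.exec (kernelTable K a) y s).steps ≤ s.steps + 400 * (n * D ^ 2) := by
  obtain ⟨dn, dD, dN, de, dl, dR, dB, dδ⟩ := hd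
  obtain ⟨hplayed, hrun, hinv, hrew, hdet, hpsi⟩ := hs
  set κ := kernelTable K a with hκ
  set z : ℕ → Fin D → ℝ := fun r => feature N D (a (x r)) with hz
  have hP := gram_posDef z hl t
  -- the exploration factor
  have F1 := exec_frame κ y Program.width s
  have E1 : (Program.exec κ y Program.width s).real 10 0 0 =
      beta lam R B δ z t + B * e * psi lam z t := by
    rw [Program.width, exec_setReal_real]
    simp only [NatExpr.eval, RealExpr.eval, Program.scalar, and_self, if_true, de, dl, dR, dB, dδ,
      hdet, hpsi, beta, sq]
  have C1 : (Program.exec κ y Program.width s).steps = s.steps + 41 := rfl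
  set s1 := Program.exec κ y Program.width s
  -- the upper confidence bounds
  have F2 := exec_frame κ y Program.bounds s1
  have r4 : s1.real 4 = s.real 4 := F1.real 4 (by decide)
  have r1 : s1.real 1 = s.real 1 := F1.real 1 (by decide)
  have r5 : s1.real 5 = s.real 5 := F1.real 5 (by decide)
  have hmul : ∀ i : Fin n, ∀ j : Fin D,
      ∑ k ∈ Finset.range D, s.real 4 j k * s.real 1 i k =
        ((gram lam z t)⁻¹ *ᵥ feature N D (a i)) j := by
    intro i j
    rw [Finset.sum_range]
    simp only [Matrix.mulVec, dotProduct, feature]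
    exact Finset.sum_congr rfl fun k _ => by rw [hinv, dN i k k.2]
  obtain ⟨E2, C2⟩ := exec_bounds (κ := κ) (y := y) (s := s1) (n := n) (D := D)
    (by rw [F1.nat 0 (by decide), dn]) (by rw [F1.nat 1 (by decide), dD])
    (fun i j => ∑ k ∈ Finset.range D, s.real 4 j k * s.real 1 i k)
    (fun i _ j _ => by rw [r4, r1])
  set s2 := Program.exec κ y Program.bounds s1
  have hucb : ∀ i : Fin n, s2.real 11 i 0 = ucb lam R B δ (B * e) z y t (feature N D (a i)) := by
    intro i
    rw [E2 i i.2, E1, r1, r5, ucb, thetaHat, invNorm]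
    congr 1
    · rw [dotProduct_inv_mulVec_comm hP, Finset.sum_range, dotProduct]
      exact Finset.sum_congr rfl fun j _ => by rw [hmul i j, hrew j, mul_comm]
    · congr 2
      rw [Finset.sum_range, dotProduct]
      exact Finset.sum_congr rfl fun j _ => by rw [hmul i j, dN i j j.2]; rfl
  -- the choice of the arm
  have F3 := exec_frame κ y (Program.argmax 11) s2
  obtain ⟨hb, hbest, C3⟩ := exec_argmax (κ := κ) (y := y) (r := 11) (s := s2) (n := n)
    (by rw [F2.nat 0 (by decide), F1.nat 0 (by decide), dn]) hn1
  set s3 := Program.exec κ y (Program.argmax 11) s2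
  set b : Fin n := ⟨s3.nat 4 0, hb⟩ with hbdef
  have hb4 : s3.nat 4 0 = (b : ℕ) := rfl
  -- the interaction with the environment
  have F4 := exec_frame κ y (.play (Program.cell 4) 13 (.lit 0) (.lit 0)) s3
  have E4 : (Program.exec κ y (.play (Program.cell 4) 13 (.lit 0) (.lit 0)) s3).real 13 0 0 =
      y (s3.played.length + 1) := by
    change (State.writeReal s3 13 0 0 (y (s3.played.length + 1))).real 13 0 0 = _
    rw [State.writeReal_real, if_pos ⟨rfl, rfl, rfl⟩]
  have P4 : (Program.exec κ y (.play (Program.cell 4) 13 (.lit 0) (.lit 0)) s3).played =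
      s3.played ++ [(b : ℕ)] := rfl
  have C4 : (Program.exec κ y (.play (Program.cell 4) 13 (.lit 0) (.lit 0)) s3).steps =
      s3.steps + 5 := rfl
  set s4 := Program.exec κ y (.play (Program.cell 4) 13 (.lit 0) (.lit 0)) s3
  have p3 : s3.played = s.played := by
    rw [F3.played (by decide), F2.played (by decide), F1.played (by decide)]
  have hlen : s3.played.length = t := by rw [p3, hplayed]; simp
  have n1 : s4.nat 1 0 = D := by
    rw [F4.nat 1 (by decide), F3.nat 1 (by decide), F2.nat 1 (by decide), F1.nat 1 (by decide), dD]
  have n4 : s4.nat 4 0 = (b : ℕ) := by rw [F4.nat 4 (by decide), hb4]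
  have q4 : s4.real 4 = s.real 4 := by
    rw [F4.real 4 (by decide), F3.real 4 (by decide), F2.real 4 (by decide), r4]
  have q1 : s4.real 1 = s.real 1 := by
    rw [F4.real 1 (by decide), F3.real 1 (by decide), F2.real 1 (by decide), r1]
  -- the vector `A⁻¹ z` of the arm played, and the squared norm of `z`
  have F5 := exec_frame κ y (Program.matVec 4) s4
  obtain ⟨E5, C5⟩ := exec_matVec (κ := κ) (y := y) (a := 4) (Or.inl rfl) n1
  rw [n4, q4, q1] at E5
  set s5 := Program.exec κ y (Program.matVec 4) s4
  set v := feature N D (a b) with hv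
  have hu5 : ∀ j : Fin D, s5.real 12 0 j = ((gram lam z t)⁻¹ *ᵥ v) j := fun j => by
    rw [E5 j j.2, hmul b j]
  set e6 : RealExpr := .mul (.get 1 (Program.cell 4) (Program.cell 7))
    (.get 12 (.lit 0) (Program.cell 7)) with he6
  have F6 := exec_frame κ y (Program.sum 7 7 e6) s5
  obtain ⟨E6, C6⟩ := exec_sum (κ := κ) (y := y) (r := 7) (v := 7) (e := e6) (s := s5) (D := D)
    (by rw [F5.nat 1 (by decide), n1]) (fun j => s.real 1 b j * s5.real 12 0 j)
    (fun j hj s'' h7 hn hr => by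
      simp only [he6, RealExpr.eval, NatExpr.eval, Program.cell]
      rw [hr 12 (by norm_num), hr 1 (by norm_num), h7, hn 4 (by norm_num), F5.nat 4 (by decide), n4,
        F5.real 1 (by decide), q1])
  set s6 := Program.exec κ y (Program.sum 7 7 e6) s5
  set w := v ⬝ᵥ ((gram lam z t)⁻¹ *ᵥ v) with hw
  have E6' : s6.real 7 0 0 = w := by
    rw [E6, Finset.sum_range, hw, dotProduct]
    exact Finset.sum_congr rfl fun j _ => by rw [hu5, dN b j j.2]; rfl
  -- the updates
  have F7 := exec_frame κ y (.setReal 9 (.lit 0) (.lit 0)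
    (.add (Program.scalar 9) (.sqrt (Program.scalar 7)))) s6
  have E7 := exec_setReal_real (κ := κ) (y := y) 9 (.lit 0) (.lit 0)
    (.add (Program.scalar 9) (.sqrt (Program.scalar 7))) s6 9 0 0
  have C7 : (Program.exec κ y (.setReal 9 (.lit 0) (.lit 0)
    (.add (Program.scalar 9) (.sqrt (Program.scalar 7)))) s6).steps = s6.steps + 11 := rfl
  set s7 := Program.exec κ y (.setReal 9 (.lit 0) (.lit 0)
    (.add (Program.scalar 9) (.sqrt (Program.scalar 7)))) s6
  have F8 := exec_frame κ y (.setReal 8 (.lit 0) (.lit 0)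
    (.mul (Program.scalar 8) (.add (.lit 1) (Program.scalar 7)))) s7
  have E8 := exec_setReal_real (κ := κ) (y := y) 8 (.lit 0) (.lit 0)
    (.mul (Program.scalar 8) (.add (.lit 1) (Program.scalar 7))) s7 8 0 0
  have C8 : (Program.exec κ y (.setReal 8 (.lit 0) (.lit 0)
    (.mul (Program.scalar 8) (.add (.lit 1) (Program.scalar 7)))) s7).steps = s7.steps + 12 := rfl
  set s8 := Program.exec κ y (.setReal 8 (.lit 0) (.lit 0)
    (.mul (Program.scalar 8) (.add (.lit 1) (Program.scalar 7)))) s7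
  have m1 : s8.nat 1 0 = D := by
    rw [F8.nat 1 (by decide), F7.nat 1 (by decide), F6.nat 1 (by decide), F5.nat 1 (by decide), n1]
  have F9 := exec_frame κ y Program.rewardUpdate s8
  obtain ⟨E9, C9⟩ := exec_rewardUpdate (κ := κ) (y := y) m1
  set s9 := Program.exec κ y Program.rewardUpdate s8
  have F10 := exec_frame κ y Program.inverseUpdate s9
  obtain ⟨E10, C10⟩ := exec_inverseUpdate (κ := κ) (y := y) (s := s9) (D := D)
    (by rw [F9.nat 1 (by decide), m1])
  set s10 := Program.exec κ y Program.inverseUpdate s9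
  rw [show Program.exec κ y Program.ucbRound s = s10 from rfl]
  -- the arms played in earlier rounds are unchanged, so that all quantities up to round `t` are
  refine ⟨⟨Function.update x (t + 1) b, ?_⟩, ?_⟩
  · set x' := Function.update x (t + 1) b with hx'
    have hx't : ∀ r ≤ t, x' r = x r := fun r hr => by
      rw [hx', Function.update_of_ne (by omega)]
    have hx'b : x' (t + 1) = b := by rw [hx', Function.update_self]
    have hzz : ∀ r ≤ t, (fun r => feature N D (a (x' r))) r = z r := fun r hr => by
      simp only [hz, hx't r hr]
    have hzb : feature N D (a (x' (t + 1))) = v := by rw [hx'b]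
    refine ⟨?_, ?_, ?_, ?_, ?_, ?_⟩
    · rw [F10.played (by decide), F9.played (by decide), F8.played (by decide),
        F7.played (by decide), F6.played (by decide), F5.played (by decide), P4, p3, hplayed,
        List.range_succ, List.map_append]
      congr 1
      · refine List.map_congr_left fun r hr => ?_
        rw [hx't (r + 1) (by have := List.mem_range.1 hr; omega)]
      · simp [hx'b]
    · intro r hr
      rcases Nat.lt_or_ge r t with h | h
      · obtain ⟨h1, h2⟩ := hrun r h
        refine ⟨⟨_, rfl⟩, fun c hc => ?_⟩
        have h3 := h2 c hc
        rw [ucb_congr fun r' hr' => hzz r' (by omega), ucb_congr fun r' hr' => hzz r' (by omega)]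
        simpa only [hx't (r + 1) (by omega)] using h3
      · obtain rfl : r = t := by omega
        refine ⟨⟨_, rfl⟩, ?_⟩
        rintro _ ⟨i, rfl⟩
        rw [ucb_congr hzz, ucb_congr hzz, hzb, hv, ← hucb, ← hucb]
        exact hbest i i.2
    · intro j k
      rw [gram_succ, hzb, gram_congr hzz, inv_add_vecMulVec_self hP, E10 j j.2 k k.2,
        F9.real 4 (by decide), F8.real 4 (by decide), F7.real 4 (by decide), F6.real 4 (by decide),
        F5.real 4 (by decide), q4, hinv, F9.real 12 (by decide), F8.real 12 (by decide),
        F7.real 12 (by decide), F6.real 12 (by decide), hu5, hu5, F9.real 7 (by decide),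
        F8.real 7 (by decide), F7.real 7 (by decide), E6']
      simp only [Matrix.sub_apply, Matrix.smul_apply, Matrix.vecMulVec_apply, smul_eq_mul, ← hw]
      ring
    · intro j
      rw [F10.real 5 (by decide), E9 j j.2, F8.real 5 (by decide), F7.real 5 (by decide),
        F6.real 5 (by decide), F5.real 5 (by decide), F4.real 5 (by decide), F3.real 5 (by decide),
        F2.real 5 (by decide), r5, hrew, F8.real 13 (by decide), F7.real 13 (by decide),
        F6.real 13 (by decide), F5.real 13 (by decide), E4, hlen, F8.nat 4 (by decide),
        F7.nat 4 (by decide), F6.nat 4 (by decide), F5.nat 4 (by decide), n4, F8.real 1 (by decide),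
        F7.real 1 (by decide), F6.real 1 (by decide), F5.real 1 (by decide), q1, dN b j j.2,
        Finset.sum_Icc_succ_top (by omega), hzb,
        sum_smul_congr (z := fun r => feature N D (a (x' r))) hzz]
      simp [hv, hz, feature]
    · rw [F10.real 8 (by decide), F9.real 8 (by decide), E8, det_scaled_gram_succ _ hl, hzb,
        gram_congr hzz]
      simp only [NatExpr.eval, RealExpr.eval, Program.scalar, and_self, if_true, Nat.cast_one]
      rw [F7.real 8 (by decide), F6.real 8 (by decide), F5.real 8 (by decide),
        F4.real 8 (by decide), F3.real 8 (by decide), F2.real 8 (by decide), F1.real 8 (by decide),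
        hdet, F7.real 7 (by decide), E6']
    · rw [F10.real 9 (by decide), F9.real 9 (by decide), F8.real 9 (by decide), E7, APGUCB.psi,
        Finset.sum_Icc_succ_top (by omega), hzb, Nat.add_sub_cancel, gram_congr hzz]
      simp only [NatExpr.eval, RealExpr.eval, Program.scalar, and_self, if_true]
      rw [F6.real 9 (by decide), F5.real 9 (by decide),
        F4.real 9 (by decide), F3.real 9 (by decide), F2.real 9 (by decide), F1.real 9 (by decide),
        hpsi, E6']
      congr 1
      exact (psi_congr hzz).symm
  · have C6' : s6.steps ≤ s5.steps + (7 + D * 18) := C6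
    have hD2 : D ≤ D ^ 2 := Nat.le_self_pow two_ne_zero D
    have hD2' : 1 ≤ D ^ 2 := Nat.one_le_pow _ _ hD1
    have hnD : D ^ 2 ≤ n * D ^ 2 := Nat.le_mul_of_pos_left _ hn1
    have hn : n ≤ n * D ^ 2 := Nat.le_mul_of_pos_right _ (by omega)
    have hnD1 : n * D ≤ n * D ^ 2 := Nat.mul_le_mul_left _ hD2
    have e1 : n * (33 + D * (16 + D * 19) + D * 35 + 1) =
      34 * n + 51 * (n * D) + 19 * (n * D ^ 2) := by ring
    have e2 : D * (7 + D * 19 + 8 + 1) = 16 * D + 19 * D ^ 2 := by ring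
    have e3 : D * (4 + 27 * D) = 4 * D + 27 * D ^ 2 := by ring
    omega

/-- The program shows a complete run of APG-UCB, within `O(n T D²)` steps. -/
theorem exec_apgucb (hK : IsPosDefKernel K) (he : 0 < e) (hl : 0 < lam) (hn1 : 1 ≤ n) {T : ℕ}
    (hT : 1 ≤ T) :
    ∃ D : ℕ, ShowsAPGUCBRun K a T e lam R B δ y D
        (Program.apgucb.exec (kernelTable K a) y (initState n T e lam R B δ)) ∧
      (Program.apgucb.exec (kernelTable K a) y (initState n T e lam R B δ)).steps ≤
        600 * (n * T * D ^ 2) := by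
  set κ := kernelTable K a with hκ
  set s0 := initState n T e lam R B δ with hs0
  have F1 := exec_frame κ y Program.greedy s0
  obtain ⟨D, p, N, hout, hhold, C1⟩ := exec_greedy (y := y) (a := a) (s := s0) hK he hn1
    (by simp [hs0, initState]) (by simp [hs0, initState]) (by simp [hs0, initState])
    (by simp [hs0, initState])
  set s1 := Program.exec κ y Program.greedy s0
  have hD1 := hout.pos
  have F2 := exec_frame κ y Program.gramInit s1
  obtain ⟨E2, E2', C2⟩ := exec_gramInit (κ := κ) (y := y) hhold.dim
  set s2 := Program.exec κ y Program.gramInit s1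
  have r0 : s2.real 0 = s0.real 0 := by rw [F2.real 0 (by decide), F1.real 0 (by decide)]
  have hdata : ∀ s, s.nat 0 = s2.nat 0 → s.nat 1 = s2.nat 1 → s.real 0 = s2.real 0 →
      s.real 1 = s2.real 1 → HoldsData a e lam R B δ D N s := by
    intro s h1 h2 h3 h4
    refine ⟨?_, ?_, ?_, ?_, ?_, ?_, ?_, ?_⟩
    · rw [h1, F2.nat 0 (by decide), hhold.arms]
    · rw [h2, F2.nat 1 (by decide), hhold.dim]
    · intro i k hk
      rw [h4, F2.real 1 (by decide), hhold.newton i k hk]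
    all_goals rw [h3, r0]; simp [hs0, initState]
  have hT2 : s2.nat 0 1 = T := by
    rw [F2.nat 0 (by decide), F1.nat 0 (by decide)]; simp [hs0, initState]
  have hr1 : s1.real 0 0 1 = lam := by rw [F1.real 0 (by decide)]; simp [hs0, initState]
  have hzero : ∀ r j, r ≠ 0 → s0.real r 0 j = 0 := by
    intro r j hr
    simp [hs0, initState, hr]
  have h := exec_loop (κ := κ) (y := y) (v := 5) (b := Program.horizon) (p := Program.ucbRound)
    (s := s2) (n := T) hT2
    (fun t s => (∃ x, HoldsRounds a e lam R B δ D N y t x s) ∧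
      s.steps ≤ s2.steps + (3 + t * (400 * (n * D ^ 2) + 1)))
    ⟨⟨fun _ => ⟨0, hn1⟩, by
      refine ⟨?_, fun t ht => absurd ht (by omega), fun j k => ?_, fun j => ?_, ?_, ?_⟩
      · change s2.played = _
        rw [F2.played (by decide), F1.played (by decide)]
        simp [hs0, initState]
      · change s2.real 4 j k = _
        rw [E2 j j.2 k k.2, hr1, inv_gram_zero]
        simp [Matrix.one_apply, Fin.ext_iff]
      · change s2.real 5 0 j = _
        rw [F2.real 5 (by decide), F1.real 5 (by decide), hzero 5 j (by norm_num)]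
        simp
      · change s2.real 8 0 0 = _
        rw [E2', det_scaled_gram_zero _ hl]
      · change s2.real 9 0 0 = _
        rw [F2.real 9 (by decide), F1.real 9 (by decide), hzero 9 0 (by norm_num)]
        simp [psi]⟩, by simp [State.charge, NatExpr.cost, Program.horizon]⟩
    (fun t ht s hF hI => by
      obtain ⟨⟨x, hx⟩, hsteps⟩ := hI
      have hF' := loopStart_frame t hF
      have hx' : HoldsRounds a e lam R B δ D N y t x ((s.writeNat 5 0 t).charge 1) :=
        ⟨hx.1, hx.2, hx.3, hx.4, hx.5, hx.6⟩
      have hC : ((s.writeNat 5 0 t).charge 1).steps = s.steps + 1 := rfl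
      obtain ⟨h1, h2⟩ := exec_ucbRound (K := K) hl (hdata _ (hF'.nat 0 (by decide))
        (hF'.nat 1 (by decide)) (hF'.real 0 (by decide)) (hF'.real 1 (by decide))) hn1 hD1 hx'
      refine ⟨h1, h2.trans ?_⟩
      rw [hC, add_mul, one_mul]
      omega)
  have F3 := exec_frame κ y (.loop 5 Program.horizon Program.ucbRound) s2
  obtain ⟨⟨x, hx⟩, C3⟩ := h
  set s3 := Program.exec κ y (.loop 5 Program.horizon Program.ucbRound) s2
  rw [show Program.exec κ y Program.apgucb s0 = s3 from rfl]
  refine ⟨D, ⟨p, N, x, hout, hx.run, ?_, ?_, ?_, hx.played⟩, ?_⟩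
  · rw [F3.nat 1 (by decide), F2.nat 1 (by decide), hhold.dim]
  · intro k hk
    rw [F3.nat 2 (by decide), F2.nat 2 (by decide), hhold.points k hk]
  · intro i k hk
    rw [F3.real 1 (by decide), F2.real 1 (by decide), hhold.newton i k hk]
  · have h0 : s0.steps = 0 := rfl
    have hD2 : D ≤ D ^ 2 := Nat.le_self_pow two_ne_zero D
    have hD2' : 1 ≤ D ^ 2 := Nat.one_le_pow _ _ hD1
    have hnD : D ^ 2 ≤ n * D ^ 2 := Nat.le_mul_of_pos_left _ hn1
    have hTn : n * D ^ 2 ≤ T * (n * D ^ 2) := Nat.le_mul_of_pos_left _ hT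
    have hTT : T ≤ T * (n * D ^ 2) := Nat.le_mul_of_pos_right _ (by omega)
    have e1 : T * (400 * (n * D ^ 2) + 1) = 400 * (T * (n * D ^ 2)) + T := by ring
    have e2 : D * (14 + 7 * D) = 14 * D + 7 * D ^ 2 := by ring
    have e3 : n * T * D ^ 2 = T * (n * D ^ 2) := by ring
    rw [e3]
    omega

end Rounds

end

end APGUCB

theorem mainTheorem3 :
    -- the regret bound
    (∃ c : ℕ, ∀ R B lam α : ℝ, 0 ≤ R → 1 ≤ lam → 0 < α → ∃ C : ℝ,
      ∀ (d : ℕ) (Ω : Set (EuclideanSpace ℝ (Fin d))) (K : Ω → Ω → ℝ),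
      APGUCB.IsPosDefKernel K → (∀ x, K x x ≤ 1) →
      ∀ (H : Type*) [NormedAddCommGroup H] [InnerProductSpace ℝ H] [CompleteSpace H]
        [RKHS ℝ H Ω ℝ], APGUCB.IsRKHSOf H K →
      ∀ f : H, ‖f‖ ≤ B →
      ∀ A : Set Ω, A.Nonempty →
      -- measurability of the kernel sections; automatic if `A` is finite or `K` is continuous
      (∀ ξ ∈ A, Measurable fun x : A => K x ξ) →
      ∀ (T : ℕ) (q δ : ℝ), 1 ≤ T → 1 / 2 ≤ q → 0 < δ → δ < 1 →
      ∀ (D : ℕ) (ξ : ℕ → Ω) (N : ℕ → Ω → ℝ),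
      APGUCB.IsPGreedyOutput K A (α / (T : ℝ) ^ q) D ξ N →
      ∀ (S : Type*) [mS : MeasurableSpace S] (μ : Measure S) [IsProbabilityMeasure μ]
        (F : Filtration ℕ mS) (x : ℕ → S → Ω) (noise : ℕ → S → ℝ),
      (∀ t ∈ Finset.Icc 1 T, Measurable[F t] (x t)) →
      (∀ t ∈ Finset.Icc 1 T, Measurable[F (t + 1)] fun ω => f (x t ω) + noise t ω) →
      APGUCB.IsCondSubGaussian μ F R T noise →
      (∀ ω, APGUCB.IsUCBRun A D N lam R B δ (α / (T : ℝ) ^ q) T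
        (fun t => x t ω) (fun t => f (x t ω) + noise t ω)) →
      1 - δ ≤ μ.real {ω | APGUCB.regret A f T (fun t => x t ω) ≤
        C * Real.log (T + 1) ^ c * (√(T * D * Real.log (1 / δ)) + D * √T)}) ∧
    -- the computational complexity
    (∃ (P : APGUCB.Program) (C : ℕ),
      ∀ (d : ℕ) (Ω : Set (EuclideanSpace ℝ (Fin d))) (K : Ω → Ω → ℝ),
      APGUCB.IsPosDefKernel K → (∀ x, K x x ≤ 1) →
      ∀ (n : ℕ) (a : Fin n → Ω), 1 ≤ n → Function.Injective a →
      ∀ (T : ℕ) (q α lam R B δ : ℝ), 1 ≤ T → 1 / 2 ≤ q → 0 < α → 1 ≤ lam → 0 ≤ R → 0 ≤ B →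
      0 < δ → δ < 1 →
      ∀ y : ℕ → ℝ, ∃ D : ℕ,
        APGUCB.ShowsAPGUCBRun K a T (α / (T : ℝ) ^ q) lam R B δ y D
          (P.exec (APGUCB.kernelTable K a) y
            (APGUCB.initState n T (α / (T : ℝ) ^ q) lam R B δ)) ∧
        (P.exec (APGUCB.kernelTable K a) y
          (APGUCB.initState n T (α / (T : ℝ) ^ q) lam R B δ)).steps ≤ C * (n * T * D ^ 2)) := by
  refine ⟨⟨1, fun R B lam α hR hl hα => ⟨12 * (B * α) + 16 * R + 8 * (√lam * B), ?_⟩⟩,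
    ⟨APGUCB.Program.apgucb, 600, ?_⟩⟩
  · intro d Ω K hK hK1 H _ _ _ _ hH f hf A hA hAm T q δ hT hq hδ hδ1 D ξ N hG S _ μ _ F x noise
      hx hy hsub hrun
    exact APGUCB.le_measureReal_regret_le hK hK1 hH hR hl hα f hf hA hAm hT hq hδ hδ1 hG μ F x
      noise hx hy hsub hrun
  · intro d Ω K hK _ n a hn _ T q α lam R B δ hT _ hα hl _ _ _ _ y
    have hT0 : (0 : ℝ) < T := by exact_mod_cast hT
    exact APGUCB.exec_apgucb hK (by positivity) (by linarith) hn hT
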